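/- Let $k$ be a field of characteristic $0$, $R=k[q,q^{-1}]$, $K=k(q)$. Let $\widehat F_q[SL_n]$ be the unital associative $R$-algebra generated by $\rho_{ij}$ ($1\le i,j\le n$) with relations $$\rho_{ij}\rho_{il}=q\,\rho_{il}\rho_{ij}\ (j<l),\quad \rho_{il}\rho_{hl}=q\,\rho_{hl}\rho_{il}\ (i<h),\quad \rho_{il}\rho_{jm}=\rho_{jm}\rho_{il},\quad \rho_{im}\rho_{jl}-\rho_{jl}\rho_{im}=(q-q^{-1})\rho_{il}\rho_{jm}\ (i<j,\ m<l),$$ $$\textstyle\sum_{\sigma\in S_n}(-q)^{\ell(\sigma)}\rho_{1,\sigma(1)}\cdots\rho_{n,\sigma(n)}=1 .$$ It is a Hopf algebra over $R$ with $\Delta(\rho_{ij})=\sum_l\rho_{il}\otimes\rho_{lj}$, $\epsilon(\rho_{ij})=\delta_{ij}$ and $S(\rho_{ij})=(-q)^{i-j}\,{\det}_q\big((\rho_{hl})_{h\ne j,\,l\ne i}\big)$. Put $F_q[SL_n]=K\otimes_R\widehat F_q[SL_n]$, let $I$ be the kernel of $\widehat F_q[SL_n]\xrightarrow{\ \epsilon\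 }R\xrightarrow{\ q\mapsto1\ }k$, and $$\widetilde F_q[SL_n]:=\sum_{m\ge0}\big((q-1)^{-1}I\big)^m\subseteq F_q[SL_n].$$ Let $\mathfrak{sl}_n$ carry its standard Lie cobracket $\delta(x)=[x\otimes1+1\otimes x,\ \sum_{i<j}(E_{ji}\otimes E_{ij}-E_{ij}\otimes E_{ji})]$ (so $\delta(e_i)=h_i\otimes e_i-e_i\otimes h_i$, $\delta(f_i)=h_i\otimes f_i-f_i\otimes h_i$, $\delta(h_i)=0$), let $\mathfrak{sl}_n^*$ be the dual Lie bialgebra (its bracket and cobracket are the transposes of $\delta$ and of the bracket of $\mathfrak{sl}_n$), and let $U(\mathfrak{sl}_n^*)$ carry its standard Hopf structure and the Poisson cobracket which extends the Lie cobracket of $\mathfrak{sl}_n^*$ by $\delta(ab)=\delta(a)\Delta(b)+\Delta(a)\delta(b)$. **Theorem.** (1) For every $n$, $\widetilde F_q[SL_n]$ is the unital $R$-subalgebra of $F_q[SL_n]$ generated by $r_{ij}:=(\rho_{ij}-\delta_{ij})/(q-1)$, $1\le i,j\le n$. It spans $F_q[SL_n]$ over $K$, and it is a Hopf algebra over $R$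 whose Hopf structure extends that of $\widehat F_q[SL_n]$. For $a\in\widetilde F_q[SL_n]$, $\Delta(a)-\Delta^{op}(a)$ is divisible by $q-1$, and $\widetilde F_q[SL_n]/(q-1)\widetilde F_q[SL_n]$, with the induced Hopf structure and the cobracket $\delta(a\bmod (q-1))=\frac{\Delta(a)-\Delta^{op}(a)}{q-1}\bmod(q-1)$, is a co-Poisson Hopf algebra. There is an isomorphism of co-Poisson Hopf algebras $$\widetilde F_q[SL_n]\big/(q-1)\widetilde F_q[SL_n]\ \cong\ U(\mathfrak{sl}_n^*)$$ sending the class of $r_{ij}$ to the functional $X\mapsto X_{ij}$ on $\mathfrak{sl}_n$. (2) For $n=2$, the elements $H_+=r_{11}$, $E=r_{12}$, $F=r_{21}$, $H_-=r_{22}$ generate $\widetilde F_q[SL_2]$ and satisfy $$H_+E=qEH_++E,\quad H_+F=qFH_++F,\quad EH_-=qH_-E+E,\quad FH_-=qH_-F+F,$$ $$EF=FE,\quad H_+H_--H_-H_+=(q-q^{-1})EF,\quad H_-+H_+=(q-1)(qEF-H_+H_-),$$ with $$\Delta(H_+)=H_+\otimes1+1\otimes H_++(q-1)(H_+\otimes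 H_++E\otimes F),\quad \Delta(E)=E\otimes1+1\otimes E+(q-1)(H_+\otimes E+E\otimes H_-),$$ $$\Delta(F)=F\otimes1+1\otimes F+(q-1)(F\otimes H_++H_-\otimes F),\quad \Delta(H_-)=H_-\otimes1+1\otimes H_-+(q-1)(H_-\otimes H_-+F\otimes E),$$ $\epsilon(H_\pm)=\epsilon(E)=\epsilon(F)=0$, and $S(H_\pm)=H_\mp$, $S(E)=-q^{-1}E$, $S(F)=-qF$. The Lie bialgebra $\mathfrak{sl}_2^*$ has the basis $\mathrm f,\mathrm h,\mathrm e$ dual to the Chevalley basis $f,h,e$ of $\mathfrak{sl}_2$, with $[\mathrm h,\mathrm e]=\mathrm e$, $[\mathrm h,\mathrm f]=\mathrm f$, $[\mathrm e,\mathrm f]=0$, $\delta(\mathrm f)=2(\mathrm f\otimes\mathrm h-\mathrm h\otimes\mathrm f)$, $\delta(\mathrm h)=\mathrm e\otimes\mathrm f-\mathrm f\otimes\mathrm e$, $\delta(\mathrm e)=2(\mathrm h\otimes\mathrm e-\mathrm e\otimes\mathrm h)$. The isomorphism of co-Poisson Hopf algebras $\widetilde F_q[SL_2]/(q-1)\widetilde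 F_q[SL_2]\cong U(\mathfrak{sl}_2^*)$ is given by $H_\pm\mapsto\pm\mathrm h$, $E\mapsto\mathrm e$, $F\mapsto\mathrm f$. -/

import Mathlib

open scoped TensorProduct LaurentPolynomial

set_option linter.unusedSectionVars false

namespace GQDP

/-- A Hopf algebra structure over `R` on a given `R`-algebra `A`. -/
structure HopfStr (R A : Type*) [CommRing R] [Ring A] [Algebra R A] where
  comul : A →ₐ[R] A ⊗[R] A
  counit : A →ₐ[R] R
  antipode : A →ₗ[R] A
  coassoc : (TensorProduct.assoc R A A A).toLinearMap ∘ₗ comul.toLinearMap.rTensor A ∘ₗ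
      comul.toLinearMap = comul.toLinearMap.lTensor A ∘ₗ comul.toLinearMap
  rTensor_counit : counit.toLinearMap.rTensor A ∘ₗ comul.toLinearMap = TensorProduct.mk R R A 1
  lTensor_counit : counit.toLinearMap.lTensor A ∘ₗ comul.toLinearMap =
      (TensorProduct.mk R A R).flip 1
  mul_antipode_rTensor : LinearMap.mul' R A ∘ₗ antipode.rTensor A ∘ₗ comul.toLinearMap =
      Algebra.linearMap R A ∘ₗ counit.toLinearMap
  mul_antipode_lTensor : LinearMap.mul' R A ∘ₗ antipode.lTensor A ∘ₗ comul.toLinearMap =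
      Algebra.linearMap R A ∘ₗ counit.toLinearMap

/-- The corresponding Mathlib Hopf algebra. -/
abbrev HopfStr.toHopfAlgebra {R A : Type*} [CommRing R] [Ring A] [Algebra R A]
    (H : HopfStr R A) : HopfAlgebra R A where
  comul := H.comul.toLinearMap
  counit := H.counit.toLinearMap
  coassoc := H.coassoc
  rTensor_counit_comp_comul := H.rTensor_counit
  lTensor_counit_comp_comul := H.lTensor_counit
  counit_one := map_one H.counit
  mul_compr₂_counit := by ext; simp
  comul_one := map_one H.comul
  mul_compr₂_comul := by ext; simp
  antipode := H.antipode
  mul_antipode_rTensor_comul := H.mul_antipode_rTensor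
  mul_antipode_lTensor_comul := H.mul_antipode_lTensor

section UEA
variable (k : Type*) [Field k] (L : Type*) [LieRing L] [LieAlgebra k L]
attribute [local instance 100] LieRing.ofAssociativeRing

local notation "U" => UniversalEnvelopingAlgebra k L

/-- `x ↦ x ⊗ 1 + 1 ⊗ x`. -/
def envComulLie : L →ₗ⁅k⁆ (U ⊗[k] U) where
  toFun x := UniversalEnvelopingAlgebra.ι k x ⊗ₜ[k] (1 : U) +
    (1 : U) ⊗ₜ[k] UniversalEnvelopingAlgebra.ι k x
  map_add' x y := by simp only [map_add, TensorProduct.add_tmul, TensorProduct.tmul_add]; abel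
  map_smul' c x := by
    simp only [map_smul, TensorProduct.smul_tmul', TensorProduct.tmul_smul, smul_add,
      RingHom.id_apply]
  map_lie' {x y} := by
    simp only [LieHom.map_lie, LieRing.of_associative_ring_bracket, add_mul, mul_add,
      Algebra.TensorProduct.tmul_mul_tmul, one_mul, mul_one, TensorProduct.sub_tmul,
      TensorProduct.tmul_sub]
    abel

/-- The coproduct of `U(L)`: elements of `L` are primitive. -/
def envComul : U →ₐ[k] U ⊗[k] U := UniversalEnvelopingAlgebra.lift k (envComulLie k L)

/-- The counit of `U(L)`. -/
def envCounit : U →ₐ[k] k := UniversalEnvelopingAlgebra.lift k (0 : L →ₗ⁅k⁆ k)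

/-- `x ↦ -x`, with values in the opposite algebra. -/
def envAntipodeLie : L →ₗ⁅k⁆ Uᵐᵒᵖ where
  toFun x := -MulOpposite.op (UniversalEnvelopingAlgebra.ι k x)
  map_add' x y := by simp only [map_add, MulOpposite.op_add]; abel
  map_smul' c x := by simp
  map_lie' {x y} := by
    simp only [LieHom.map_lie, LieRing.of_associative_ring_bracket, neg_mul_neg,
      ← MulOpposite.op_mul, ← MulOpposite.op_sub, ← MulOpposite.op_neg, neg_sub]

/-- The antipode of `U(L)`. -/
def envAntipode : U →ₗ[k] U :=
  (MulOpposite.opLinearEquiv k).symm.toLinearMap ∘ₗ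
    (UniversalEnvelopingAlgebra.lift k (envAntipodeLie k L)).toLinearMap

variable {k L}
theorem envComul_ι (x : L) : envComul k L (UniversalEnvelopingAlgebra.ι k x) =
    UniversalEnvelopingAlgebra.ι k x ⊗ₜ[k] (1 : U) + (1 : U) ⊗ₜ[k] UniversalEnvelopingAlgebra.ι k x :=
  UniversalEnvelopingAlgebra.lift_ι_apply k _ x

theorem envCounit_ι (x : L) : envCounit k L (UniversalEnvelopingAlgebra.ι k x) = 0 :=
  UniversalEnvelopingAlgebra.lift_ι_apply k _ x

theorem envAntipode_ι (x : L) : envAntipode k L (UniversalEnvelopingAlgebra.ι k x) =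
    -UniversalEnvelopingAlgebra.ι k x := by
  have h : UniversalEnvelopingAlgebra.lift k (envAntipodeLie k L)
      (UniversalEnvelopingAlgebra.ι k x) = envAntipodeLie k L x :=
    UniversalEnvelopingAlgebra.lift_ι_apply k _ x
  rw [envAntipode, LinearMap.comp_apply, AlgHom.toLinearMap_apply, h]
  rfl

theorem envAntipode_mul (a b : U) : envAntipode k L (a * b) =
    envAntipode k L b * envAntipode k L a := by simp [envAntipode]

theorem envAntipode_one : envAntipode k L 1 = 1 := by simp [envAntipode]

theorem env_algHom_ext {A : Type*} [Ring A] [Algebra k A] {f g : U →ₐ[k] A}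
    (h : ∀ x, f (UniversalEnvelopingAlgebra.ι k x) = g (UniversalEnvelopingAlgebra.ι k x)) :
    f = g := UniversalEnvelopingAlgebra.hom_ext k (LieHom.ext h)

theorem env_induction {P : U → Prop} (hι : ∀ x, P (UniversalEnvelopingAlgebra.ι k x))
    (hc : ∀ c : k, P (algebraMap k U c)) (ha : ∀ a b, P a → P b → P (a + b))
    (hm : ∀ a b, P a → P b → P (a * b)) (a : U) : P a := by
  let S : Subalgebra k U :=
    { carrier := {a | P a}
      mul_mem' := fun h h' => hm _ _ h h'
      add_mem' := fun h h' => ha _ _ h h'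
      algebraMap_mem' := hc }
  let f : L →ₗ⁅k⁆ S :=
    { toFun := fun x => ⟨UniversalEnvelopingAlgebra.ι k x, hι x⟩
      map_add' := fun x y => Subtype.ext (map_add _ _ _)
      map_smul' := fun x y => Subtype.ext (map_smul _ _ _)
      map_lie' := fun {x y} => Subtype.ext (LieHom.map_lie _ _ _) }
  have h : S.val.comp (UniversalEnvelopingAlgebra.lift k f) = AlgHom.id k U := by
    ext x
    have := UniversalEnvelopingAlgebra.lift_ι_apply k f x
    simp only [LieHom.comp_apply, AlgHom.coe_toLieHom, AlgHom.comp_apply, this]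
    rfl
  have := congrArg (fun g => g a) h
  simp only [AlgHom.comp_apply, AlgHom.id_apply] at this
  rw [← this]
  exact (UniversalEnvelopingAlgebra.lift k f a).2

variable (k L)
/-- The standard Hopf algebra structure of `U(L)`. -/
def envHopf : HopfStr k U where
  comul := envComul k L
  counit := envCounit k L
  antipode := envAntipode k L
  coassoc := by
    have : ((Algebra.TensorProduct.assoc k k k U U U).toAlgHom.comp
        (Algebra.TensorProduct.map (envComul k L) (AlgHom.id k U))).comp (envComul k L) =
        (Algebra.TensorProduct.map (AlgHom.id k U) (envComul k L)).comp (envComul k L) := by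
      refine env_algHom_ext fun x => ?_
      simp only [AlgHom.comp_apply, envComul_ι, map_add,
        Algebra.TensorProduct.map_tmul, map_one, AlgHom.id_apply, TensorProduct.add_tmul,
        TensorProduct.tmul_add, Algebra.TensorProduct.one_def]
      simp [add_assoc, -UniversalEnvelopingAlgebra.ι_apply]
    exact congrArg AlgHom.toLinearMap this
  rTensor_counit := by
    have : (Algebra.TensorProduct.map (envCounit k L) (AlgHom.id k U)).comp (envComul k L) =
        (Algebra.TensorProduct.includeRight : U →ₐ[k] k ⊗[k] U) := by
      refine env_algHom_ext fun x => ?_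
      simp only [AlgHom.comp_apply, envComul_ι, map_add,
        Algebra.TensorProduct.map_tmul, map_one, AlgHom.id_apply, envCounit_ι]
      simp [-UniversalEnvelopingAlgebra.ι_apply]
    exact congrArg AlgHom.toLinearMap this
  lTensor_counit := by
    have : (Algebra.TensorProduct.map (AlgHom.id k U) (envCounit k L)).comp (envComul k L) =
        (Algebra.TensorProduct.includeLeft : U →ₐ[k] U ⊗[k] k) := by
      refine env_algHom_ext fun x => ?_
      simp only [AlgHom.comp_apply, envComul_ι, map_add,
        Algebra.TensorProduct.map_tmul, map_one, AlgHom.id_apply, envCounit_ι]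
      simp [-UniversalEnvelopingAlgebra.ι_apply]
    exact congrArg AlgHom.toLinearMap this
  mul_antipode_rTensor := by
    have key : ∀ a : U, ∀ w : U ⊗[k] U,
        LinearMap.mul' k U ((envAntipode k L).rTensor U (envComul k L a * w)) =
        envCounit k L a • LinearMap.mul' k U ((envAntipode k L).rTensor U w) := by
      intro a
      induction a using env_induction with
      | hι x =>
        intro w
        induction w with
        | zero => simp
        | add u v hu hv => rw [mul_add, map_add, map_add, hu, hv, map_add, map_add, smul_add]
        | tmul u v =>
          simp only [envComul_ι, envCounit_ι, add_mul, Algebra.TensorProduct.tmul_mul_tmul,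
            map_add, LinearMap.rTensor_tmul, LinearMap.mul'_apply, envAntipode_mul,
            envAntipode_ι, one_mul, zero_smul, mul_neg, neg_mul, mul_assoc, neg_add_cancel]
      | hc c =>
        intro w
        rw [AlgHom.commutes, AlgHom.commutes, ← Algebra.smul_def, map_smul, map_smul]
        rfl
      | ha a b h h' => intro w; simp only [map_add, add_mul, add_smul, h, h']
      | hm a b h h' =>
        intro w
        rw [map_mul (envComul k L), mul_assoc, h, h', map_mul, mul_smul]
    ext a
    have := key a 1
    rw [mul_one] at this
    simpa [Algebra.TensorProduct.one_def, envAntipode_one, Algebra.algebraMap_eq_smul_one]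
      using this
  mul_antipode_lTensor := by
    have key : ∀ a : U, ∀ w : U ⊗[k] U,
        LinearMap.mul' k U ((envAntipode k L).lTensor U (w * envComul k L a)) =
        envCounit k L a • LinearMap.mul' k U ((envAntipode k L).lTensor U w) := by
      intro a
      induction a using env_induction with
      | hι x =>
        intro w
        induction w with
        | zero => simp
        | add u v hu hv => rw [add_mul, map_add, map_add, hu, hv, map_add, map_add, smul_add]
        | tmul u v =>
          simp only [envComul_ι, envCounit_ι, mul_add, Algebra.TensorProduct.tmul_mul_tmul,
            map_add, LinearMap.lTensor_tmul, LinearMap.mul'_apply, envAntipode_mul,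
            envAntipode_ι, mul_one, zero_smul, mul_neg, neg_mul, mul_assoc, add_neg_cancel]
      | hc c =>
        intro w
        rw [AlgHom.commutes, AlgHom.commutes, ← Algebra.commutes, ← Algebra.smul_def, map_smul,
          map_smul]
        rfl
      | ha a b h h' => intro w; simp only [map_add, mul_add, add_smul, h, h']
      | hm a b h h' =>
        intro w
        rw [map_mul (envComul k L), ← mul_assoc, h', h, map_mul, mul_smul, smul_comm]
    ext a
    have := key a 1
    rw [one_mul] at this
    simpa [Algebra.TensorProduct.one_def, envAntipode_one, Algebra.algebraMap_eq_smul_one]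
      using this

end UEA

section LieBialg
variable {k : Type*} [Field k] {L : Type*} [LieRing L] [LieAlgebra k L]

/-- The bracket on `L*` which is the transpose of `d : L → L ⊗ L`. -/
def dualBracket (d : L →ₗ[k] L ⊗[k] L) (φ ψ : Module.Dual k L) : Module.Dual k L :=
  TensorProduct.dualDistrib k L L (φ ⊗ₜ[k] ψ) ∘ₗ d

variable (k L) in
/-- A Lie bialgebra structure on the Lie algebra `L`: a skew-symmetric 1-cocycle
`L → L ⊗ L` whose transpose satisfies the Jacobi identity on `L*`. -/
structure LieBialgebraStr where
  cobracket : L →ₗ[k] L ⊗[k] L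
  skew : ∀ x, TensorProduct.comm k L L (cobracket x) = -cobracket x
  jacobi : ∀ φ ψ χ : Module.Dual k L,
    dualBracket cobracket φ (dualBracket cobracket ψ χ) +
      dualBracket cobracket ψ (dualBracket cobracket χ φ) +
      dualBracket cobracket χ (dualBracket cobracket φ ψ) = 0
  cocycle : ∀ x y, cobracket ⁅x, y⁆ = ⁅x, cobracket y⁆ - ⁅y, cobracket x⁆

theorem dualBracket_skew (d : L →ₗ[k] L ⊗[k] L)
    (hd : ∀ x, TensorProduct.comm k L L (d x) = -d x) (φ ψ : Module.Dual k L) :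
    dualBracket d φ ψ = -dualBracket d ψ φ := by
  have h : ∀ t : L ⊗[k] L, TensorProduct.dualDistrib k L L (φ ⊗ₜ[k] ψ) (TensorProduct.comm k L L t)
      = TensorProduct.dualDistrib k L L (ψ ⊗ₜ[k] φ) t := by
    intro t
    induction t with
    | zero => simp
    | add a b ha hb => simp only [map_add, ha, hb]
    | tmul a b => simp [mul_comm]
  ext x
  have := h (d x)
  rw [hd, map_neg] at this
  simp only [dualBracket, LinearMap.comp_apply, LinearMap.neg_apply, ← this, neg_neg]

/-- The dual space `L*` of a Lie bialgebra, carrying the transpose of the Lie cobracket as its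
Lie bracket. -/
def LieBialgebraStr.Dual (_B : LieBialgebraStr k L) : Type _ := Module.Dual k L

namespace LieBialgebraStr
variable (B : LieBialgebraStr k L)

instance : AddCommGroup B.Dual := inferInstanceAs (AddCommGroup (Module.Dual k L))
instance : Module k B.Dual := inferInstanceAs (Module k (Module.Dual k L))
instance [FiniteDimensional k L] : FiniteDimensional k B.Dual :=
  inferInstanceAs (FiniteDimensional k (Module.Dual k L))

/-- `L*` as a plain dual space. -/
def toDual : B.Dual ≃ₗ[k] Module.Dual k L := LinearEquiv.refl k _

/-- `dualBracket` as a bilinear map. -/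
def bracketₗ : Module.Dual k L →ₗ[k] Module.Dual k L →ₗ[k] Module.Dual k L :=
  LinearMap.mk₂ k (dualBracket B.cobracket)
    (fun a b c => by simp [dualBracket, TensorProduct.add_tmul, LinearMap.add_comp])
    (fun a b c => by simp [dualBracket, ← TensorProduct.smul_tmul', LinearMap.smul_comp])
    (fun a b c => by simp [dualBracket, TensorProduct.tmul_add, LinearMap.add_comp])
    (fun a b c => by simp [dualBracket, TensorProduct.tmul_smul, LinearMap.smul_comp])

instance [CharZero k] : LieRing B.Dual where
  __ := (inferInstance : AddCommGroup B.Dual)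
  bracket φ ψ := dualBracket B.cobracket φ ψ
  add_lie a b c := (B.bracketₗ).map_add₂ a b c
  lie_add a b c := (B.bracketₗ a).map_add b c
  lie_self a := by
    have h : dualBracket B.cobracket a a = -dualBracket B.cobracket a a :=
      dualBracket_skew _ B.skew a a
    have h2 : (2 : k) • dualBracket B.cobracket a a = 0 := by
      rw [two_smul]; nth_rewrite 1 [h]; exact neg_add_cancel _
    exact (smul_eq_zero.mp h2).resolve_left two_ne_zero
  leibniz_lie a b c := by
    have h := B.jacobi a b c
    change dualBracket _ a (dualBracket _ b c) =
      dualBracket _ (dualBracket _ a b) c + dualBracket _ b (dualBracket _ a c)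
    rw [dualBracket_skew _ B.skew (dualBracket _ a b) c, dualBracket_skew _ B.skew a c]
    have h2 : dualBracket B.cobracket b (-dualBracket B.cobracket c a) =
      -dualBracket B.cobracket b (dualBracket B.cobracket c a) :=
      (B.bracketₗ b).map_neg _
    rw [h2]
    rw [← sub_eq_zero, ← h]; abel

instance [CharZero k] : LieAlgebra k B.Dual where
  __ := (inferInstance : Module k B.Dual)
  lie_smul c a b := (B.bracketₗ a).map_smul c b


variable [CharZero k]

theorem toDual_lie (φ ψ : B.Dual) :
    B.toDual ⁅φ, ψ⁆ = dualBracket B.cobracket (B.toDual φ) (B.toDual ψ) := rfl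

/-- The pairing of tensors `L* ⊗ L*` with `L ⊗ L`. -/
def pair₂ : B.Dual ⊗[k] B.Dual →ₗ[k] Module.Dual k (L ⊗[k] L) :=
  TensorProduct.dualDistrib k L L

theorem pair₂_tmul (φ ψ : B.Dual) (x y : L) :
    B.pair₂ (φ ⊗ₜ[k] ψ) (x ⊗ₜ[k] y) = B.toDual φ x * B.toDual ψ y := rfl

variable [FiniteDimensional k L]

/-- The Lie cobracket of `L*`: the transpose of the Lie bracket of `L`. -/
noncomputable def dualCobracket : B.Dual →ₗ[k] B.Dual ⊗[k] B.Dual :=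
  (TensorProduct.dualDistribEquiv k L L).symm.toLinearMap ∘ₗ
    (TensorProduct.lift (LieModule.toEnd k L L : L →ₗ[k] Module.End k L)).dualMap ∘ₗ
      B.toDual.toLinearMap

theorem pair₂_dualCobracket (φ : B.Dual) (x y : L) :
    B.pair₂ (B.dualCobracket φ) (x ⊗ₜ[k] y) = B.toDual φ ⁅x, y⁆ := by
  have h := (TensorProduct.dualDistribEquiv k L L).apply_symm_apply
    ((TensorProduct.lift (LieModule.toEnd k L L : L →ₗ[k] Module.End k L)).dualMap (B.toDual φ))
  have h2 := congrArg (fun f => f (x ⊗ₜ[k] y)) h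
  exact h2

theorem pair₂_ext {s t : B.Dual ⊗[k] B.Dual}
    (h : ∀ x y, B.pair₂ s (x ⊗ₜ[k] y) = B.pair₂ t (x ⊗ₜ[k] y)) : s = t := by
  apply (TensorProduct.dualDistribEquiv k L L).injective
  exact TensorProduct.ext' h

theorem pair₂_comm (t : B.Dual ⊗[k] B.Dual) (x y : L) :
    B.pair₂ (TensorProduct.comm k _ _ t) (x ⊗ₜ[k] y) = B.pair₂ t (y ⊗ₜ[k] x) := by
  induction t with
  | zero => simp
  | add a b ha hb => simp only [map_add, LinearMap.add_apply, ha, hb]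
  | tmul a b => simp [pair₂_tmul, mul_comm]

theorem pair₂_lie (φ : B.Dual) (t : B.Dual ⊗[k] B.Dual) (x y : L) :
    B.pair₂ ⁅φ, t⁆ (x ⊗ₜ[k] y) =
      TensorProduct.dualDistrib k L L
        (B.toDual φ ⊗ₜ[k] (B.pair₂ t ∘ₗ (TensorProduct.mk k L L).flip y)) (B.cobracket x) +
      TensorProduct.dualDistrib k L L
        (B.toDual φ ⊗ₜ[k] (B.pair₂ t ∘ₗ TensorProduct.mk k L L x)) (B.cobracket y) := by
  induction t with
  | zero => simp
  | add a b ha hb =>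
    simp only [lie_add, map_add, LinearMap.add_apply, ha, hb, LinearMap.add_comp,
      TensorProduct.tmul_add]
    abel
  | tmul a b =>
    have h1 : B.pair₂ (a ⊗ₜ[k] b) ∘ₗ (TensorProduct.mk k L L).flip y =
        B.toDual b y • B.toDual a := by
      ext z; exact mul_comm _ _
    have h2 : B.pair₂ (a ⊗ₜ[k] b) ∘ₗ TensorProduct.mk k L L x =
        B.toDual a x • B.toDual b := by
      ext z; rfl
    rw [TensorProduct.LieModule.lie_tmul_right, h1, h2, map_add, LinearMap.add_apply,
      pair₂_tmul, pair₂_tmul, TensorProduct.tmul_smul, TensorProduct.tmul_smul, map_smul,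
      map_smul, LinearMap.smul_apply, LinearMap.smul_apply, smul_eq_mul, smul_eq_mul,
      toDual_lie, toDual_lie, mul_comm]
    rfl

theorem dualDistrib_lie (f g : Module.Dual k L) (x : L) (u : L ⊗[k] L) :
    TensorProduct.dualDistrib k L L (f ⊗ₜ[k] g) ⁅x, u⁆ =
      TensorProduct.dualDistrib k L L (f ⊗ₜ[k] (g ∘ₗ (LieModule.toEnd k L L x))) u +
      TensorProduct.dualDistrib k L L (g ⊗ₜ[k] (f ∘ₗ (LieModule.toEnd k L L x)))
        (TensorProduct.comm k L L u) := by
  induction u with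
  | zero => simp
  | add a b ha hb => simp only [lie_add, map_add, ha, hb]; abel
  | tmul a b =>
    rw [TensorProduct.LieModule.lie_tmul_right]
    simp [mul_comm, add_comm]

theorem dualDistrib_neg (f g : Module.Dual k L) (u : L ⊗[k] L) :
    TensorProduct.dualDistrib k L L (f ⊗ₜ[k] (-g)) u =
      -TensorProduct.dualDistrib k L L (f ⊗ₜ[k] g) u := by
  rw [← neg_one_smul k g, TensorProduct.tmul_smul, map_smul, LinearMap.smul_apply, neg_one_smul]

theorem dual_cocycle (φ ψ : B.Dual) : B.dualCobracket ⁅φ, ψ⁆ =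
    ⁅φ, B.dualCobracket ψ⁆ - ⁅ψ, B.dualCobracket φ⁆ := by
  apply B.pair₂_ext
  intro x y
  have h1 : ∀ (χ : B.Dual), B.pair₂ (B.dualCobracket χ) ∘ₗ (TensorProduct.mk k L L).flip y =
      -(B.toDual χ ∘ₗ (LieModule.toEnd k L L y)) := by
    intro χ; ext z
    refine (B.pair₂_dualCobracket χ z y).trans ?_
    rw [← lie_skew, map_neg]; rfl
  have h2 : ∀ (χ : B.Dual), B.pair₂ (B.dualCobracket χ) ∘ₗ TensorProduct.mk k L L x =
      B.toDual χ ∘ₗ (LieModule.toEnd k L L x) := by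
    intro χ; ext z
    exact B.pair₂_dualCobracket χ x z
  rw [pair₂_dualCobracket, toDual_lie, map_sub, LinearMap.sub_apply, pair₂_lie, pair₂_lie,
    h1, h1, h2, h2, dualBracket, LinearMap.comp_apply, B.cocycle, map_sub, dualDistrib_lie,
    dualDistrib_lie, B.skew, B.skew]
  simp only [dualDistrib_neg, map_neg]
  ring

/-- The dual Lie bialgebra `L*`. -/
noncomputable def dual : LieBialgebraStr k B.Dual where
  cobracket := B.dualCobracket
  skew φ := by
    apply B.pair₂_ext
    intro x y
    rw [pair₂_comm, pair₂_dualCobracket, map_neg, LinearMap.neg_apply, pair₂_dualCobracket,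
      ← lie_skew, map_neg]
  jacobi := by
    let ev : L →ₗ[k] Module.Dual k B.Dual := Module.Dual.eval k L
    have hev : ∀ f : Module.Dual k B.Dual, ∃ x : L, f = ev x := fun f => by
      obtain ⟨x, hx⟩ := (Module.evalEquiv k L).surjective f
      exact ⟨x, hx.symm⟩
    have hbr : ∀ x y : L, dualBracket B.dualCobracket
        (ev x) (ev y) =
        ev ⁅x, y⁆ := by
      intro x y
      ext φ
      have h : ∀ t : B.Dual ⊗[k] B.Dual, TensorProduct.dualDistrib k B.Dual B.Dual
        ((ev x) ⊗ₜ[k]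
          (ev y)) t = B.pair₂ t (x ⊗ₜ[k] y) := by
        intro t
        induction t with
        | zero => simp
        | add a b ha hb => simp only [map_add, LinearMap.add_apply, ha, hb]
        | tmul a b => rfl
      exact (h _).trans (B.pair₂_dualCobracket φ x y)
    intro f g h
    obtain ⟨x, rfl⟩ := hev f
    obtain ⟨y, rfl⟩ := hev g
    obtain ⟨z, rfl⟩ := hev h
    rw [hbr, hbr, hbr, hbr, hbr, hbr, ← map_add, ← map_add, lie_jacobi, map_zero]
  cocycle := B.dual_cocycle

end LieBialgebraStr
end LieBialg

section CoPoisson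
variable (k : Type*) [Field k] (L : Type*) [LieRing L] [LieAlgebra k L]
attribute [local instance 100] LieRing.ofAssociativeRing
local notation "U" => UniversalEnvelopingAlgebra k L

variable {k L}
/-- `L ⊗ L → U(L) ⊗ U(L)`. -/
def envTensor : L ⊗[k] L →ₗ[k] U ⊗[k] U :=
  TensorProduct.map (UniversalEnvelopingAlgebra.ι k (L := L)).toLinearMap
    (UniversalEnvelopingAlgebra.ι k (L := L)).toLinearMap

theorem envTensor_lie (x : L) (t : L ⊗[k] L) : envTensor ⁅x, t⁆ =
    envComul k L (UniversalEnvelopingAlgebra.ι k x) * envTensor t -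
      envTensor t * envComul k L (UniversalEnvelopingAlgebra.ι k x) := by
  induction t with
  | zero => simp
  | add a b ha hb => simp only [lie_add, map_add, ha, hb, mul_add, add_mul]; abel
  | tmul a b =>
    rw [TensorProduct.LieModule.lie_tmul_right, map_add]
    simp only [envTensor, TensorProduct.map_tmul, LieHom.coe_toLinearMap, LieHom.map_lie,
      LieRing.of_associative_ring_bracket, envComul_ι, add_mul, mul_add,
      Algebra.TensorProduct.tmul_mul_tmul, one_mul, mul_one, TensorProduct.sub_tmul,
      TensorProduct.tmul_sub]
    abel

/-- `x ↦ Δ(x) + ε δ(x)` (`ε² = 0`), used to extend the Lie cobracket `δ` to `U(L)`. -/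
def LieBialgebraStr.envLie (B : LieBialgebraStr k L) : L →ₗ⁅k⁆ DualNumber (U ⊗[k] U) where
  toFun x := TrivSqZeroExt.inl (envComul k L (UniversalEnvelopingAlgebra.ι k x)) +
    TrivSqZeroExt.inr (envTensor (B.cobracket x))
  map_add' x y := by ext <;> simp only [map_add, TrivSqZeroExt.fst_add, TrivSqZeroExt.snd_add, TrivSqZeroExt.fst_inl, TrivSqZeroExt.snd_inl, TrivSqZeroExt.fst_inr, TrivSqZeroExt.snd_inr, add_zero, zero_add]
  map_smul' c x := by ext <;> simp only [map_smul, TrivSqZeroExt.fst_add, TrivSqZeroExt.snd_add, TrivSqZeroExt.fst_inl, TrivSqZeroExt.snd_inl, TrivSqZeroExt.fst_inr, TrivSqZeroExt.snd_inr, add_zero, zero_add, TrivSqZeroExt.fst_smul, TrivSqZeroExt.snd_smul, RingHom.id_apply]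
  map_lie' {x y} := by
    rw [LieRing.of_associative_ring_bracket]
    ext
    · simp only [LieHom.map_lie, LieRing.of_associative_ring_bracket, map_sub, map_mul, TrivSqZeroExt.fst_sub,
        TrivSqZeroExt.fst_add, TrivSqZeroExt.fst_mul, TrivSqZeroExt.fst_inl, TrivSqZeroExt.fst_inr, add_zero]
    · simp only [B.cocycle, map_sub, envTensor_lie, TrivSqZeroExt.snd_add,
        TrivSqZeroExt.snd_sub, TrivSqZeroExt.fst_add, TrivSqZeroExt.snd_mul, TrivSqZeroExt.fst_inl,
        TrivSqZeroExt.fst_inr, TrivSqZeroExt.snd_inl, TrivSqZeroExt.snd_inr, add_zero, zero_add,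
        smul_eq_mul, MulOpposite.smul_eq_mul_unop, MulOpposite.unop_op]
      abel

/-- The Poisson cobracket of `U(L)`: the extension `δ` of the Lie cobracket of `L` such that
`δ(ab) = δ(a) Δ(b) + Δ(a) δ(b)`. -/
def LieBialgebraStr.envCobracket (B : LieBialgebraStr k L) : U →ₗ[k] U ⊗[k] U :=
  (TrivSqZeroExt.sndHom (U ⊗[k] U) (U ⊗[k] U)).restrictScalars k ∘ₗ
    (UniversalEnvelopingAlgebra.lift k B.envLie).toLinearMap

theorem LieBialgebraStr.envCobracket_ι (B : LieBialgebraStr k L) (x : L) :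
    B.envCobracket (UniversalEnvelopingAlgebra.ι k x) = envTensor (B.cobracket x) := by
  have h := UniversalEnvelopingAlgebra.lift_ι_apply k B.envLie x
  rw [envCobracket, LinearMap.comp_apply, AlgHom.toLinearMap_apply, h]
  exact zero_add _

theorem LieBialgebraStr.envCobracket_mul (B : LieBialgebraStr k L) (a b : U) :
    B.envCobracket (a * b) =
      B.envCobracket a * envComul k L b + envComul k L a * B.envCobracket b := by
  have h : (TrivSqZeroExt.fstHom k (U ⊗[k] U) (U ⊗[k] U)).comp
      (UniversalEnvelopingAlgebra.lift k B.envLie) = envComul k L := by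
    refine env_algHom_ext fun x => ?_
    have h := UniversalEnvelopingAlgebra.lift_ι_apply k B.envLie x
    rw [AlgHom.comp_apply, h]
    exact add_zero _
  have hf : ∀ a, (UniversalEnvelopingAlgebra.lift k B.envLie a).fst = envComul k L a :=
    fun a => congrArg (fun f => f a) h
  have : (UniversalEnvelopingAlgebra.lift k B.envLie (a * b)).snd =
    (UniversalEnvelopingAlgebra.lift k B.envLie a).fst * (UniversalEnvelopingAlgebra.lift k B.envLie b).snd +
    (UniversalEnvelopingAlgebra.lift k B.envLie a).snd * (UniversalEnvelopingAlgebra.lift k B.envLie b).fst := by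
    rw [map_mul, TrivSqZeroExt.snd_mul]; rfl
  rw [hf, hf, add_comm] at this
  exact this
end CoPoisson

section SL
variable (n : ℕ) (k : Type*) [Field k]
attribute [local instance 100] LieRing.ofAssociativeRing
open LieAlgebra.SpecialLinear

/-- The Lie algebra `sl_n(k)`. -/
abbrev Sl := sl (Fin n) k

/-- The tensor `∑_{i<j} (E_ji ⊗ E_ij - E_ij ⊗ E_ji)`. -/
noncomputable def slR : Sl n k ⊗[k] Sl n k :=
  ∑ p : {p : Fin n × Fin n // p.1 < p.2},
    (single p.1.2 p.1.1 p.2.ne' (1 : k) ⊗ₜ[k] single p.1.1 p.1.2 p.2.ne (1 : k) -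
      single p.1.1 p.1.2 p.2.ne (1 : k) ⊗ₜ[k] single p.1.2 p.1.1 p.2.ne' (1 : k))

/-- The standard Lie cobracket of `sl_n`, `x ↦ x · r`. On Chevalley generators it reads
`δ(e_i) = h_i ⊗ e_i - e_i ⊗ h_i`, `δ(f_i) = h_i ⊗ f_i - f_i ⊗ h_i`, `δ(h_i) = 0`. -/
noncomputable def slCobracket : Sl n k →ₗ[k] Sl n k ⊗[k] Sl n k :=
  (LieModule.toEnd k (Sl n k) (Sl n k ⊗[k] Sl n k) :
    Sl n k →ₗ[k] Module.End k (Sl n k ⊗[k] Sl n k)).flip (slR n k)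

theorem slCobracket_apply (x : Sl n k) : slCobracket n k x = ⁅x, slR n k⁆ := rfl

theorem slCobracket_skew (x : Sl n k) :
    TensorProduct.comm k _ _ (slCobracket n k x) = -slCobracket n k x := by
  have h : ∀ t : Sl n k ⊗[k] Sl n k, TensorProduct.comm k (Sl n k) (Sl n k) ⁅x, t⁆ =
      ⁅x, TensorProduct.comm k (Sl n k) (Sl n k) t⁆ := by
    intro t
    induction t with
    | zero => simp
    | add a b ha hb => simp only [lie_add, map_add, ha, hb]
    | tmul a b => simp [TensorProduct.LieModule.lie_tmul_right, add_comm]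
  have h2 : TensorProduct.comm k _ _ (slR n k) = -slR n k := by
    simp [slR, map_sum, map_sub, ← Finset.sum_neg_distrib]
  rw [slCobracket_apply, h, h2, lie_neg]

variable {n k}
/-- Strictly upper triangular part minus strictly lower triangular part. -/
def triR (M : Matrix (Fin n) (Fin n) k) : Matrix (Fin n) (Fin n) k :=
  Matrix.of fun i j => if i < j then M i j else if j < i then -M i j else 0

/-- Strictly upper triangular part. -/
def upPart (M : Matrix (Fin n) (Fin n) k) : Matrix (Fin n) (Fin n) k :=
  Matrix.of fun i j => if i < j then M i j else 0
/-- Strictly lower triangular part. -/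
def loPart (M : Matrix (Fin n) (Fin n) k) : Matrix (Fin n) (Fin n) k :=
  Matrix.of fun i j => if j < i then M i j else 0
/-- Diagonal part. -/
def diPart (M : Matrix (Fin n) (Fin n) k) : Matrix (Fin n) (Fin n) k :=
  Matrix.of fun i j => if i = j then M i j else 0

theorem triR_add (M N : Matrix (Fin n) (Fin n) k) : triR (M + N) = triR M + triR N := by
  ext i j; simp only [triR, Matrix.of_apply, Matrix.add_apply]; split_ifs <;> ring
theorem triR_neg (M : Matrix (Fin n) (Fin n) k) : triR (-M) = -triR M := by
  ext i j; simp only [triR, Matrix.of_apply, Matrix.neg_apply]; split_ifs <;> ring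
theorem triR_sub (M N : Matrix (Fin n) (Fin n) k) : triR (M - N) = triR M - triR N := by
  rw [sub_eq_add_neg, triR_add, triR_neg, ← sub_eq_add_neg]
theorem triR_eq (M : Matrix (Fin n) (Fin n) k) : triR M = upPart M - loPart M := by
  ext i j; simp only [triR, upPart, loPart, Matrix.of_apply, Matrix.sub_apply]
  rcases lt_trichotomy i j with h | h | h
  · simp [h, h.not_gt]
  · simp [h]
  · simp [h, h.not_gt]
theorem part_eq (M : Matrix (Fin n) (Fin n) k) : M = upPart M + diPart M + loPart M := by
  ext i j; simp only [diPart, upPart, loPart, Matrix.of_apply, Matrix.add_apply]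
  rcases lt_trichotomy i j with h | h | h
  · simp [h, h.not_gt, h.ne]
  · simp [h]
  · simp [h, h.not_gt, h.ne']

theorem triR_of_up {M : Matrix (Fin n) (Fin n) k} (h : ∀ i j, ¬ i < j → M i j = 0) :
    triR M = M := by
  ext i j; simp only [triR, Matrix.of_apply]
  split_ifs with h1 h2
  · rfl
  · rw [h i j h1, neg_zero]
  · rw [h i j h1]
theorem triR_of_lo {M : Matrix (Fin n) (Fin n) k} (h : ∀ i j, ¬ j < i → M i j = 0) :
    triR M = -M := by
  ext i j; simp only [triR, Matrix.of_apply, Matrix.neg_apply]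
  split_ifs with h1 h2
  · rw [h i j h1.not_gt, neg_zero]
  · rfl
  · rw [h i j h2, neg_zero]

theorem mul_zero_of (P Q S : Fin n → Fin n → Prop) (hS : ∀ i l j, P i l → Q l j → S i j)
    {M N : Matrix (Fin n) (Fin n) k}
    (hM : ∀ i j, ¬ P i j → M i j = 0) (hN : ∀ i j, ¬ Q i j → N i j = 0) (i j : Fin n)
    (h : ¬ S i j) : (M * N) i j = 0 := by
  rw [Matrix.mul_apply]
  refine Finset.sum_eq_zero fun l _ => ?_
  by_cases h1 : P i l
  · by_cases h2 : Q l j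
    · exact absurd (hS i l j h1 h2) h
    · rw [hN l j h2, mul_zero]
  · rw [hM i l h1, zero_mul]

theorem upPart_z (M : Matrix (Fin n) (Fin n) k) (i j : Fin n) (h : ¬ i < j) : upPart M i j = 0 :=
  if_neg h
theorem loPart_z (M : Matrix (Fin n) (Fin n) k) (i j : Fin n) (h : ¬ j < i) : loPart M i j = 0 :=
  if_neg h
theorem diPart_z (M : Matrix (Fin n) (Fin n) k) (i j : Fin n) (h : ¬ i = j) : diPart M i j = 0 :=
  if_neg h

theorem triR_uu (M N : Matrix (Fin n) (Fin n) k) :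
    triR (upPart M * upPart N) = upPart M * upPart N :=
  triR_of_up (mul_zero_of (fun i j => i < j) (fun i j => i < j) (fun i j => i < j)
    (fun _ _ _ => lt_trans) (upPart_z M) (upPart_z N))
theorem triR_ud (M N : Matrix (Fin n) (Fin n) k) :
    triR (upPart M * diPart N) = upPart M * diPart N :=
  triR_of_up (mul_zero_of _ _ _ (fun _ _ _ h h' => h' ▸ h) (upPart_z M) (diPart_z N))
theorem triR_du (M N : Matrix (Fin n) (Fin n) k) :
    triR (diPart M * upPart N) = diPart M * upPart N :=
  triR_of_up (mul_zero_of _ _ _ (fun _ _ _ h h' => h ▸ h') (diPart_z M) (upPart_z N))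
theorem triR_ll (M N : Matrix (Fin n) (Fin n) k) :
    triR (loPart M * loPart N) = -(loPart M * loPart N) :=
  triR_of_lo (mul_zero_of (fun i j => j < i) (fun i j => j < i) _ (fun _ _ _ h h' => lt_trans h' h)
    (loPart_z M) (loPart_z N))
theorem triR_ld (M N : Matrix (Fin n) (Fin n) k) :
    triR (loPart M * diPart N) = -(loPart M * diPart N) :=
  triR_of_lo (mul_zero_of (fun i j => j < i) _ _ (fun _ _ _ h h' => h' ▸ h)
    (loPart_z M) (diPart_z N))
theorem triR_dl (M N : Matrix (Fin n) (Fin n) k) :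
    triR (diPart M * loPart N) = -(diPart M * loPart N) :=
  triR_of_lo (mul_zero_of _ (fun i j => j < i) _ (fun _ _ _ h h' => h ▸ h')
    (diPart_z M) (loPart_z N))

theorem diPart_comm (M N : Matrix (Fin n) (Fin n) k) : diPart M * diPart N = diPart N * diPart M := by
  have h : ∀ M : Matrix (Fin n) (Fin n) k, diPart M = Matrix.diagonal fun i => M i i := by
    intro M; ext i j; simp only [diPart, Matrix.of_apply, Matrix.diagonal_apply]
    split_ifs with h
    · rw [h]
    · rfl
  rw [h, h, Matrix.diagonal_mul_diagonal, Matrix.diagonal_mul_diagonal]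
  simp only [mul_comm]

/-- the bracket `[RM, N] + [M, RN]` -/
def triBr (M N : Matrix (Fin n) (Fin n) k) : Matrix (Fin n) (Fin n) k :=
  (triR M * N - N * triR M) + (M * triR N - triR N * M)

theorem triR_triBr (M N : Matrix (Fin n) (Fin n) k) :
    triR (triBr M N) = (triR M * triR N - triR N * triR M) + (M * N - N * M) := by
  have huu := triR_uu M N
  have huu' := triR_uu N M
  have hud := triR_ud M N
  have hud' := triR_ud N M
  have hdu := triR_du M N
  have hdu' := triR_du N M
  have hll := triR_ll M N
  have hll' := triR_ll N M
  have hld := triR_ld M N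
  have hld' := triR_ld N M
  have hdl := triR_dl M N
  have hdl' := triR_dl N M
  have hM := part_eq M
  have hN := part_eq N
  have hd := diPart_comm M N
  rw [triBr, triR_eq M, triR_eq N]
  generalize upPart M = u at *
  generalize upPart N = u' at *
  generalize loPart M = l at *
  generalize loPart N = l' at *
  generalize diPart M = d at *
  generalize diPart N = d' at *
  subst hM hN
  have hb : (u - l) * (u' + d' + l') - (u' + d' + l') * (u - l) +
      ((u + d + l) * (u' - l') - (u' - l') * (u + d + l)) =
      (u * u' + u * u') - (u' * u + u' * u) + (u * d' - d' * u) + (d * u' - u' * d)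
        - (l * l' + l * l') + (l' * l + l' * l) - (l * d' - d' * l) - (d * l' - l' * d) := by
    noncomm_ring
  rw [hb]
  simp only [triR_add, triR_sub, huu, huu', hud, hud', hdu, hdu', hll, hll', hld, hld', hdl, hdl']
  have hc : (u + d + l) * (u' + d' + l') - (u' + d' + l') * (u + d + l) =
      (u + d + l) * (u' + d' + l') - (u' + d' + l') * (u + d + l) - (d * d' - d' * d) := by
    rw [hd, sub_self, sub_zero]
  rw [hc]
  noncomm_ring

theorem triBr_jacobi (M N P : Matrix (Fin n) (Fin n) k) :
    triBr M (triBr N P) + triBr N (triBr P M) + triBr P (triBr M N) = 0 := by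
  rw [triBr, triR_triBr, triBr.eq_1 N (triBr P M), triR_triBr, triBr.eq_1 P (triBr M N), triR_triBr]
  simp only [triBr]
  noncomm_ring


/-- The functional `X ↦ tr(M X)` on `sl_n`. -/
def trForm (M : Matrix (Fin n) (Fin n) k) : Module.Dual k (Sl n k) :=
  Matrix.traceLinearMap (Fin n) k k ∘ₗ LinearMap.mulLeft k M ∘ₗ (Sl n k).toSubmodule.subtype

theorem trForm_apply (M : Matrix (Fin n) (Fin n) k) (X : Sl n k) :
    trForm M X = (M * X.val).trace := rfl

theorem trForm_surj (φ : Module.Dual k (Sl n k)) : ∃ M, φ = trForm M := by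
  obtain ⟨g, hg⟩ := LinearMap.exists_extend (p := (Sl n k).toSubmodule) φ
  refine ⟨Matrix.of fun i j => g (Matrix.single j i 1), ?_⟩
  ext X
  have h1 : φ X = g X.val := (LinearMap.congr_fun hg X).symm
  rw [h1, trForm_apply]
  conv_lhs => rw [Matrix.matrix_eq_sum_single X.val]
  simp only [map_sum, Matrix.trace, Matrix.diag, Matrix.mul_apply, Matrix.of_apply]
  rw [Finset.sum_comm]
  refine Finset.sum_congr rfl fun i _ => Finset.sum_congr rfl fun j _ => ?_
  have : Matrix.single j i (X.val j i) = X.val j i • Matrix.single j i (1 : k) := by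
    rw [Matrix.smul_single, smul_eq_mul, mul_one]
  rw [this, map_smul, smul_eq_mul, mul_comm]

theorem triR_sum (N : Matrix (Fin n) (Fin n) k) :
    triR N = ∑ p : {p : Fin n × Fin n // p.1 < p.2},
      (N p.1.1 p.1.2 • Matrix.single p.1.1 p.1.2 (1 : k) -
        N p.1.2 p.1.1 • Matrix.single p.1.2 p.1.1 (1 : k)) := by
  ext i j
  rw [Matrix.sum_apply]
  simp only [triR, Matrix.of_apply, Matrix.sub_apply, Matrix.smul_apply, Matrix.single_apply,
    smul_eq_mul, mul_ite, mul_one, mul_zero]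
  rw [Finset.sum_sub_distrib]
  rcases lt_trichotomy i j with h | h | h
  · rw [if_pos h, Finset.sum_eq_single ⟨(i, j), h⟩, Finset.sum_eq_zero]
    · simp
    · rintro ⟨⟨a, b⟩, hp⟩ -
      refine if_neg ?_
      rintro ⟨rfl, rfl⟩
      exact h.not_gt hp
    · rintro ⟨⟨a, b⟩, hp⟩ - hne
      refine if_neg ?_
      rintro ⟨rfl, rfl⟩
      exact hne rfl
    · simp
  · subst h
    rw [if_neg (lt_irrefl _), if_neg (lt_irrefl _), Finset.sum_eq_zero, Finset.sum_eq_zero, sub_zero]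
    · rintro ⟨⟨a, b⟩, hp⟩ -
      refine if_neg ?_
      rintro ⟨h1, h2⟩
      exact hp.ne' (h1.trans h2.symm)
    · rintro ⟨⟨a, b⟩, hp⟩ -
      refine if_neg ?_
      rintro ⟨h1, h2⟩
      exact hp.ne' (h2.trans h1.symm)
  · rw [if_neg h.not_gt, if_pos h, Finset.sum_eq_zero, Finset.sum_eq_single ⟨(j, i), h⟩]
    · simp
    · rintro ⟨⟨a, b⟩, hp⟩ - hne
      refine if_neg ?_
      rintro ⟨rfl, rfl⟩
      exact hne rfl
    · simp
    · rintro ⟨⟨a, b⟩, hp⟩ -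
      refine if_neg ?_
      rintro ⟨rfl, rfl⟩
      exact h.not_gt hp

theorem dualBracket_trForm (M N : Matrix (Fin n) (Fin n) k) :
    dualBracket (slCobracket n k) (trForm M) (trForm N) = trForm (triBr M N) := by
  ext X
  have e1 : ∀ (Q : Matrix (Fin n) (Fin n) k) (i j : Fin n),
      (Q * Matrix.single i j (1 : k)).trace = Q j i := by
    intro Q i j; simp [Matrix.trace_mul_single]
  have h1 : ∀ P Q : Matrix (Fin n) (Fin n) k, (P * (X.val * triR Q - triR Q * X.val)).trace =
      ∑ p : {p : Fin n × Fin n // p.1 < p.2},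
      (Q p.1.1 p.1.2 * (P * (X.val * Matrix.single p.1.1 p.1.2 (1 : k) -
          Matrix.single p.1.1 p.1.2 (1 : k) * X.val)).trace -
        Q p.1.2 p.1.1 * (P * (X.val * Matrix.single p.1.2 p.1.1 (1 : k) -
          Matrix.single p.1.2 p.1.1 (1 : k) * X.val)).trace) := by
    intro P Q
    rw [triR_sum, Finset.mul_sum, Finset.sum_mul, ← Finset.sum_sub_distrib, Finset.mul_sum,
      Matrix.trace_sum]
    refine Finset.sum_congr rfl fun p _ => ?_
    simp only [mul_sub, sub_mul, mul_smul_comm, smul_mul_assoc, Matrix.trace_sub,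
      Matrix.trace_smul, smul_eq_mul]
    ring
  have h2 : dualBracket (slCobracket n k) (trForm M) (trForm N) X =
      (N * (X.val * triR M - triR M * X.val)).trace -
        (M * (X.val * triR N - triR N * X.val)).trace := by
    rw [h1, h1, ← Finset.sum_sub_distrib, dualBracket, LinearMap.comp_apply, slCobracket_apply,
      slR]
    have : ∀ (s : Finset {p : Fin n × Fin n // p.1 < p.2})
        (f : {p : Fin n × Fin n // p.1 < p.2} → Sl n k ⊗[k] Sl n k),
        ⁅X, ∑ p ∈ s, f p⁆ = ∑ p ∈ s, ⁅X, f p⁆ := fun s f =>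
      map_sum (LieModule.toEnd k (Sl n k) (Sl n k ⊗[k] Sl n k) X) f s
    rw [this, map_sum]
    refine Finset.sum_congr rfl fun p _ => ?_
    rw [lie_sub, TensorProduct.LieModule.lie_tmul_right, TensorProduct.LieModule.lie_tmul_right]
    simp only [map_sub, map_add, TensorProduct.dualDistrib_apply, trForm_apply, sl_bracket,
      val_single, e1]
    ring
  rw [h2, trForm_apply, triBr]
  simp only [mul_sub, sub_mul, add_mul, Matrix.trace_sub, Matrix.trace_add]
  have c1 : (M * (X.val * triR N)).trace = (triR N * M * X.val).trace := by
    rw [← mul_assoc, Matrix.trace_mul_comm, mul_assoc]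
  have c2 : (N * (X.val * triR M)).trace = (triR M * N * X.val).trace := by
    rw [← mul_assoc, Matrix.trace_mul_comm, mul_assoc]
  rw [c1, c2, mul_assoc M, mul_assoc N]
  ring

variable (n k)
/-- `sl_n` with the standard Lie bialgebra structure. -/
noncomputable def slBialgebra : LieBialgebraStr k (Sl n k) where
  cobracket := slCobracket n k
  skew := slCobracket_skew n k
  jacobi φ ψ χ := by
    obtain ⟨M, rfl⟩ := trForm_surj φ
    obtain ⟨N, rfl⟩ := trForm_surj ψ
    obtain ⟨P, rfl⟩ := trForm_surj χ
    have hadd : ∀ A B : Matrix (Fin n) (Fin n) k, trForm A + trForm B = trForm (A + B) := by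
      intro A B; ext X
      simp only [LinearMap.add_apply, trForm_apply, add_mul, Matrix.trace_add]
    simp only [dualBracket_trForm, hadd, triBr_jacobi]
    ext X
    simp [trForm_apply]
  cocycle x y := by
    simp only [slCobracket_apply, lie_lie]

/-- The dual Lie bialgebra `sl_n*`. -/
abbrev SlDual := (slBialgebra n k).Dual

/-- The matrix coefficient `X ↦ X_ij` as an element of `sl_n*`. -/
noncomputable def slCoord (i j : Fin n) : SlDual n k :=
  (slBialgebra n k).toDual.symm
    (Matrix.entryLinearMap k k i j ∘ₗ (Sl n k).toSubmodule.subtype)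

end SL


section Quantum

open LaurentPolynomial

variable (n : ℕ) (k : Type*) [Field k]

/-- `q - 1` in `k[q, q⁻¹]`; the variable `q` is `T 1`. -/
noncomputable def qSub : k[T;T⁻¹] := T 1 - 1

/-- Evaluation at `q = 1`. -/
noncomputable def evOne : k[T;T⁻¹] →+* k := eval₂ (RingHom.id k) 1

/-- The field `k(q)`. -/
def RatQ := FractionRing k[T;T⁻¹]

noncomputable instance : Field (RatQ k) := inferInstanceAs (Field (FractionRing k[T;T⁻¹]))
noncomputable instance : Algebra k[T;T⁻¹] (RatQ k) :=
  inferInstanceAs (Algebra k[T;T⁻¹] (FractionRing k[T;T⁻¹]))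
instance : IsFractionRing k[T;T⁻¹] (RatQ k) :=
  inferInstanceAs (IsFractionRing k[T;T⁻¹] (FractionRing k[T;T⁻¹]))

variable {n k} in
/-- The length (number of inversions) of a permutation. -/
def invNum (σ : Equiv.Perm (Fin n)) : ℕ :=
  (Finset.univ.filter fun p : Fin n × Fin n => p.1 < p.2 ∧ σ p.2 < σ p.1).card

variable {n k} in
/-- The quantum determinant `∑_σ (-q)^{l(σ)} x_{1,σ(1)} ⋯ x_{m,σ(m)}`. -/
noncomputable def qDet {A : Type*} [Ring A] [Algebra k[T;T⁻¹] A] (x : Fin n → Fin n → A) : A :=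
  ∑ σ : Equiv.Perm (Fin n), ((-T 1 : k[T;T⁻¹]) ^ invNum σ) • (List.ofFn fun i => x i (σ i)).prod

/-- The free algebra on the generators `ρ_ij`. -/
abbrev GenAlg := FreeAlgebra k[T;T⁻¹] (Fin n × Fin n)

variable {n} in
/-- The free generators. -/
noncomputable def gen (i j : Fin n) : GenAlg n k := FreeAlgebra.ι k[T;T⁻¹] (i, j)

/-- The defining relations of the quantum function algebra of `SL_n`. -/
inductive SlRel : GenAlg n k → GenAlg n k → Prop
  | row (i j l : Fin n) (h : j < l) :
      SlRel (gen k i j * gen k i l) ((T 1 : k[T;T⁻¹]) • (gen k i l * gen k i j))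
  | col (i h l : Fin n) (hh : i < h) :
      SlRel (gen k i l * gen k h l) ((T 1 : k[T;T⁻¹]) • (gen k h l * gen k i l))
  | comm (i j m l : Fin n) (h : i < j) (h' : m < l) :
      SlRel (gen k i l * gen k j m) (gen k j m * gen k i l)
  | cross (i j m l : Fin n) (h : i < j) (h' : m < l) :
      SlRel (gen k i m * gen k j l - gen k j l * gen k i m)
        ((T 1 - T (-1) : k[T;T⁻¹]) • (gen k i l * gen k j m))
  | det : SlRel (qDet (k := k) (gen k)) 1

/-- The quantum function algebra of `SL_n` over `k[q, q⁻¹]`. -/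
def FHat := RingQuot (SlRel n k)

noncomputable instance : Ring (FHat n k) := inferInstanceAs (Ring (RingQuot (SlRel n k)))
noncomputable instance : Algebra k[T;T⁻¹] (FHat n k) :=
  inferInstanceAs (Algebra k[T;T⁻¹] (RingQuot (SlRel n k)))

/-- The quotient map from the free algebra. -/
noncomputable def mkHat : GenAlg n k →ₐ[k[T;T⁻¹]] FHat n k := RingQuot.mkAlgHom k[T;T⁻¹] (SlRel n k)


variable {n} in
/-- The generators `ρ_ij`. -/
noncomputable def rho (i j : Fin n) : FHat n k := mkHat n k (gen k i j)

/-- The counit, `ρ_ij ↦ δ_ij`. -/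
noncomputable def counitHat : FHat n k →ₐ[k[T;T⁻¹]] k[T;T⁻¹] :=
  RingQuot.liftAlgHom k[T;T⁻¹] ⟨FreeAlgebra.lift k[T;T⁻¹] fun p => if p.1 = p.2 then 1 else 0, by
    intro x y h
    induction h with
    | row i j l h =>
      simp only [gen, map_mul, map_smul, FreeAlgebra.lift_ι_apply]
      by_cases h1 : i = j
      · subst h1; simp [h.ne]
      · simp [h1]
    | col i h l hh =>
      simp only [gen, map_mul, map_smul, FreeAlgebra.lift_ι_apply]
      by_cases h1 : i = l
      · subst h1; simp [hh.ne']
      · simp [h1]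
    | comm i j m l h h' => rw [map_mul, map_mul, mul_comm]
    | cross i j m l h h' =>
      simp only [gen, map_sub, map_mul, map_smul, FreeAlgebra.lift_ι_apply]
      rw [mul_comm, sub_self]
      by_cases h1 : i = l
      · subst h1; simp [(h'.trans h).ne']
      · simp [h1]
    | det =>
      simp only [qDet, map_sum, map_smul, map_list_prod, List.map_ofFn, map_one]
      rw [Finset.sum_eq_single 1]
      · have : invNum (1 : Equiv.Perm (Fin n)) = 0 := by
          rw [invNum, Finset.card_eq_zero, Finset.filter_eq_empty_iff]
          rintro p - ⟨h1, h2⟩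
          exact h1.not_gt h2
        simp [this, gen, Function.comp_def]
      · intro σ _ hσ
        obtain ⟨i, hi⟩ : ∃ i, σ i ≠ i := by
          by_contra hc
          push Not at hc
          exact hσ (Equiv.ext hc)
        rw [List.prod_ofFn, Finset.prod_eq_zero (Finset.mem_univ i), smul_zero]
        simp [gen, Ne.symm hi]
      · simp⟩

theorem counitHat_rho (i j : Fin n) : counitHat n k (rho k i j) = if i = j then 1 else 0 := by
  exact (RingQuot.liftAlgHom_mkAlgHom_apply _ _ _ _).trans (by simp [gen])

/-- `k(q) ⊗ FHat`, the quantum function algebra over `k(q)`. -/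
def Fq := RatQ k ⊗[k[T;T⁻¹]] FHat n k

noncomputable instance : Ring (Fq n k) := inferInstanceAs (Ring (RatQ k ⊗[k[T;T⁻¹]] FHat n k))
noncomputable instance : Algebra (RatQ k) (Fq n k) :=
  inferInstanceAs (Algebra (RatQ k) (RatQ k ⊗[k[T;T⁻¹]] FHat n k))
noncomputable instance : Algebra k[T;T⁻¹] (Fq n k) :=
  inferInstanceAs (Algebra k[T;T⁻¹] (RatQ k ⊗[k[T;T⁻¹]] FHat n k))
instance : IsScalarTower k[T;T⁻¹] (RatQ k) (Fq n k) :=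
  inferInstanceAs (IsScalarTower k[T;T⁻¹] (RatQ k) (RatQ k ⊗[k[T;T⁻¹]] FHat n k))

/-- The canonical map `FHat → Fq`. -/
noncomputable def toFq : FHat n k →ₐ[k[T;T⁻¹]] Fq n k :=
  (Algebra.TensorProduct.includeRight : FHat n k →ₐ[k[T;T⁻¹]] RatQ k ⊗[k[T;T⁻¹]] FHat n k)

/-- The ideal `I`, kernel of the counit followed by evaluation at `q = 1`. -/
noncomputable def augIdeal : Ideal (FHat n k) :=
  RingHom.ker ((evOne k).comp (counitHat n k).toRingHom)

/-- `(q - 1)⁻¹ I` inside `Fq`. -/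
noncomputable def scaledAug : Submodule k[T;T⁻¹] (Fq n k) :=
  (((augIdeal n k).restrictScalars k[T;T⁻¹]).map (toFq n k).toLinearMap).map
    (LinearMap.lsmul (RatQ k) (Fq n k) (algebraMap k[T;T⁻¹] (RatQ k) (qSub k))⁻¹ |>.restrictScalars k[T;T⁻¹])

/-- `∑_m ((q - 1)⁻¹ I)^m`. -/
noncomputable def tildeModule : Submodule k[T;T⁻¹] (Fq n k) := ⨆ m : ℕ, scaledAug n k ^ m

/-- `∑_m ((q - 1)⁻¹ I)^m` as a `k[q, q⁻¹]`-subalgebra of `Fq`. -/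
noncomputable def Ftilde : Subalgebra k[T;T⁻¹] (Fq n k) :=
  (tildeModule n k).toSubalgebra
    (by
      refine (le_iSup (fun m : ℕ => scaledAug n k ^ m) 0) ?_
      rw [pow_zero]; exact Submodule.one_le.mp le_rfl)
    (by
      intro x y hx hy
      have h : tildeModule n k * tildeModule n k ≤ tildeModule n k := by
        rw [tildeModule, Submodule.iSup_mul]
        refine iSup_le fun a => ?_
        rw [Submodule.mul_iSup]
        refine iSup_le fun b => ?_
        rw [← pow_add]
        exact le_iSup (fun m : ℕ => scaledAug n k ^ m) (a + b)
      exact h (Submodule.mul_mem_mul hx hy))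

theorem scaledAug_le : scaledAug n k ≤ Subalgebra.toSubmodule (Ftilde n k) := by
  have := le_iSup (fun m : ℕ => scaledAug n k ^ m) 1
  rwa [pow_one] at this

theorem scaled_mem (x : FHat n k) (hx : x ∈ augIdeal n k) :
    (algebraMap k[T;T⁻¹] (RatQ k) (qSub k))⁻¹ • toFq n k x ∈ Ftilde n k :=
  scaledAug_le n k ⟨_, ⟨x, hx, rfl⟩, rfl⟩

theorem qSub_ne : algebraMap k[T;T⁻¹] (RatQ k) (qSub k) ≠ 0 := by
  have : qSub k ≠ 0 := by
    intro h
    have h2 : (T 1 : k[T;T⁻¹]) = T 0 := by rw [T_zero]; exact sub_eq_zero.mp h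
    have := Finsupp.single_left_injective (one_ne_zero (α := k)) (congrArg (fun f => f.coeff) h2)
    exact one_ne_zero this
  exact fun h => this ((map_eq_zero_iff _ (IsFractionRing.injective _ _)).mp h)

theorem evOne_qSub : evOne k (qSub k) = 0 := by simp [evOne, qSub]

theorem toFq_mem (x : FHat n k) : toFq n k x ∈ Ftilde n k := by
  have h := scaled_mem n k (qSub k • x) (by
    simp [augIdeal, RingHom.mem_ker, evOne_qSub])
  rw [map_smul, ← algebraMap_smul (RatQ k) (qSub k), smul_smul, inv_mul_cancel₀ (qSub_ne k), one_smul] at h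
  exact h

/-- The canonical map `FHat → Ftilde`. -/
noncomputable def hatToTilde : FHat n k →ₐ[k[T;T⁻¹]] Ftilde n k :=
  (toFq n k).codRestrict _ (toFq_mem n k)

variable {n} in
/-- `r_ij = (ρ_ij - δ_ij) / (q - 1)`. -/
noncomputable def rGen (i j : Fin n) : Ftilde n k :=
  ⟨(algebraMap k[T;T⁻¹] (RatQ k) (qSub k))⁻¹ • toFq n k (rho k i j - if i = j then 1 else 0),
    scaled_mem n k _ (by
      rw [augIdeal, RingHom.mem_ker, RingHom.comp_apply]
      have : (counitHat n k) (rho k i j - if i = j then 1 else 0) = 0 := by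
        rw [map_sub, counitHat_rho]; split_ifs <;> simp
      rw [AlgHom.toRingHom_eq_coe, RingHom.coe_coe, this, map_zero])⟩

end Quantum

section Special
open LaurentPolynomial
variable (k : Type*) [Field k] (A : Type*) [Ring A] [Algebra k[T;T⁻¹] A]

/-- The ideal `(q - 1) A`. -/
def qIdeal : Ideal A := Ideal.span {algebraMap k[T;T⁻¹] A (qSub k)}

theorem mem_qIdeal (a : A) : a ∈ qIdeal k A ↔ ∃ b, a = qSub k • b := by
  rw [qIdeal, Ideal.mem_span_singleton']
  constructor
  · rintro ⟨b, rfl⟩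
    exact ⟨b, by rw [Algebra.smul_def, Algebra.commutes]⟩
  · rintro ⟨b, rfl⟩
    exact ⟨b, by rw [Algebra.smul_def, Algebra.commutes]⟩

instance : (qIdeal k A).IsTwoSided where
  mul_mem_of_left {a} b ha := by
    rw [mem_qIdeal] at ha ⊢
    obtain ⟨c, rfl⟩ := ha
    exact ⟨c * b, by rw [smul_mul_assoc]⟩

/-- The specialization `A / (q - 1) A` at `q = 1`. -/
abbrev AtOne := A ⧸ qIdeal k A

noncomputable instance : Algebra k (AtOne k A) :=
  RingHom.toAlgebra' ((Ideal.Quotient.mk (qIdeal k A)).comp ((algebraMap k[T;T⁻¹] A).comp C))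
    (fun c x => by
      obtain ⟨a, rfl⟩ := Ideal.Quotient.mk_surjective x
      simp only [RingHom.comp_apply, ← map_mul, Algebra.commutes])

variable {A}
/-- Reduction modulo `q - 1`. -/
noncomputable def atOne : A →+* AtOne k A := Ideal.Quotient.mk (qIdeal k A)

theorem C_evOne (f : k[T;T⁻¹]) : ∃ g, f = C (evOne k f) + qSub k * g := by
  induction f using LaurentPolynomial.induction_on' with
  | add p r hp hr =>
    obtain ⟨a, ha⟩ := hp
    obtain ⟨b, hb⟩ := hr
    refine ⟨a + b, ?_⟩
    rw [map_add, map_add, mul_add]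
    nth_rewrite 1 [ha, hb]
    ring
  | C_mul_T m c =>
    have hT : ∀ m : ℤ, ∃ g, (T m : k[T;T⁻¹]) = 1 + qSub k * g := by
      intro m
      induction m using Int.induction_on with
      | zero => exact ⟨0, by simp⟩
      | succ i ih =>
        obtain ⟨g, hg⟩ := ih
        refine ⟨1 + T 1 * g, ?_⟩
        rw [add_comm, T_add, hg, qSub]; ring
      | pred i ih =>
        obtain ⟨g, hg⟩ := ih
        refine ⟨T (-1) * (g - 1), ?_⟩
        rw [sub_eq_neg_add, T_add, hg, qSub]
        have : (T (-1) * T 1 : k[T;T⁻¹]) = 1 := by rw [← T_add]; simp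
        linear_combination this
    obtain ⟨g, hg⟩ := hT m
    refine ⟨C c * g, ?_⟩
    have : evOne k (C c * T m) = c := by simp [evOne]
    rw [this, hg]; ring

theorem atOne_smul (f : k[T;T⁻¹]) (a : A) : atOne k (f • a) = evOne k f • atOne k a := by
  obtain ⟨g, hg⟩ := C_evOne k f
  have h1 : atOne k (f • a) = atOne k (C (evOne k f) • a) := by
    rw [atOne, Ideal.Quotient.eq, mem_qIdeal]
    refine ⟨g • a, ?_⟩
    nth_rewrite 1 [hg]
    rw [add_smul, add_sub_cancel_left, mul_smul]
  rw [h1, Algebra.smul_def, map_mul, Algebra.smul_def]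
  rfl

/-- Reduction modulo `q - 1` of tensors: `a ⊗ b ↦ (a mod (q-1)) ⊗ (b mod (q-1))`. -/
noncomputable def atOneTensor : A ⊗[k[T;T⁻¹]] A →+ AtOne k A ⊗[k] AtOne k A :=
  TensorProduct.liftAddHom
    { toFun := fun a => ((TensorProduct.mk k (AtOne k A) (AtOne k A) (atOne k a)).toAddMonoidHom).comp
        (atOne k).toAddMonoidHom
      map_zero' := by ext b; simp
      map_add' := fun a a' => by ext b; simp }
    (fun r a b => by
      change atOne k (r • a) ⊗ₜ[k] atOne k b = atOne k a ⊗ₜ[k] atOne k (r • b)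
      rw [atOne_smul, atOne_smul, TensorProduct.smul_tmul])

end Special

section Structures
variable {R A B : Type*} [CommRing R] [Ring A] [Algebra R A] [Ring B] [Algebra R B]

/-- `f : A → B` is a homomorphism of Hopf algebras. -/
def HopfStr.IsHom (H : HopfStr R A) (H' : HopfStr R B) (f : A →ₐ[R] B) : Prop :=
  (∀ a, H'.comul (f a) = Algebra.TensorProduct.map f f (H.comul a)) ∧
  (∀ a, H'.counit (f a) = H.counit a) ∧
  ∀ a, H'.antipode (f a) = f (H.antipode a)

/-- The cyclic permutation `a ⊗ (b ⊗ c) ↦ b ⊗ (c ⊗ a)`. -/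
def cyc₃ (R A : Type*) [CommRing R] [Ring A] [Algebra R A] :
    A ⊗[R] (A ⊗[R] A) →ₗ[R] A ⊗[R] (A ⊗[R] A) :=
  (TensorProduct.assoc R A A A).toLinearMap ∘ₗ (TensorProduct.comm R A (A ⊗[R] A)).toLinearMap

/-- A (cocommutative) Hopf algebra with a Poisson cobracket `δ` is a co-Poisson Hopf algebra:
`δ` is skew, satisfies the co-Jacobi and co-Leibniz identities, and is compatible with products. -/
structure HopfStr.IsCoPoisson (H : HopfStr R A) (δ : A →ₗ[R] A ⊗[R] A) : Prop where
  cocomm : ∀ a, TensorProduct.comm R A A (H.comul a) = H.comul a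
  skew : ∀ a, TensorProduct.comm R A A (δ a) = -δ a
  coJacobi : ∀ a,
    TensorProduct.assoc R A A A (δ.rTensor A (δ a)) +
      cyc₃ R A (TensorProduct.assoc R A A A (δ.rTensor A (δ a))) +
      cyc₃ R A (cyc₃ R A (TensorProduct.assoc R A A A (δ.rTensor A (δ a)))) = 0
  coLeibniz : ∀ a,
    TensorProduct.assoc R A A A (H.comul.toLinearMap.rTensor A (δ a)) =
      δ.lTensor A (H.comul a) +
        (TensorProduct.comm R A A).toLinearMap.lTensor A
          (TensorProduct.assoc R A A A (δ.rTensor A (H.comul a)))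
  map_mul : ∀ a b, δ (a * b) = δ a * H.comul b + H.comul a * δ b

end Structures

section Semiclassical
open LaurentPolynomial
variable {k : Type*} [Field k] {A : Type*} [Ring A] [Algebra k[T;T⁻¹] A]

/-- The Hopf algebra structure `H₁` on `A / (q - 1) A` is the one induced by `H` on `A`. -/
def HopfStr.IsSpecialization (H : HopfStr k[T;T⁻¹] A) (H₁ : HopfStr k (AtOne k A)) : Prop :=
  (∀ a, H₁.comul (atOne k a) = atOneTensor k (H.comul a)) ∧
  (∀ a, H₁.counit (atOne k a) = evOne k (H.counit a)) ∧
  ∀ a, H₁.antipode (atOne k a) = atOne k (H.antipode a)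

/-- The cobracket `δ₁` on `A / (q - 1) A` is the semiclassical limit of the coproduct of `A`:
`Δ(a) - Δᵒᵖ(a)` is divisible by `q - 1`, and `δ₁(a mod (q-1))` is the
reduction of `(Δ(a) - Δᵒᵖ(a)) / (q - 1)`. -/
def HopfStr.IsSemiclassicalLimit (H : HopfStr k[T;T⁻¹] A)
    (δ₁ : AtOne k A →ₗ[k] AtOne k A ⊗[k] AtOne k A) : Prop :=
  ∀ a : A,
    (∃ y, H.comul a - TensorProduct.comm k[T;T⁻¹] A A (H.comul a) = qSub k • y) ∧
    ∀ y, H.comul a - TensorProduct.comm k[T;T⁻¹] A A (H.comul a) = qSub k • y →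
      δ₁ (atOne k a) = atOneTensor k y

variable (n : ℕ)

/-- Increasing enumeration of the indices different from `i`. -/
def skip (i : Fin n) : Fin (n - 1) ↪o Fin n :=
  (Finset.univ.erase i).orderEmbOfFin (by simp)

/-- The Hopf structure of the quantum function algebra: `Δ(ρ_ij) = ∑ ρ_il ⊗ ρ_lj`,
`ε(ρ_ij) = δ_ij`, and `S(ρ_ij)` is `(-q)^{i-j}` times the quantum minor omitting row `j`
and column `i`. -/
def IsStandardHopf (H : HopfStr k[T;T⁻¹] (FHat n k)) : Prop :=
  (∀ i j, H.comul (rho k i j) = ∑ l, rho k i l ⊗ₜ rho k l j) ∧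
  (∀ i j, H.counit (rho k i j) = if i = j then 1 else 0) ∧
  ∀ i j, H.antipode (rho k i j) =
    ((-1) ^ ((i : ℕ) + (j : ℕ)) * T ((i : ℤ) - (j : ℤ)) : k[T;T⁻¹]) •
      qDet (k := k) (fun a b => rho k (skip n j a) (skip n i b))

/-- `H` is the Hopf structure on `Ftilde` extending the standard one `Hhat` of `FHat`, `H₁` and `δ₁` are
the Hopf structure and Poisson cobracket it induces at `q = 1`, and `Φ` is an isomorphism of co-Poisson
Hopf algebras onto `U(sl_n*)`, which sends the class of `r_ij` to the matrix coefficient `X ↦ X_ij`. -/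
structure SpecializesToDual [CharZero k]
    (Hhat : HopfStr k[T;T⁻¹] (FHat n k)) (H : HopfStr k[T;T⁻¹] (Ftilde n k))
    (H₁ : HopfStr k (AtOne k (Ftilde n k)))
    (δ₁ : AtOne k (Ftilde n k) →ₗ[k] AtOne k (Ftilde n k) ⊗[k] AtOne k (Ftilde n k))
    (Φ : AtOne k (Ftilde n k) ≃ₐ[k] UniversalEnvelopingAlgebra k (SlDual n k)) : Prop where
  standard : IsStandardHopf n Hhat
  subalgebra : Hhat.IsHom H (hatToTilde n k)
  specialization : H.IsSpecialization H₁
  semiclassical : H.IsSemiclassicalLimit δ₁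
  coPoisson : H₁.IsCoPoisson δ₁
  isHom : H₁.IsHom (envHopf k (SlDual n k)) Φ
  map_cobracket : ∀ a, (slBialgebra n k).dual.envCobracket (Φ a) =
    Algebra.TensorProduct.map (Φ : _ →ₐ[k] _) (Φ : _ →ₐ[k] _) (δ₁ a)
  map_rGen : ∀ i j, Φ (atOne k (rGen k i j)) =
    UniversalEnvelopingAlgebra.ι k (slCoord n k i j)

end Semiclassical

section RankOne
variable (k : Type*) [Field k]

/-- `H₊ = r_11` for `SL_2`. -/
noncomputable abbrev hPlus : Ftilde 2 k := rGen k 0 0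
/-- `E = r_12` for `SL_2`. -/
noncomputable abbrev eGen : Ftilde 2 k := rGen k 0 1
/-- `F = r_21` for `SL_2`. -/
noncomputable abbrev fGen : Ftilde 2 k := rGen k 1 0
/-- `H₋ = r_22` for `SL_2`. -/
noncomputable abbrev hMinus : Ftilde 2 k := rGen k 1 1

/-- In `sl_2*`, with basis dual to the basis `f, h, e` of `sl_2`: the vector `h* : X ↦ X_11`. -/
noncomputable abbrev hDual : SlDual 2 k := slCoord 2 k 0 0
/-- The vector `e* : X ↦ X_12`. -/
noncomputable abbrev eDual : SlDual 2 k := slCoord 2 k 0 1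
/-- The vector `f* : X ↦ X_21`. -/
noncomputable abbrev fDual : SlDual 2 k := slCoord 2 k 1 0

end RankOne
end GQDP

/-!
The four families of relations between the `ρ_ij` are one relation, `R T₁ T₂ = T₂ T₁ R` for the
matrix `T = (ρ_ij)` (`IsQMatrix`). In this form it is inherited by products with commuting entries
(`IsQMatrix.mul`) and by the inverse over the opposite algebra (`IsQMatrix.inverse`). The quantum
determinant is `q`-alternating in the rows, hence multiplicative (`IsQMatrix.qDet_mul`), and Laplace
expansion shows that the quantum cofactors form a two-sided inverse of `T`
(`IsQMatrix.mul_cofactor`, `IsQMatrix.cofactor_mul`). The coproduct and the antipode of the quantum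
function algebra are therefore well defined, and the Hopf algebra axioms need only be checked on
generators (`hopfHat`).

The algebra `Ftilde` is generated by the `r_ij` because an element of the quantum function algebra
is its counit plus `q - 1` times a polynomial in the `r_ij` (`toFq_eq_counit_add`). It is torsion
free, so it is flat over the Dedekind domain `k[q, q⁻¹]`. A homomorphism from the quantum function
algebra to a flat algebra which is congruent to the counit modulo `q - 1` extends to `Ftilde`
(`exists_tilde_extension`); this gives the Hopf structure of `Ftilde`, and also its representations.

Substituting `ρ_ij = δ_ij + (q - 1) r_ij` and dividing by `(q - 1) ^ 2`, respectively by `q - 1`, in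
the commutation relations and in the determinant relation gives relations between the classes of the
`r_ij` at `q = 1` (`xGen_commutator`, `sum_xGen_diag`). They are the relations between the matrix
coefficients `X ↦ X_ij` in the Lie algebra `sl_n*` (`lie_slCoord`), so there is a homomorphism
`envToOne` from `U(sl_n*)` onto `Ftilde / (q - 1)`. It respects coproducts and counits, since the
`r_ij` are primitive at `q = 1`. In characteristic `0` such a homomorphism is injective as soon as
it is injective on the Lie algebra (`env_injective`): no basis of `Ftilde` is needed, only that the
classes of the `r_ij` have no linear relation other than the vanishing of the trace. This is seen in
two representations, defined by a triangular quantum matrix over the `n × n` matrices and by its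
transpose (`scalar_of_sum_xGen_eq_zero`).

The cobracket of `U(sl_n*)` is thus carried over to `Ftilde / (q - 1)`. Its co-Poisson axioms, and
its agreement with `(Δ - Δᵒᵖ) / (q - 1)`, are stable under products and hold on generators
(`HopfStr.isCoPoisson_of_generators`, `exists_comulTilde_sub_comm`). The formulas for `n = 2` are
special cases of the general ones.
-/

namespace GQDP

/-! ### Inversions of permutations -/

section Inversions
variable {m : ℕ}

theorem swap_lt_swap_iff (a : Fin m) (x y : Fin (m + 1)) (h : ¬(x = a.castSucc ∧ y = a.succ))
    (h' : ¬(x = a.succ ∧ y = a.castSucc)) :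
    Equiv.swap a.castSucc a.succ x < Equiv.swap a.castSucc a.succ y ↔ x < y := by
  simp only [Equiv.swap_apply_def]
  simp only [Fin.ext_iff, Fin.val_castSucc, Fin.val_succ] at h h'
  split_ifs with h1 h2 h3 h4 h5 h6 h7 <;>
    simp only [Fin.ext_iff, Fin.val_castSucc, Fin.val_succ, Fin.lt_def] at * <;> omega

/-- Composing with an adjacent transposition at an ascent creates exactly one inversion. -/
theorem invNum_mul_swap (σ : Equiv.Perm (Fin (m + 1))) (a : Fin m)
    (h : σ a.castSucc < σ a.succ) :
    invNum (σ * Equiv.swap a.castSucc a.succ) = invNum σ + 1 := by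
  set s := Equiv.swap a.castSucc a.succ with hs
  have hne : a.castSucc ≠ a.succ := (Fin.castSucc_lt_succ (i := a)).ne
  have hset : (Finset.univ.filter fun p : Fin (m + 1) × Fin (m + 1) =>
      p.1 < p.2 ∧ (σ * s) p.2 < (σ * s) p.1) =
      insert (a.castSucc, a.succ) ((Finset.univ.filter fun p : Fin (m + 1) × Fin (m + 1) =>
        p.1 < p.2 ∧ σ p.2 < σ p.1).map (Equiv.prodCongr s s).toEmbedding) := by
    ext ⟨x, y⟩
    simp only [Finset.mem_filter, Finset.mem_univ, true_and, Finset.mem_insert, Prod.mk.injEq,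
      Finset.mem_map_equiv, Equiv.prodCongr_symm, Equiv.prodCongr_apply, Prod.map,
      Equiv.Perm.mul_apply]
    have hss : s.symm = s := by rw [hs, Equiv.symm_swap]
    rw [hss]
    by_cases h1 : x = a.castSucc ∧ y = a.succ
    · obtain ⟨rfl, rfl⟩ := h1
      simp [hs, h]
    · by_cases h2 : x = a.succ ∧ y = a.castSucc
      · obtain ⟨rfl, rfl⟩ := h2
        simp only [hs, Equiv.swap_apply_left, Equiv.swap_apply_right]
        simp [hne, hne.symm, h.not_gt, Fin.castSucc_lt_succ.not_gt]
      · have h3 := swap_lt_swap_iff a x y h1 h2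
        rw [← hs] at h3
        rw [or_iff_right h1, h3]
        exact Finset.mem_filter.trans (and_iff_right (Finset.mem_univ _))
  rw [invNum, hset, Finset.card_insert_of_notMem, Finset.card_map]
  · rfl
  · simp only [Finset.mem_map_equiv, Finset.mem_filter, Finset.mem_univ, true_and,
      Equiv.prodCongr_symm, Equiv.prodCongr_apply, Prod.map]
    rw [hs, Equiv.symm_swap, Equiv.swap_apply_left, Equiv.swap_apply_right]
    exact fun hh => hh.1.not_gt Fin.castSucc_lt_succ

theorem invNum_one (n : ℕ) : invNum (1 : Equiv.Perm (Fin n)) = 0 := by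
  rw [invNum, Finset.card_eq_zero, Finset.filter_eq_empty_iff]
  rintro p - ⟨h1, h2⟩
  exact h1.not_gt h2

theorem invNum_inv {n : ℕ} (σ : Equiv.Perm (Fin n)) : invNum σ⁻¹ = invNum σ := by
  refine Finset.card_bij' (fun p _ => (σ⁻¹ p.2, σ⁻¹ p.1)) (fun p _ => (σ p.2, σ p.1)) ?_ ?_ ?_ ?_
  all_goals simp +contextual

/-- Conjugation by the order reversal preserves the number of inversions. -/
theorem invNum_rev {n : ℕ} (σ : Equiv.Perm (Fin n)) :
    invNum (Fin.revPerm * σ * Fin.revPerm) = invNum σ := by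
  refine Finset.card_bij' (fun p _ => (p.2.rev, p.1.rev)) (fun p _ => (p.2.rev, p.1.rev))
    ?_ ?_ ?_ ?_
  all_goals simp +contextual

/-- The permutation of `Fin (m + 1)` which sends `0` to `l` and acts on the remaining indices
as `τ` does, the values different from `l` being enumerated increasingly. -/
def consPerm (p : Fin (m + 1) × Equiv.Perm (Fin m)) : Equiv.Perm (Fin (m + 1)) :=
  p.1.cycleRange.symm * Equiv.Perm.decomposeFin.symm (0, p.2)

theorem consPerm_zero (p : Fin (m + 1) × Equiv.Perm (Fin m)) : consPerm p 0 = p.1 := by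
  simp [consPerm]

theorem consPerm_succ (p : Fin (m + 1) × Equiv.Perm (Fin m)) (i : Fin m) :
    consPerm p i.succ = p.1.succAbove (p.2 i) := by
  simp [consPerm]

theorem consPerm_bijective : Function.Bijective (consPerm (m := m)) := by
  rw [Fintype.bijective_iff_injective_and_card]
  constructor
  · rintro ⟨l, τ⟩ ⟨l', τ'⟩ h
    have h0 : l = l' := by
      have := congrArg (fun σ => σ 0) h
      simpa only [consPerm_zero] using this
    subst h0
    congr 1
    ext i
    have := congrArg (fun σ => σ i.succ) h
    simp only [consPerm_succ] at this
    rw [Fin.succAbove_right_injective this]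
  · simp [Fintype.card_perm, Nat.factorial_succ]

theorem invNum_consPerm (p : Fin (m + 1) × Equiv.Perm (Fin m)) :
    invNum (consPerm p) = (p.1 : ℕ) + invNum p.2 := by
  obtain ⟨l, τ⟩ := p
  have hset : (Finset.univ.filter fun p : Fin (m + 1) × Fin (m + 1) =>
      p.1 < p.2 ∧ consPerm (l, τ) p.2 < consPerm (l, τ) p.1) =
      (Finset.univ.filter fun i : Fin m => l.succAbove (τ i) < l).image
        (fun i => ((0 : Fin (m + 1)), i.succ)) ∪
      (Finset.univ.filter fun p : Fin m × Fin m => p.1 < p.2 ∧ τ p.2 < τ p.1).image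
        (Prod.map Fin.succ Fin.succ) := by
    ext ⟨x, y⟩
    simp only [Finset.mem_filter, Finset.mem_univ, true_and, Finset.mem_union,
      Finset.mem_image, Prod.map, Prod.mk.injEq, Prod.exists]
    cases x using Fin.cases with
    | zero =>
      cases y using Fin.cases with
      | zero => simp
      | succ y => simp [consPerm_zero, consPerm_succ]
    | succ x =>
      cases y using Fin.cases with
      | zero => simp
      | succ y => simp [consPerm_succ, Fin.succAbove_lt_succAbove_iff, (Fin.succ_ne_zero _).symm]
  rw [invNum, hset, Finset.card_union_of_disjoint, Finset.card_image_of_injective,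
    Finset.card_image_of_injective]
  rotate_left
  · exact (Fin.succ_injective _).prodMap (Fin.succ_injective _)
  · intro i j h
    simpa using h
  · rw [Finset.disjoint_left]
    rintro ⟨x, y⟩ h1 h2
    simp only [Finset.mem_image, Prod.map, Prod.mk.injEq] at h1 h2
    obtain ⟨_, _, h1, _⟩ := h1
    obtain ⟨_, _, h2, _⟩ := h2
    exact Fin.succ_ne_zero _ (h2.trans h1.symm)
  congr 1
  have : (Finset.univ.filter fun i : Fin m => l.succAbove (τ i) < l).card =
      (Finset.univ.filter fun i : Fin m => i.castSucc < l).card := by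
    refine Finset.card_bij' (fun i _ => τ i) (fun i _ => τ⁻¹ i) ?_ ?_ ?_ ?_ <;>
      simp [Fin.succAbove_lt_iff_castSucc_lt]
  rw [this]
  have h2 : (Finset.univ.filter fun i : Fin m => i.castSucc < l) =
      Finset.univ.filter fun i : Fin m => (i : ℕ) < l := by
    ext i; simp [Fin.lt_def]
  rw [h2, Fin.card_filter_val_lt]
  exact min_eq_right (Nat.lt_succ_iff.mp l.isLt)

end Inversions

/-! ### Ordered products in a noncommutative ring -/

section ListProd
variable {C : Type*} [Ring C]

/-- Two orderings of the same list have the same product if any two entries which occur in opposite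
relative orders commute. -/
theorem prod_map_eq_of_perm {ι : Type*} [DecidableEq ι] (f : ι → C) (l₁ l₂ : List ι)
    (hp : l₁.Perm l₂) (hn : l₁.Nodup)
    (hc : ∀ a b, List.Sublist [a, b] l₁ → List.Sublist [b, a] l₂ → Commute (f a) (f b)) :
    (l₁.map f).prod = (l₂.map f).prod := by
  induction l₁ generalizing l₂ with
  | nil => rw [List.nil_perm.mp hp]
  | cons a l ih =>
    have ha : a ∈ l₂ := hp.subset List.mem_cons_self
    obtain ⟨u, v, rfl⟩ := List.append_of_mem ha
    have hp' : l.Perm (u ++ v) := (List.perm_cons a).mp (hp.trans List.perm_middle)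
    have hcomm : Commute (f a) (u.map f).prod := by
      refine Commute.list_prod_right _ _ ?_
      intro x hx
      obtain ⟨b, hb, rfl⟩ := List.mem_map.mp hx
      refine hc a b ?_ ?_
      · rw [List.cons_sublist_cons, List.singleton_sublist]
        exact hp'.symm.subset (List.mem_append_left _ hb)
      · have h1 : List.Sublist [b] u := List.singleton_sublist.mpr hb
        have h2 : List.Sublist [a] (a :: v) := by simp
        exact h1.append h2
    rw [List.map_cons, List.prod_cons, ih (u ++ v) hp' hn.of_cons]
    · simp only [List.map_append, List.map_cons, List.prod_append, List.prod_cons]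
      rw [← mul_assoc, hcomm.eq, mul_assoc]
    · intro x y hx hy
      refine hc x y (hx.cons a) (hy.trans ?_)
      exact List.Sublist.append (List.Sublist.refl u) (List.sublist_cons_self a v)

theorem prod_ofFn_sum {ι : Type*} [Fintype ι] {n : ℕ} (a : Fin n → ι → C) :
    (List.ofFn fun i => ∑ l, a i l).prod =
      ∑ g : Fin n → ι, (List.ofFn fun i => a i (g i)).prod := by
  induction n with
  | zero => simp
  | succ n ih =>
    rw [List.ofFn_succ, List.prod_cons, ih, Finset.sum_mul_sum,
      ← (Fin.consEquiv fun _ => ι).sum_comp, Fintype.sum_prod_type]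
    simp [List.ofFn_succ, Fin.consEquiv]

theorem prod_ofFn_mul_of_commute {n : ℕ} (u v : Fin n → C) (h : ∀ i j, Commute (u i) (v j)) :
    (List.ofFn fun i => u i * v i).prod = (List.ofFn u).prod * (List.ofFn v).prod := by
  induction n with
  | zero => simp
  | succ n ih =>
    rw [List.ofFn_succ, List.prod_cons, ih _ _ fun i j => h _ _, List.ofFn_succ (f := u),
      List.ofFn_succ (f := v), List.prod_cons, List.prod_cons]
    have : Commute (v 0) (List.ofFn fun i : Fin n => u i.succ).prod := by
      refine Commute.list_prod_right _ _ fun x hx => ?_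
      obtain ⟨i, rfl⟩ := List.mem_ofFn.mp hx
      exact (h _ _).symm
    simp only [mul_assoc]
    rw [← mul_assoc (v 0), this.eq, mul_assoc]

/-- An ordered product as a function of two adjacent factors, the other factors being fixed. The
outer factors `A`, `B` are the same for all such products. -/
theorem prod_ofFn_adjacent {m : ℕ} (u : Fin (m + 1) → C) (a : Fin m) :
    ∃ A B : C, ∀ v : Fin (m + 1) → C, (∀ i, i ≠ a.castSucc → i ≠ a.succ → v i = u i) →
      (List.ofFn v).prod = A * (v a.castSucc * v a.succ) * B := by
  induction m with
  | zero => exact a.elim0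
  | succ m ih =>
    cases a using Fin.cases with
    | zero =>
      refine ⟨1, (List.ofFn fun i : Fin m => u i.succ.succ).prod, fun v hv => ?_⟩
      rw [List.ofFn_succ, List.ofFn_succ, List.prod_cons, List.prod_cons, one_mul, ← mul_assoc]
      congr 3
      funext i
      refine hv _ ?_ ?_ <;> simp [Fin.ext_iff]
    | succ b =>
      obtain ⟨A, B, h⟩ := ih (fun i => u i.succ) b
      refine ⟨u 0 * A, B, fun v hv => ?_⟩
      rw [List.ofFn_succ, List.prod_cons, h (fun i => v i.succ), hv 0]
      · simp only [mul_assoc, Fin.succ_castSucc]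
      · simp [Fin.ext_iff]
      · simp [Fin.ext_iff]
      · intro i h1 h2
        refine hv _ ?_ ?_
        · rwa [← Fin.succ_castSucc, Ne, Fin.succ_inj]
        · rwa [Ne, Fin.succ_inj]

end ListProd

/-! ### Quantum matrices -/

section QuantumMatrices
open LaurentPolynomial
variable {k : Type*} [Field k] {C : Type*} [Ring C] [Algebra k[T;T⁻¹] C]

variable (k) in
/-- The braid form of the `R`-matrix of `SL_n` is the flip `e_a ⊗ e_b ↦ e_b ⊗ e_a` plus the diagonal
matrix with these entries. -/
noncomputable def qWeight {n : ℕ} (a b : Fin n) : k[T;T⁻¹] :=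
  if a = b then T 1 - 1 else if a < b then T 1 - T (-1) else 0

variable (k) in
/-- The entries of `t` satisfy the relations of a quantum matrix. The four families of relations
are written as one: `T₁ T₂` commutes with the flip plus `qWeight`, which is the equation
`R T₁ T₂ = T₂ T₁ R` in coordinates. -/
def IsQMatrix {n : ℕ} (t : Fin n → Fin n → C) : Prop :=
  ∀ i j a b, t i b * t j a - t j a * t i b =
    (qWeight k i j - qWeight k a b) • (t i a * t j b)

theorem T_one_mul_T_neg_one : (T 1 * T (-1) : k[T;T⁻¹]) = 1 := by rw [← T_add]; simp

theorem T_one_pow_mul (n : ℕ) : (-T 1 : k[T;T⁻¹]) ^ n * (-T (-1)) ^ n = 1 := by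
  rw [← mul_pow, neg_mul_neg, T_one_mul_T_neg_one, one_pow]

theorem neg_T_pow_smul_cancel (n : ℕ) {x y : C}
    (h : (-T 1 : k[T;T⁻¹]) ^ n • x = (-T 1 : k[T;T⁻¹]) ^ n • y) : x = y := by
  have := congrArg (fun z => (-T (-1) : k[T;T⁻¹]) ^ n • z) h
  simpa only [smul_smul, mul_comm _ ((-T 1 : k[T;T⁻¹]) ^ n), T_one_pow_mul, one_smul] using this

/-- The four families of defining relations combine to the single family of `IsQMatrix`. -/
theorem IsQMatrix.of_rel {n : ℕ} {t : Fin n → Fin n → C}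
    (row : ∀ i j l, j < l → t i j * t i l = (T 1 : k[T;T⁻¹]) • (t i l * t i j))
    (col : ∀ i h l, i < h → t i l * t h l = (T 1 : k[T;T⁻¹]) • (t h l * t i l))
    (comm : ∀ i j m l, i < j → m < l → t i l * t j m = t j m * t i l)
    (cross : ∀ i j m l, i < j → m < l → t i m * t j l - t j l * t i m =
      (T 1 - T (-1) : k[T;T⁻¹]) • (t i l * t j m)) : IsQMatrix k t := by
  have hq : ∀ x : C, (T (-1) : k[T;T⁻¹]) • (T 1 : k[T;T⁻¹]) • x = x := fun x => by
    rw [smul_smul, mul_comm, T_one_mul_T_neg_one, one_smul]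
  have hq' : ∀ x : C, (T 1 : k[T;T⁻¹]) • (T (-1) : k[T;T⁻¹]) • x = x := fun x => by
    rw [smul_smul, T_one_mul_T_neg_one, one_smul]
  intro i j a b
  rcases lt_trichotomy i j with h | h | h <;> rcases lt_trichotomy a b with h' | h' | h'
  · rw [comm i j a b h h', sub_self]
    simp [qWeight, h.ne, h, h'.ne, h']
  · subst h'
    rw [col i j a h]
    simp only [qWeight, h.ne, h, if_true, if_false, sub_smul, one_smul, hq]
    abel
  · rw [cross i j b a h h']
    simp [qWeight, h.ne, h, h'.ne', h'.not_gt]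
  · subst h
    rw [row i a b h']
    simp only [qWeight, h'.ne, h', if_true, if_false, sub_smul, one_smul, hq]
    abel
  · subst h h'
    simp [qWeight]
  · subst h
    rw [row i b a h']
    simp only [qWeight, h'.ne', h'.not_gt, if_true, if_false, sub_smul, one_smul, sub_zero]
  · have := cross j i a b h h'
    rw [← neg_sub, this]
    simp only [qWeight, h.ne', h.not_gt, h'.ne, h', if_true, if_false, zero_sub, neg_smul]
    rw [comm j i a b h h']
  · subst h'
    rw [col j i a h]
    simp only [qWeight, h.ne', h.not_gt, if_true, if_false, sub_smul, one_smul, zero_sub,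
      neg_sub]
  · rw [comm j i b a h h', sub_self]
    simp [qWeight, h.ne', h.not_gt, h'.ne', h'.not_gt]

namespace IsQMatrix
variable {n : ℕ} {t : Fin n → Fin n → C} (ht : IsQMatrix k t)
include ht

theorem comm {i j a b : Fin n} (h : i < j) (h' : a < b) : t i b * t j a = t j a * t i b := by
  have := ht i j a b
  rwa [show qWeight k i j - qWeight k a b = 0 by simp [qWeight, h, h', h.ne, h'.ne], zero_smul,
    sub_eq_zero] at this

theorem row {i j l : Fin n} (h : j < l) : t i j * t i l = (T 1 : k[T;T⁻¹]) • (t i l * t i j) := by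
  have := ht i i l j
  rw [sub_eq_iff_eq_add] at this
  rw [this]
  simp [qWeight, h.ne', h.not_gt, sub_smul]

theorem col {i j l : Fin n} (h : i < j) : t i l * t j l = (T 1 : k[T;T⁻¹]) • (t j l * t i l) := by
  have := ht j i l l
  rw [sub_eq_iff_eq_add', ← sub_eq_iff_eq_add] at this
  rw [← this]
  simp only [qWeight, h.ne', h.not_gt, if_true, if_false, zero_sub, neg_sub, sub_smul, one_smul]
  abel

theorem cross {i j a b : Fin n} (h : i < j) (h' : a < b) :
    t i a * t j b - t j b * t i a = (T 1 - T (-1) : k[T;T⁻¹]) • (t i b * t j a) := by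
  have := ht i j b a
  rwa [show qWeight k i j - qWeight k b a = T 1 - T (-1) by
    simp [qWeight, h, h.ne, h'.ne', h'.not_gt]] at this

theorem submatrix {m : ℕ} (f g : Fin m → Fin n) (hf : StrictMono f) (hg : StrictMono g) :
    IsQMatrix k fun i j => t (f i) (g j) := by
  intro i j a b
  rw [ht, qWeight, qWeight, qWeight, qWeight]
  simp [hf.lt_iff_lt, hg.lt_iff_lt, hf.injective.eq_iff, hg.injective.eq_iff]

theorem transpose : IsQMatrix k fun i j => t j i :=
  of_rel (fun _ _ _ h => ht.col h) (fun _ _ _ h => ht.row h)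
    (fun _ _ _ _ h h' => (ht.comm h' h).symm)
    (fun i j m l h h' => by rw [ht.cross h' h, ht.comm h' h])

theorem map {C' : Type*} [Ring C'] [Algebra k[T;T⁻¹] C'] (f : C →ₐ[k[T;T⁻¹]] C') :
    IsQMatrix k fun i j => f (t i j) := by
  intro i j a b
  rw [← map_mul, ← map_mul, ← map_sub, ht, map_smul, map_mul]

/-- Rotating a quantum matrix by a half turn gives a quantum matrix over the opposite algebra. -/
theorem rev : IsQMatrix k fun i j => MulOpposite.op (t i.rev j.rev) := by
  have h1 : ∀ i j : Fin n, i < j → j.rev < i.rev := fun i j h => Fin.rev_lt_rev.mpr h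
  refine of_rel (fun i j l h => ?_) (fun i j l h => ?_) (fun i j m l h h' => ?_)
    (fun i j m l h h' => ?_)
  · simp only [← MulOpposite.op_mul, ← MulOpposite.op_smul, ht.row (h1 _ _ h)]
  · simp only [← MulOpposite.op_mul, ← MulOpposite.op_smul, ht.col (h1 _ _ h)]
  · simp only [← MulOpposite.op_mul, ht.comm (h1 _ _ h) (h1 _ _ h')]
  · simp only [← MulOpposite.op_mul, ← MulOpposite.op_smul, ← MulOpposite.op_sub,
      ht.cross (h1 _ _ h) (h1 _ _ h'), ht.comm (h1 _ _ h) (h1 _ _ h')]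

/-- The product of two quantum matrices whose entries commute with each other is a quantum matrix,
as `T₁ T₂ U₁ U₂` commutes with the `R`-matrix when `T₁ T₂` and `U₁ U₂` do. This makes the coproduct
well defined. -/
theorem mul {u : Fin n → Fin n → C} (hu : IsQMatrix k u)
    (hc : ∀ i j a b, Commute (t i j) (u a b)) :
    IsQMatrix k fun i j => ∑ l, t i l * u l j := by
  have hprod : ∀ i j a b, (∑ l, t i l * u l a) * (∑ l, t j l * u l b) =
      ∑ p : Fin n × Fin n, t i p.1 * t j p.2 * (u p.1 a * u p.2 b) := by
    intro i j a b
    rw [Finset.sum_mul_sum, Fintype.sum_prod_type]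
    refine Finset.sum_congr rfl fun x _ => Finset.sum_congr rfl fun y _ => ?_
    rw [mul_assoc, ← mul_assoc (u x a), ← (hc j y x a).eq]
    simp only [mul_assoc]
  intro i j a b
  simp only [hprod]
  have h1 : ∀ p : Fin n × Fin n, t i p.1 * t j p.2 * (u p.1 b * u p.2 a) =
      t i p.1 * t j p.2 * (u p.2 a * u p.1 b) +
        qWeight k p.1 p.2 • (t i p.1 * t j p.2 * (u p.1 a * u p.2 b)) -
        qWeight k a b • (t i p.1 * t j p.2 * (u p.1 a * u p.2 b)) := by
    intro p
    have := hu p.1 p.2 a b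
    rw [sub_eq_iff_eq_add] at this
    rw [this, sub_smul, mul_add, mul_sub, mul_smul_comm, mul_smul_comm]
    abel
  have h2 : ∀ p : Fin n × Fin n, t i p.2 * t j p.1 * (u p.1 a * u p.2 b) +
        qWeight k p.1 p.2 • (t i p.1 * t j p.2 * (u p.1 a * u p.2 b)) =
      t j p.1 * t i p.2 * (u p.1 a * u p.2 b) +
        qWeight k i j • (t i p.1 * t j p.2 * (u p.1 a * u p.2 b)) := by
    intro p
    have := ht i j p.1 p.2
    rw [sub_eq_iff_eq_add] at this
    rw [this, sub_smul, add_mul, sub_mul, smul_mul_assoc, smul_mul_assoc]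
    abel
  have h3 : ∑ p : Fin n × Fin n, t i p.1 * t j p.2 * (u p.2 a * u p.1 b) =
      ∑ p : Fin n × Fin n, t i p.2 * t j p.1 * (u p.1 a * u p.2 b) :=
    (Equiv.sum_comp (Equiv.prodComm (Fin n) (Fin n)) _).symm
  have e1 := Finset.sum_congr (rfl : (Finset.univ : Finset (Fin n × Fin n)) = _) fun p _ => h1 p
  have e2 := Finset.sum_congr (rfl : (Finset.univ : Finset (Fin n × Fin n)) = _) fun p _ => h2 p
  rw [Finset.sum_sub_distrib, Finset.sum_add_distrib, ← Finset.smul_sum] at e1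
  rw [Finset.sum_add_distrib, Finset.sum_add_distrib, ← Finset.smul_sum] at e2
  rw [e1, h3, eq_sub_of_add_eq e2, sub_smul]
  abel

end IsQMatrix
end QuantumMatrices

/-! ### Inverses of quantum matrices -/

section QuantumMatrixInverse
open LaurentPolynomial
variable {k : Type*} [Field k] {C : Type*} [Ring C] [Algebra k[T;T⁻¹] C]

/-- The entries of the inverse of a quantum matrix satisfy the opposite relations: `X = T₁ T₂`
commutes with the braid form `Q` of the `R`-matrix, hence so does `Y = X⁻¹`. This makes the antipode
well defined. -/
theorem IsQMatrix.inverse {n : ℕ} {t s : Fin n → Fin n → C} (ht : IsQMatrix k t)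
    (hts : ∀ i j, ∑ l, t i l * s l j = if i = j then 1 else 0)
    (hst : ∀ i j, ∑ l, s i l * t l j = if i = j then 1 else 0) :
    IsQMatrix k fun i j => MulOpposite.op (s i j) := by
  classical
  let X : Matrix (Fin n × Fin n) (Fin n × Fin n) C := .of fun p r => t p.1 r.1 * t p.2 r.2
  let Y : Matrix (Fin n × Fin n) (Fin n × Fin n) C := .of fun p r => s p.2 r.2 * s p.1 r.1
  let Q : Matrix (Fin n × Fin n) (Fin n × Fin n) C := .of fun p r =>
    (if p = r.swap then 1 else 0) + if p = r then algebraMap _ C (qWeight k p.1 p.2) else 0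
  have hQl : ∀ (M : Matrix (Fin n × Fin n) (Fin n × Fin n) C) p r,
      (Q * M) p r = M p.swap r + qWeight k p.1 p.2 • M p r := by
    intro M p r
    have : ∀ x : Fin n × Fin n, (if p = x.swap then (1 : C) else 0) =
        if p.swap = x then 1 else 0 := by
      intro x
      congr 1
      rw [eq_iff_iff]
      exact ⟨fun h => by rw [h, Prod.swap_swap], fun h => by rw [← h, Prod.swap_swap]⟩
    simp [Q, Matrix.mul_apply, add_mul, Finset.sum_add_distrib, this, Algebra.smul_def]
  have hQr : ∀ (M : Matrix (Fin n × Fin n) (Fin n × Fin n) C) p r,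
      (M * Q) p r = M p r.swap + qWeight k r.1 r.2 • M p r := by
    intro M p r
    simp [Q, Matrix.mul_apply, mul_add, Finset.sum_add_distrib, Algebra.smul_def,
      Algebra.commutes]
  have hXY : X * Y = 1 := by
    ext p r
    simp only [X, Y, Matrix.mul_apply, Matrix.of_apply, Fintype.sum_prod_type]
    have : ∀ x y, t p.1 x * t p.2 y * (s y r.2 * s x r.1) =
        t p.1 x * (t p.2 y * s y r.2) * s x r.1 := fun x y => by simp only [mul_assoc]
    simp only [this, ← Finset.mul_sum, ← Finset.sum_mul, hts]
    by_cases h : p.2 = r.2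
    · simp [h, hts, Matrix.one_apply, Prod.ext_iff]
    · simp [h, Prod.ext_iff]
  have hYX : Y * X = 1 := by
    ext p r
    simp only [X, Y, Matrix.mul_apply, Matrix.of_apply, Fintype.sum_prod_type_right]
    have : ∀ x y, s p.2 y * s p.1 x * (t x r.1 * t y r.2) =
        s p.2 y * (s p.1 x * t x r.1) * t y r.2 := fun x y => by simp only [mul_assoc]
    simp only [this, ← Finset.mul_sum, ← Finset.sum_mul, hst]
    by_cases h : p.1 = r.1
    · simp [h, hst, Matrix.one_apply, Prod.ext_iff]
    · simp [h, Prod.ext_iff]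
  have hXQ : X * Q = Q * X := by
    ext p r
    rw [hQl, hQr]
    have := ht p.1 p.2 r.1 r.2
    rw [sub_smul, sub_eq_sub_iff_add_eq_add] at this
    simpa [X, add_comm] using this
  have hYQ : Y * Q = Q * Y := by
    calc Y * Q = Y * (Q * X) * Y := by rw [mul_assoc, mul_assoc, hXY, mul_one]
      _ = Q * Y := by rw [← hXQ, ← mul_assoc, hYX, one_mul]
  intro i j a b
  have := congrFun (congrFun hYQ (i, j)) (a, b)
  rw [hQl, hQr] at this
  simp only [Y, Matrix.of_apply, Prod.swap] at this
  simp only [← MulOpposite.op_mul, ← MulOpposite.op_smul, ← MulOpposite.op_sub]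
  congr 1
  rw [sub_smul, sub_eq_sub_iff_add_eq_add, this]
  abel

end QuantumMatrixInverse

/-! ### The quantum determinant -/

section QuantumDeterminant
open LaurentPolynomial
variable {k : Type*} [Field k] {C : Type*} [Ring C] [Algebra k[T;T⁻¹] C]

theorem map_qDet {C' : Type*} [Ring C'] [Algebra k[T;T⁻¹] C'] (f : C →ₐ[k[T;T⁻¹]] C') {n : ℕ}
    (t : Fin n → Fin n → C) : f (qDet (k := k) t) = qDet (k := k) fun i j => f (t i j) := by
  simp [qDet, map_sum, map_list_prod, List.map_ofFn, Function.comp_def]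

theorem perm_eq_one_of_forall_le {n : ℕ} {σ : Equiv.Perm (Fin n)} (h : ∀ i, i ≤ σ i) : σ = 1 := by
  refine Equiv.ext fun i => ?_
  have hsum : ∑ i : Fin n, ((σ i : Fin n) : ℕ) = ∑ i : Fin n, (i : ℕ) :=
    Equiv.sum_comp σ fun i => (i : ℕ)
  exact (Fin.ext ((Finset.sum_eq_sum_iff_of_le fun i _ => Fin.le_def.mp (h i)).mp hsum.symm i
    (Finset.mem_univ i))).symm

/-- Only the diagonal contributes to the quantum determinant of an upper triangular matrix. -/
theorem qDet_of_upper {n : ℕ} (t : Fin n → Fin n → C) (h : ∀ i j, j < i → t i j = 0) :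
    qDet (k := k) t = (List.ofFn fun i => t i i).prod := by
  rw [qDet, Finset.sum_eq_single 1]
  · simp [invNum_one]
  · intro σ _ hσ
    obtain ⟨i, hi⟩ : ∃ i, σ i < i := by
      by_contra hc
      push Not at hc
      exact hσ (perm_eq_one_of_forall_le hc)
    rw [List.prod_eq_zero, smul_zero]
    exact List.mem_ofFn.mpr ⟨i, h _ _ hi⟩
  · simp

/-- A sum over permutations is a sum over those with an ascent at `a`, each taken together with its
product by the adjacent transposition at `a`. -/
theorem sum_perm_adjacent {m : ℕ} {M : Type*} [AddCommMonoid M] (a : Fin m)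
    (f : Equiv.Perm (Fin (m + 1)) → M) :
    ∑ σ, f σ = ∑ σ ∈ Finset.univ.filter fun σ : Equiv.Perm (Fin (m + 1)) =>
      σ a.castSucc < σ a.succ, (f σ + f (σ * Equiv.swap a.castSucc a.succ)) := by
  rw [Finset.sum_add_distrib, ← Finset.sum_filter_add_sum_filter_not Finset.univ
    fun σ : Equiv.Perm (Fin (m + 1)) => σ a.castSucc < σ a.succ]
  congr 1
  refine Finset.sum_bij' (fun σ _ => σ * Equiv.swap a.castSucc a.succ)
    (fun σ _ => σ * Equiv.swap a.castSucc a.succ) ?_ ?_ ?_ ?_ ?_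
  · intro σ hσ
    simp only [Finset.mem_filter, Finset.mem_univ, true_and, not_lt] at hσ
    simp only [Finset.mem_filter, Finset.mem_univ, true_and, Equiv.Perm.mul_apply,
      Equiv.swap_apply_left, Equiv.swap_apply_right]
    exact lt_of_le_of_ne hσ fun h => (Fin.castSucc_lt_succ (i := a)).ne' (σ.injective h)
  · intro σ hσ
    simp only [Finset.mem_filter, Finset.mem_univ, true_and] at hσ
    simpa only [Finset.mem_filter, Finset.mem_univ, true_and, Equiv.Perm.mul_apply,
      Equiv.swap_apply_left, Equiv.swap_apply_right] using hσ.not_gt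
  · intro σ _; simp [mul_assoc]
  · intro σ _; simp [mul_assoc]
  · intro σ _; simp [mul_assoc]

/-- The quantum determinant as a sum of multiples of quantum `2 × 2` minors of two adjacent rows. -/
theorem qDet_adjacent {m : ℕ} (u : Fin (m + 1) → Fin (m + 1) → C) (a : Fin m) :
    ∃ A B : Equiv.Perm (Fin (m + 1)) → C, ∀ v : Fin (m + 1) → Fin (m + 1) → C,
      (∀ i, i ≠ a.castSucc → i ≠ a.succ → v i = u i) →
      qDet (k := k) v = ∑ σ ∈ Finset.univ.filter fun σ : Equiv.Perm (Fin (m + 1)) =>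
        σ a.castSucc < σ a.succ, (-T 1 : k[T;T⁻¹]) ^ invNum σ •
        (A σ * (v a.castSucc (σ a.castSucc) * v a.succ (σ a.succ) -
          (T 1 : k[T;T⁻¹]) • (v a.castSucc (σ a.succ) * v a.succ (σ a.castSucc))) * B σ) := by
  choose A B h using fun σ : Equiv.Perm (Fin (m + 1)) => prod_ofFn_adjacent (fun i => u i (σ i)) a
  refine ⟨A, B, fun v hv => ?_⟩
  rw [qDet, sum_perm_adjacent a]
  refine Finset.sum_congr rfl fun σ hσ => ?_
  simp only [Finset.mem_filter, Finset.mem_univ, true_and] at hσ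
  rw [h σ (fun i => v i (σ i)) fun i h1 h2 => by rw [hv i h1 h2], invNum_mul_swap σ a hσ,
    h σ fun i => v i ((σ * Equiv.swap a.castSucc a.succ) i)]
  · simp only [Equiv.Perm.mul_apply, Equiv.swap_apply_left, Equiv.swap_apply_right, mul_sub,
      sub_mul, mul_smul_comm, smul_mul_assoc, smul_sub, pow_succ, smul_smul, mul_neg, neg_smul]
    abel
  · intro i h1 h2
    simp only [Equiv.Perm.mul_apply, Equiv.swap_apply_of_ne_of_ne h1 h2, hv i h1 h2]

variable {n : ℕ} {t : Fin n → Fin n → C}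

theorem IsQMatrix.qDet_rows_adjacent_eq (ht : IsQMatrix k t) {m : ℕ} (c : Fin (m + 1) → Fin n)
    (hc : StrictMono c) (g : Fin (m + 1) → Fin n) (a : Fin m)
    (hg : g a.castSucc = g a.succ) : qDet (k := k) (fun i j => t (g i) (c j)) = 0 := by
  obtain ⟨A, B, h⟩ := qDet_adjacent (k := k) (fun i j => t (g i) (c j)) a
  rw [h _ fun _ _ _ => rfl]
  refine Finset.sum_eq_zero fun σ hσ => ?_
  simp only [Finset.mem_filter, Finset.mem_univ, true_and] at hσ
  rw [hg, ht.row (hc hσ), sub_self, mul_zero, zero_mul, smul_zero]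

/-- Exchanging two adjacent rows, which are in increasing order, multiplies the quantum determinant
by `-q`. -/
theorem IsQMatrix.qDet_rows_adjacent_swap (ht : IsQMatrix k t) {m : ℕ} (c : Fin (m + 1) → Fin n)
    (hc : StrictMono c) (g : Fin (m + 1) → Fin n) (a : Fin m)
    (hg : g a.castSucc < g a.succ) :
    qDet (k := k) (fun i j => t (g (Equiv.swap a.castSucc a.succ i)) (c j)) =
      (-T 1 : k[T;T⁻¹]) • qDet (k := k) (fun i j => t (g i) (c j)) := by
  obtain ⟨A, B, h⟩ := qDet_adjacent (k := k) (fun i j => t (g i) (c j)) a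
  rw [h _ fun _ _ _ => rfl, h fun i j => t (g (Equiv.swap a.castSucc a.succ i)) (c j),
    Finset.smul_sum]
  · refine Finset.sum_congr rfl fun σ hσ => ?_
    simp only [Finset.mem_filter, Finset.mem_univ, true_and] at hσ
    have key : t (g a.succ) (c (σ a.castSucc)) * t (g a.castSucc) (c (σ a.succ)) -
        (T 1 : k[T;T⁻¹]) • (t (g a.succ) (c (σ a.succ)) * t (g a.castSucc) (c (σ a.castSucc))) =
        (-T 1 : k[T;T⁻¹]) • (t (g a.castSucc) (c (σ a.castSucc)) * t (g a.succ) (c (σ a.succ)) -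
          (T 1 : k[T;T⁻¹]) •
            (t (g a.castSucc) (c (σ a.succ)) * t (g a.succ) (c (σ a.castSucc)))) := by
      rw [← ht.comm hg (hc hσ), sub_eq_iff_eq_add.mp (ht.cross hg (hc hσ))]
      simp only [neg_smul, smul_sub, smul_add, sub_smul, smul_smul, neg_mul, T_one_mul_T_neg_one,
        one_smul]
      abel
    rw [Equiv.swap_apply_left, Equiv.swap_apply_right, key, mul_smul_comm, smul_mul_assoc,
      smul_comm]
  · intro i h1 h2
    rw [Equiv.swap_apply_of_ne_of_ne h1 h2]

/-- A quantum determinant with a repeated row vanishes: adjacent exchanges bring the two equal rows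
next to each other. -/
theorem IsQMatrix.qDet_rows_eq_zero (ht : IsQMatrix k t) {m : ℕ} (c : Fin m → Fin n)
    (hc : StrictMono c) (g : Fin m → Fin n) (hg : ¬Function.Injective g) :
    qDet (k := k) (fun i j => t (g i) (c j)) = 0 := by
  have key : ∀ (d : ℕ) (g : Fin m → Fin n) (i j : Fin m), (j : ℕ) = i + d + 1 → g i = g j →
      qDet (k := k) (fun i j => t (g i) (c j)) = 0 := by
    intro d
    induction d with
    | zero =>
      intro g i j hij h
      obtain ⟨m, rfl⟩ : ∃ m', m = m' + 1 := ⟨m - 1, by omega⟩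
      have hi : (i : ℕ) < m := by omega
      refine ht.qDet_rows_adjacent_eq c hc g ⟨i, hi⟩ ?_
      have h1 : (⟨i, hi⟩ : Fin m).succ = j := Fin.ext (by simp [hij])
      rw [h1]
      exact h
    | succ d ih =>
      intro g i j hij h
      obtain ⟨m, rfl⟩ : ∃ m', m = m' + 1 := ⟨m - 1, by omega⟩
      have hj : (j : ℕ) - 1 < m := by omega
      set a : Fin m := ⟨j - 1, hj⟩ with ha
      have h1 : a.succ = j := Fin.ext (by simp [ha]; omega)
      have hi : i ≠ a.castSucc := fun h => by simp [ha, Fin.ext_iff] at h; omega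
      have hi' : i ≠ a.succ := fun h => by simp [ha, Fin.ext_iff] at h; omega
      have h0 := ih (fun x => g (Equiv.swap a.castSucc a.succ x)) i a.castSucc
        (by simp [ha]; omega)
        (by rw [Equiv.swap_apply_of_ne_of_ne hi hi', Equiv.swap_apply_left, h1, h])
      rcases lt_trichotomy (g a.castSucc) (g a.succ) with hlt | heq | hlt
      · rw [ht.qDet_rows_adjacent_swap c hc g a hlt] at h0
        refine neg_T_pow_smul_cancel (k := k) 1 ?_
        rw [pow_one, h0, smul_zero]
      · exact ht.qDet_rows_adjacent_eq c hc g a heq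
      · have := ht.qDet_rows_adjacent_swap c hc
          (fun x => g (Equiv.swap a.castSucc a.succ x)) a (by simpa using hlt)
        simp only [Equiv.swap_apply_self] at this
        rw [this, h0, smul_zero]
  obtain ⟨i, j, h, hne⟩ : ∃ i j, g i = g j ∧ i ≠ j := by
    simpa [Function.Injective] using hg
  rcases lt_or_gt_of_ne hne with h' | h'
  · exact key (j - i - 1) g i j (by omega) h
  · exact key (i - j - 1) g j i (by omega) h.symm

/-- Permuting the rows multiplies the quantum determinant by `(-q) ^ ℓ`, by induction on the length
`ℓ`. -/
theorem IsQMatrix.qDet_rows_perm (ht : IsQMatrix k t) (g : Equiv.Perm (Fin n)) :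
    qDet (k := k) (fun i j => t (g i) j) = (-T 1 : k[T;T⁻¹]) ^ invNum g • qDet (k := k) t := by
  obtain _ | m := n
  · rw [Subsingleton.elim g 1, invNum_one, pow_zero, one_smul]
    rfl
  induction hd : invNum g generalizing g with
  | zero =>
    have hmono : StrictMono g := by
      rw [Fin.strictMono_iff_lt_succ]
      intro a
      by_contra hlt
      rw [invNum, Finset.card_eq_zero, Finset.filter_eq_empty_iff] at hd
      refine hd (Finset.mem_univ (a.castSucc, a.succ)) ⟨Fin.castSucc_lt_succ, ?_⟩
      exact lt_of_le_of_ne (not_lt.mp hlt) fun h =>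
        (Fin.castSucc_lt_succ (i := a)).ne' (g.injective h)
    simp [perm_eq_one_of_forall_le fun i => hmono.le_apply]
  | succ d ih =>
    have : ¬ StrictMono g := by
      intro h
      rw [perm_eq_one_of_forall_le fun i => h.le_apply, invNum_one] at hd
      exact absurd hd (Nat.succ_ne_zero _).symm
    rw [Fin.strictMono_iff_lt_succ] at this
    push Not at this
    obtain ⟨a, ha⟩ := this
    have ha' : g a.succ < g a.castSucc := lt_of_le_of_ne ha fun h =>
      (Fin.castSucc_lt_succ (i := a)).ne' (g.injective h)
    set g' := g * Equiv.swap a.castSucc a.succ with hg'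
    have hgg : g = g' * Equiv.swap a.castSucc a.succ := by simp [hg', mul_assoc]
    have hlt : g' a.castSucc < g' a.succ := by simpa [hg'] using ha'
    have hd' : invNum g' = d := by
      have := invNum_mul_swap g' a hlt
      rw [← hgg, hd] at this
      omega
    have := ht.qDet_rows_adjacent_swap id strictMono_id g' a hlt
    simp only [id] at this
    rw [hgg]
    simp only [Equiv.Perm.mul_apply]
    rw [this, ih g' hd', smul_smul, pow_succ']

/-- The quantum determinant is multiplicative if the entries of the two matrices commute with each
other. Only the second factor has to be a quantum matrix. -/
theorem IsQMatrix.qDet_mul {u : Fin n → Fin n → C} (hu : IsQMatrix k u)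
    (hc : ∀ i j a b, Commute (t i j) (u a b)) :
    qDet (k := k) (fun i j => ∑ l, t i l * u l j) = qDet (k := k) t * qDet (k := k) u := by
  have h1 : qDet (k := k) (fun i j => ∑ l, t i l * u l j) = ∑ g : Fin n → Fin n,
      (List.ofFn fun i => t i (g i)).prod * qDet (k := k) fun i j => u (g i) j := by
    simp only [qDet, prod_ofFn_sum, Finset.mul_sum, Finset.smul_sum]
    rw [Finset.sum_comm]
    refine Finset.sum_congr rfl fun g _ => Finset.sum_congr rfl fun σ _ => ?_
    rw [prod_ofFn_mul_of_commute _ _ fun i j => hc _ _ _ _, mul_smul_comm]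
  rw [h1, ← Fintype.sum_of_injective (fun g : Equiv.Perm (Fin n) => (g : Fin n → Fin n))
    DFunLike.coe_injective (fun g => (List.ofFn fun i => t i (g i)).prod *
      ((-T 1 : k[T;T⁻¹]) ^ invNum g • qDet (k := k) u))]
  · simp only [mul_smul_comm, ← smul_mul_assoc, ← Finset.sum_mul]
    rfl
  · intro g hg
    have := hu.qDet_rows_eq_zero id strictMono_id g fun hinj =>
      hg ⟨Equiv.ofBijective g (Finite.injective_iff_bijective.mp hinj), rfl⟩
    simp only [id] at this
    rw [this, mul_zero]
  · intro g
    rw [hu.qDet_rows_perm g]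

/-- Laplace expansion along the row `i`, with the minors that omit the row `j`: the sum is the
quantum determinant of the rows `i, 0, …, ĵ, …, m`. -/
theorem IsQMatrix.laplace_row {m : ℕ} {t : Fin (m + 1) → Fin (m + 1) → C} (ht : IsQMatrix k t)
    (i j : Fin (m + 1)) :
    ∑ l : Fin (m + 1), t i l * ((-T 1 : k[T;T⁻¹]) ^ (l : ℕ) •
      qDet (k := k) fun a b => t (j.succAbove a) (l.succAbove b)) =
    if i = j then (-T 1 : k[T;T⁻¹]) ^ (j : ℕ) • qDet (k := k) t else 0 := by
  -- expansion along the first row, which is the row `i`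
  have h1 : qDet (k := k) (fun a b => t (Fin.cons (α := fun _ => Fin (m + 1)) i j.succAbove a) b) =
      ∑ l : Fin (m + 1), t i l * ((-T 1 : k[T;T⁻¹]) ^ (l : ℕ) •
        qDet (k := k) fun a b => t (j.succAbove a) (l.succAbove b)) := by
    rw [qDet, ← (Equiv.ofBijective _ consPerm_bijective).sum_comp, Fintype.sum_prod_type]
    refine Finset.sum_congr rfl fun l _ => ?_
    rw [qDet, Finset.smul_sum, Finset.mul_sum]
    refine Finset.sum_congr rfl fun τ _ => ?_
    simp only [Equiv.ofBijective_apply, invNum_consPerm, List.ofFn_succ, List.prod_cons,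
      Fin.cons_zero, Fin.cons_succ, consPerm_zero, consPerm_succ, pow_add, mul_smul_comm, mul_smul]
  rw [← h1]
  split_ifs with h
  · subst h
    have h2 : (Fin.cons (α := fun _ => Fin (m + 1)) i i.succAbove) = consPerm (i, 1) := by
      funext x
      cases x using Fin.cases with
      | zero => simp [consPerm_zero]
      | succ x => simp [consPerm_succ]
    rw [h2, ht.qDet_rows_perm, invNum_consPerm, invNum_one, add_zero]
  · refine ht.qDet_rows_eq_zero id strictMono_id _ fun hinj => ?_
    obtain ⟨x, hx⟩ := Fin.exists_succAbove_eq h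
    have : (0 : Fin (m + 1)) = x.succ := hinj (by simp [hx])
    exact Fin.succ_ne_zero _ this.symm

/-- Factors `t i a`, `t j b` whose order depends on the sorting, by rows or by columns, have `i < j`
and `b < a`, and such entries commute. -/
theorem IsQMatrix.qDet_transpose (ht : IsQMatrix k t) :
    qDet (k := k) (fun i j => t j i) = qDet (k := k) t := by
  rw [qDet, qDet, ← Equiv.sum_comp (Equiv.inv (Equiv.Perm (Fin n))) fun σ =>
    (-T 1 : k[T;T⁻¹]) ^ invNum σ • (List.ofFn fun i => t (σ i) i).prod]
  refine Finset.sum_congr rfl fun σ _ => ?_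
  rw [Equiv.inv_apply, invNum_inv]
  congr 1
  -- both products run over the graph of `σ`, ordered by columns and by rows respectively
  have h1 : (List.ofFn fun i => t (σ⁻¹ i) i) =
      ((List.finRange n).map fun i => (σ⁻¹ i, i)).map fun p => t p.1 p.2 := by
    rw [List.map_map, List.ofFn_eq_map]; rfl
  have h2 : (List.ofFn fun i => t i (σ i)) =
      ((List.finRange n).map fun i => (i, σ i)).map fun p => t p.1 p.2 := by
    rw [List.map_map, List.ofFn_eq_map]; rfl
  rw [h1, h2]
  have hs : (List.finRange n).Pairwise (· < ·) := List.pairwise_lt_finRange n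
  have hn1 : ((List.finRange n).map fun i => (σ⁻¹ i, i)).Nodup :=
    (List.nodup_finRange n).map fun a b h => (Prod.ext_iff.mp h).2
  have hn2 : ((List.finRange n).map fun i => (i, σ i)).Nodup :=
    (List.nodup_finRange n).map fun a b h => (Prod.ext_iff.mp h).1
  refine prod_map_eq_of_perm _ _ _ ?_ hn1 ?_
  · rw [List.perm_ext_iff_of_nodup hn1 hn2]
    rintro ⟨a, b⟩
    simp only [List.mem_map, List.mem_finRange, true_and, Prod.mk.injEq]
    constructor
    · rintro ⟨x, rfl, rfl⟩; exact ⟨_, rfl, by simp⟩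
    · rintro ⟨x, rfl, rfl⟩; exact ⟨_, by simp, rfl⟩
  · intro a b hab hba
    have p1 : ((List.finRange n).map fun i => (σ⁻¹ i, i)).Pairwise fun p r => p.2 < r.2 :=
      List.pairwise_map.mpr hs
    have p2 : ((List.finRange n).map fun i => (i, σ i)).Pairwise fun p r => p.1 < r.1 :=
      List.pairwise_map.mpr hs
    have q1 := List.pairwise_pair.mp (p1.sublist hab)
    have q2 := List.pairwise_pair.mp (p2.sublist hba)
    exact (ht.comm q2 q1).symm

/-- The half turn reverses the order of the factors in each term of the quantum determinant. -/
theorem IsQMatrix.qDet_rev (t : Fin n → Fin n → C) :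
    qDet (k := k) (fun i j => MulOpposite.op (t i.rev j.rev)) =
      MulOpposite.op (qDet (k := k) t) := by
  have hbij : Function.Bijective fun σ : Equiv.Perm (Fin n) => Fin.revPerm * σ * Fin.revPerm :=
    ((Group.mulRight_bijective (Fin.revPerm (n := n))).comp (Group.mulLeft_bijective Fin.revPerm))
  rw [qDet, qDet, ← hbij.sum_comp, ← MulOpposite.opAddEquiv_apply, map_sum]
  refine Finset.sum_congr rfl fun σ _ => ?_
  rw [invNum_rev, MulOpposite.opAddEquiv_apply, MulOpposite.op_smul, MulOpposite.op_list_prod]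
  congr 2
  refine List.ext_getElem (by simp) fun i h1 h2 => ?_
  have hi : i < n := by simpa using h1
  have e : (⟨i, hi⟩ : Fin n).rev = ⟨n - 1 - i, by omega⟩ := Fin.ext (by simp [Fin.val_rev]; omega)
  simp [e]

end QuantumDeterminant

/-! ### Quantum cofactors -/

section Cofactors
open LaurentPolynomial
variable {k : Type*} [Field k] {C : Type*} [Ring C] [Algebra k[T;T⁻¹] C]

theorem skip_eq_succAbove {m : ℕ} (i : Fin (m + 1)) (a : Fin m) :
    skip (m + 1) i a = i.succAbove a := by
  have h : (i.succAboveOrderEmb : Fin m ↪o Fin (m + 1)) =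
      (Finset.univ.erase i).orderEmbOfFin (by simp) :=
    Finset.orderEmbOfFin_unique' _ fun x => by simp [Fin.succAbove_ne]
  exact (DFunLike.congr_fun h a).symm

variable (k) in
/-- The entries `(-q) ^ (i - j) det_q (t with row j and column i removed)` of the quantum cofactor
matrix. -/
noncomputable def qCofactor {n : ℕ} (t : Fin n → Fin n → C) (i j : Fin n) : C :=
  ((-1) ^ ((i : ℕ) + (j : ℕ)) * T ((i : ℤ) - (j : ℤ)) : k[T;T⁻¹]) •
    qDet (k := k) fun a b => t (skip n j a) (skip n i b)

theorem cofactor_sign (i j : ℕ) : ((-1) ^ (i + j) * T ((i : ℤ) - (j : ℤ)) : k[T;T⁻¹]) =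
    (-T (-1)) ^ j * (-T 1) ^ i := by
  rw [neg_pow (T (-1) : k[T;T⁻¹]), neg_pow (T 1 : k[T;T⁻¹]), T_pow, T_pow, pow_add,
    sub_eq_neg_add, T_add]
  simp only [mul_one, mul_neg]
  ring

variable {n : ℕ} {t : Fin n → Fin n → C}

theorem IsQMatrix.mul_cofactor (ht : IsQMatrix k t) (i j : Fin n) :
    ∑ l, t i l * qCofactor k t l j = if i = j then qDet (k := k) t else 0 := by
  obtain _ | m := n
  · exact i.elim0
  have h1 : ∀ l : Fin (m + 1), t i l * qCofactor k t l j = (-T (-1) : k[T;T⁻¹]) ^ (j : ℕ) •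
      (t i l * ((-T 1 : k[T;T⁻¹]) ^ (l : ℕ) •
        qDet (k := k) fun a b => t (j.succAbove a) (l.succAbove b))) := by
    intro l
    rw [qCofactor, cofactor_sign, mul_smul_comm, mul_smul_comm, ← mul_smul]
    simp only [skip_eq_succAbove]
    rfl
  simp only [h1]
  rw [← Finset.smul_sum, ht.laplace_row]
  split_ifs
  · rw [smul_smul, mul_comm, T_one_pow_mul, one_smul]
  · rw [smul_zero]

theorem rev_skip (i : Fin n) (a : Fin (n - 1)) : (skip n i a).rev = skip n i.rev a.rev := by
  obtain _ | m := n
  · exact i.elim0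
  · rw [skip_eq_succAbove, Fin.rev_succAbove]
    exact (skip_eq_succAbove _ _).symm

/-- The half turn, followed by transposition, takes the cofactor matrix to the one over the opposite
algebra. -/
theorem IsQMatrix.cofactor_rev (ht : IsQMatrix k t) (i j : Fin n) :
    qCofactor k (fun i j => MulOpposite.op (t j.rev i.rev)) i j =
      MulOpposite.op (qCofactor k t j.rev i.rev) := by
  rw [qCofactor, qCofactor, MulOpposite.op_smul]
  congr 1
  · congr 1
    · have h1 := Fin.val_rev i
      have h2 := Fin.val_rev j
      have h3 : (j.rev : ℕ) + i.rev + 2 * (i + j + 1) = i + j + 2 * n := by omega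
      have h4 := congrArg (fun e => (-1 : k[T;T⁻¹]) ^ e) h3
      simpa only [pow_add _ _ (2 * _), pow_mul, neg_one_sq, one_pow, mul_one] using h4.symm
    · congr 1
      have h1 := Fin.val_rev i
      have h2 := Fin.val_rev j
      omega
  · simp only [rev_skip]
    rw [IsQMatrix.qDet_rev (fun a b => t (skip n i.rev b) (skip n j.rev a)),
      (ht.submatrix _ _ (skip n i.rev).strictMono (skip n j.rev).strictMono).qDet_transpose]

/-- The left cofactor identity is the right cofactor identity over the opposite algebra, for the
half turn of the transposed matrix. -/
theorem IsQMatrix.cofactor_mul (ht : IsQMatrix k t) (i j : Fin n) :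
    ∑ l, qCofactor k t i l * t l j = if i = j then qDet (k := k) t else 0 := by
  have h := (ht.rev.transpose).mul_cofactor j.rev i.rev
  simp only [ht.cofactor_rev, Fin.rev_rev, ← MulOpposite.op_mul, Fin.rev_inj] at h
  rw [IsQMatrix.qDet_rev fun i j => t j i, ht.qDet_transpose] at h
  rw [← Equiv.sum_comp (Fin.revPerm (n := n))]
  have h2 := congrArg MulOpposite.unop h
  rw [← MulOpposite.opAddEquiv_symm_apply, map_sum] at h2
  rw [show (∑ l, qCofactor k t i (Fin.revPerm l) * t (Fin.revPerm l) j) = _ from h2]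
  by_cases hij : i = j
  · simp [hij]
  · simp [hij, Ne.symm hij]

/-- A left inverse of a quantum matrix of quantum determinant `1` has quantum
determinant `1` over the opposite algebra. -/
theorem IsQMatrix.qDet_inverse {s : Fin n → Fin n → C} (ht : IsQMatrix k t)
    (hd : qDet (k := k) t = 1)
    (hst : ∀ i j, ∑ l, s i l * t l j = if i = j then 1 else 0) :
    qDet (k := k) (fun i j => MulOpposite.op (s i j)) = 1 := by
  classical
  let x : Fin n → Fin n → Cᵐᵒᵖ ⊗[k[T;T⁻¹]] C := fun i j => MulOpposite.op (s i j) ⊗ₜ 1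
  let y : Fin n → Fin n → Cᵐᵒᵖ ⊗[k[T;T⁻¹]] C := fun i j => 1 ⊗ₜ t i j
  have hy : IsQMatrix k y := ht.map
    (Algebra.TensorProduct.includeRight : C →ₐ[k[T;T⁻¹]] Cᵐᵒᵖ ⊗[k[T;T⁻¹]] C)
  have hdet : qDet (k := k) (fun i j => ∑ l, x i l * y l j) =
      qDet (k := k) (fun i j => MulOpposite.op (s i j)) ⊗ₜ 1 := by
    rw [hy.qDet_mul fun i j a b => by
      simp [x, y, Commute, SemiconjBy]]
    have h1 := map_qDet (k := k)
      (Algebra.TensorProduct.includeLeft : Cᵐᵒᵖ →ₐ[k[T;T⁻¹]] Cᵐᵒᵖ ⊗[k[T;T⁻¹]] C)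
      fun i j => MulOpposite.op (s i j)
    have h2 := map_qDet (k := k)
      (Algebra.TensorProduct.includeRight : C →ₐ[k[T;T⁻¹]] Cᵐᵒᵖ ⊗[k[T;T⁻¹]] C) t
    rw [hd, map_one] at h2
    refine (congrArg₂ (· * ·) h1.symm h2.symm).trans ?_
    rw [mul_one]; rfl
  -- `μ` is the multiplication; the matrix `x y` acts under it as the unit matrix
  let μ : Cᵐᵒᵖ ⊗[k[T;T⁻¹]] C →ₗ[k[T;T⁻¹]] C := LinearMap.mul' k[T;T⁻¹] C ∘ₗ
    (MulOpposite.opLinearEquiv k[T;T⁻¹]).symm.toLinearMap.rTensor C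
  have hμ : ∀ i j w, μ ((∑ l, x i l * y l j) * w) =
      (if i = j then (1 : k[T;T⁻¹]) else 0) • μ w := by
    intro i j w
    induction w with
    | zero => simp
    | add u v hu hv => rw [mul_add, map_add, map_add, hu, hv, smul_add]
    | tmul u v =>
      have h : ∀ l, μ (x i l * y l j * u ⊗ₜ v) = u.unop * (s i l * t l j) * v := by
        intro l
        simp [x, y, μ, Algebra.TensorProduct.tmul_mul_tmul, mul_assoc]
      rw [Finset.sum_mul, map_sum]
      simp only [h, ← Finset.sum_mul, ← Finset.mul_sum, hst]
      by_cases hij : i = j <;> simp [hij, μ]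
  -- `μ (F g * w) = E g • μ w` holds for generators `g` of the free algebra, hence for all `g`, and
  -- in particular for the quantum determinant of the generators
  let F : GenAlg n k →ₐ[k[T;T⁻¹]] Cᵐᵒᵖ ⊗[k[T;T⁻¹]] C :=
    FreeAlgebra.lift _ fun p => ∑ l, x p.1 l * y l p.2
  let E : GenAlg n k →ₐ[k[T;T⁻¹]] k[T;T⁻¹] :=
    FreeAlgebra.lift _ fun p => if p.1 = p.2 then 1 else 0
  have hFE : ∀ g w, μ (F g * w) = E g • μ w := by
    intro g
    induction g using FreeAlgebra.induction with
    | grade0 r => intro w; rw [AlgHom.commutes, AlgHom.commutes, ← Algebra.smul_def, map_smul]; rfl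
    | grade1 p => intro w; simpa [F, E] using hμ p.1 p.2 w
    | mul a b ha hb => intro w; rw [map_mul F, mul_assoc, ha, hb, map_mul, mul_smul]
    | add a b ha hb => intro w; rw [map_add, add_mul, map_add, ha, hb, map_add, add_smul]
  have h := hFE (qDet (k := k) (gen k)) 1
  rw [map_qDet, map_qDet, mul_one] at h
  have hF : ∀ i j, F (gen k i j) = ∑ l, x i l * y l j := fun i j => by simp [F, gen]
  have hE : qDet (k := k) (fun i j => E (gen k i j)) = 1 := by
    rw [qDet_of_upper]
    · simp [E, gen]
    · intro i j hij
      simp [E, gen, hij.ne']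
  have hμ1 : μ 1 = 1 := by simp [μ, Algebra.TensorProduct.one_def]
  simp only [hF] at h
  rw [hdet, hE, one_smul, hμ1] at h
  have h3 : (qDet (k := k) (fun i j => MulOpposite.op (s i j))).unop = 1 := by
    simp only [μ, LinearMap.comp_apply, LinearMap.rTensor_tmul, LinearMap.mul'_apply, mul_one] at h
    exact h
  exact MulOpposite.unop_injective h3

end Cofactors

/-! ### Hopf algebra structures from generators -/

section Generators
variable {R A : Type*} [CommRing R] [Ring A] [Algebra R A]

/-- The linear map underlying an algebra homomorphism to the opposite algebra. -/
def unopLinear (S : A →ₐ[R] Aᵐᵒᵖ) : A →ₗ[R] A :=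
  (MulOpposite.opLinearEquiv R).symm.toLinearMap ∘ₗ S.toLinearMap

theorem unopLinear_apply (S : A →ₐ[R] Aᵐᵒᵖ) (a : A) : unopLinear S a = (S a).unop := rfl

/-- If `x = Δ(a)` satisfies the antipode axiom, with `∑ S(a₁) a₂ = r`, then in `x w` the factor `x`
can be replaced by `r`. So the antipode axiom is inherited by products. -/
theorem antipode_left_mul (S : A →ₐ[R] Aᵐᵒᵖ) (x w : A ⊗[R] A)
    (r : R) (hx : LinearMap.mul' R A ((unopLinear S).rTensor A x) = algebraMap R A r) :
    LinearMap.mul' R A ((unopLinear S).rTensor A (x * w)) =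
      r • LinearMap.mul' R A ((unopLinear S).rTensor A w) := by
  have h : ∀ u v, LinearMap.mul' R A ((unopLinear S).rTensor A (x * u ⊗ₜ v)) =
      unopLinear S u * LinearMap.mul' R A ((unopLinear S).rTensor A x) * v := by
    intro u v
    clear hx
    induction x with
    | zero => simp
    | add a b ha hb => simp only [add_mul, map_add, ha, hb, mul_add]
    | tmul a b => simp [unopLinear_apply, mul_assoc]
  induction w with
  | zero => simp
  | add a b ha hb => rw [mul_add, map_add, map_add, ha, hb, map_add, map_add, smul_add]
  | tmul u v =>
    rw [h, hx, ← Algebra.commutes, mul_assoc, ← Algebra.smul_def]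
    simp

theorem antipode_right_mul (S : A →ₐ[R] Aᵐᵒᵖ) (x w : A ⊗[R] A)
    (r : R) (hx : LinearMap.mul' R A ((unopLinear S).lTensor A x) = algebraMap R A r) :
    LinearMap.mul' R A ((unopLinear S).lTensor A (w * x)) =
      r • LinearMap.mul' R A ((unopLinear S).lTensor A w) := by
  have h : ∀ u v, LinearMap.mul' R A ((unopLinear S).lTensor A (u ⊗ₜ v * x)) =
      u * LinearMap.mul' R A ((unopLinear S).lTensor A x) * unopLinear S v := by
    intro u v
    clear hx
    induction x with
    | zero => simp
    | add a b ha hb => simp only [mul_add, map_add, ha, hb, add_mul]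
    | tmul a b => simp [unopLinear_apply, mul_assoc]
  induction w with
  | zero => simp
  | add a b ha hb => rw [add_mul, map_add, map_add, ha, hb, map_add, map_add, smul_add]
  | tmul u v =>
    rw [h, hx, ← Algebra.commutes, mul_assoc, ← Algebra.smul_def]
    simp

theorem algHom_ext_of_adjoin {B : Type*} [Semiring B] [Algebra R B] {s : Set A}
    (hs : Algebra.adjoin R s = ⊤) {f g : A →ₐ[R] B} (h : ∀ a ∈ s, f a = g a) : f = g :=
  AlgHom.ext_of_adjoin_eq_top hs h

/-- A Hopf algebra structure from algebra homomorphisms satisfying the Hopf algebra axioms on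
a set of generators, the antipode being given as a homomorphism to the opposite algebra. -/
def HopfStr.ofGenerators (Δ : A →ₐ[R] A ⊗[R] A) (ε : A →ₐ[R] R) (S : A →ₐ[R] Aᵐᵒᵖ) (s : Set A)
    (hs : Algebra.adjoin R s = ⊤)
    (h1 : ∀ a ∈ s, TensorProduct.assoc R A A A (Δ.toLinearMap.rTensor A (Δ a)) =
      Δ.toLinearMap.lTensor A (Δ a))
    (h2 : ∀ a ∈ s, ε.toLinearMap.rTensor A (Δ a) = 1 ⊗ₜ a)
    (h3 : ∀ a ∈ s, ε.toLinearMap.lTensor A (Δ a) = a ⊗ₜ 1)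
    (h4 : ∀ a ∈ s, LinearMap.mul' R A ((unopLinear S).rTensor A (Δ a)) = algebraMap R A (ε a))
    (h5 : ∀ a ∈ s, LinearMap.mul' R A ((unopLinear S).lTensor A (Δ a)) = algebraMap R A (ε a)) :
    HopfStr R A where
  comul := Δ
  counit := ε
  antipode := unopLinear S
  coassoc := by
    have : ((Algebra.TensorProduct.assoc R R R A A A).toAlgHom.comp
        (Algebra.TensorProduct.map Δ (AlgHom.id R A))).comp Δ =
        (Algebra.TensorProduct.map (AlgHom.id R A) Δ).comp Δ :=
      algHom_ext_of_adjoin hs fun a ha => h1 a ha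
    exact congrArg AlgHom.toLinearMap this
  rTensor_counit := by
    have : (Algebra.TensorProduct.map ε (AlgHom.id R A)).comp Δ =
        (Algebra.TensorProduct.includeRight : A →ₐ[R] R ⊗[R] A) :=
      algHom_ext_of_adjoin hs fun a ha => h2 a ha
    exact congrArg AlgHom.toLinearMap this
  lTensor_counit := by
    have : (Algebra.TensorProduct.map (AlgHom.id R A) ε).comp Δ =
        (Algebra.TensorProduct.includeLeft : A →ₐ[R] A ⊗[R] R) :=
      algHom_ext_of_adjoin hs fun a ha => h3 a ha
    exact congrArg AlgHom.toLinearMap this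
  mul_antipode_rTensor := by
    ext a
    have ha : a ∈ Algebra.adjoin R s := hs ▸ Algebra.mem_top
    change LinearMap.mul' R A ((unopLinear S).rTensor A (Δ a)) = algebraMap R A (ε a)
    induction ha using Algebra.adjoin_induction with
    | mem a ha => exact h4 a ha
    | algebraMap r =>
      rw [AlgHom.commutes, AlgHom.commutes, Algebra.algebraMap_eq_smul_one, map_smul, map_smul,
        Algebra.TensorProduct.one_def]
      simp [unopLinear_apply, Algebra.algebraMap_eq_smul_one]
    | add a b _ _ ha hb => simp only [map_add, ha, hb]
    | mul a b _ _ ha hb =>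
      rw [map_mul, antipode_left_mul S _ _ _ ha, hb, map_mul, map_mul, Algebra.smul_def]
  mul_antipode_lTensor := by
    ext a
    have ha : a ∈ Algebra.adjoin R s := hs ▸ Algebra.mem_top
    change LinearMap.mul' R A ((unopLinear S).lTensor A (Δ a)) = algebraMap R A (ε a)
    induction ha using Algebra.adjoin_induction with
    | mem a ha => exact h5 a ha
    | algebraMap r =>
      rw [AlgHom.commutes, AlgHom.commutes, Algebra.algebraMap_eq_smul_one, map_smul, map_smul,
        Algebra.TensorProduct.one_def]
      simp [unopLinear_apply, Algebra.algebraMap_eq_smul_one]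
    | add a b _ _ ha hb => simp only [map_add, ha, hb]
    | mul a b _ _ ha hb =>
      rw [map_mul, antipode_right_mul S _ _ _ hb, ha, map_mul, map_mul, Algebra.smul_def,
        Algebra.commutes]

end Generators

/-! ### The Hopf algebra structure of the quantum function algebra -/

section QuantumFunctionAlgebra
open LaurentPolynomial
variable (n : ℕ) (k : Type*) [Field k]

theorem isQMatrix_rho : IsQMatrix k (rho (n := n) k) := by
  have h : ∀ {x y}, SlRel n k x y → mkHat n k x = mkHat n k y := fun h =>
    RingQuot.mkAlgHom_rel k[T;T⁻¹] h
  refine IsQMatrix.of_rel (fun i j l hl => ?_) (fun i j l hl => ?_) (fun i j m l h1 h2 => ?_)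
    (fun i j m l h1 h2 => ?_)
  · have := h (SlRel.row i j l hl)
    simp only [map_mul, map_smul] at this
    exact this
  · have := h (SlRel.col i j l hl)
    simp only [map_mul, map_smul] at this
    exact this
  · have := h (SlRel.comm i j m l h1 h2)
    simp only [map_mul] at this
    exact this
  · have := h (SlRel.cross i j m l h1 h2)
    simp only [map_mul, map_smul, map_sub] at this
    exact this

theorem qDet_rho : qDet (k := k) (rho (n := n) k) = 1 := by
  have h : mkHat n k (qDet (k := k) (gen k)) = mkHat n k 1 :=
    RingQuot.mkAlgHom_rel k[T;T⁻¹] SlRel.det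
  rwa [map_qDet, map_one] at h

variable {n k} {C : Type*} [Ring C] [Algebra k[T;T⁻¹] C]

/-- The universal property of the quantum function algebra. -/
noncomputable def liftHat (t : Fin n → Fin n → C) (ht : IsQMatrix k t) (hd : qDet (k := k) t = 1) :
    FHat n k →ₐ[k[T;T⁻¹]] C :=
  RingQuot.liftAlgHom k[T;T⁻¹] ⟨FreeAlgebra.lift k[T;T⁻¹] fun p => t p.1 p.2, by
    intro x y h
    induction h with
    | row i j l h => simpa [gen] using ht.row h
    | col i h l hh => simpa [gen] using ht.col hh
    | comm i j m l h h' => simpa [gen] using ht.comm h h'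
    | cross i j m l h h' => simpa [gen] using ht.cross h h'
    | det => rw [map_qDet, map_one, ← hd]; simp [gen]⟩

theorem liftHat_rho (t : Fin n → Fin n → C) (ht : IsQMatrix k t) (hd : qDet (k := k) t = 1)
    (i j : Fin n) : liftHat t ht hd (rho k i j) = t i j :=
  (RingQuot.liftAlgHom_mkAlgHom_apply _ _ _ _).trans (by simp [gen])

variable (n k) in
theorem adjoin_rho : Algebra.adjoin k[T;T⁻¹] {x | ∃ i j : Fin n, x = rho k i j} = ⊤ := by
  have h1 : (mkHat n k).range = ⊤ :=
    (AlgHom.range_eq_top _).mpr (RingQuot.mkAlgHom_surjective _ _)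
  rw [← h1, ← Algebra.map_top, ← FreeAlgebra.adjoin_range_ι, AlgHom.map_adjoin]
  congr 1
  ext x
  constructor
  · rintro ⟨i, j, rfl⟩
    exact ⟨_, ⟨(i, j), rfl⟩, rfl⟩
  · rintro ⟨_, ⟨⟨i, j⟩, rfl⟩, rfl⟩
    exact ⟨i, j, rfl⟩

variable (n k)

theorem rho_mul_cofactor (i j : Fin n) :
    ∑ l, rho k i l * qCofactor k (rho k) l j = if i = j then 1 else 0 := by
  rw [(isQMatrix_rho n k).mul_cofactor, qDet_rho]

theorem cofactor_mul_rho (i j : Fin n) :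
    ∑ l, qCofactor k (rho k) i l * rho k l j = if i = j then 1 else 0 := by
  rw [(isQMatrix_rho n k).cofactor_mul, qDet_rho]

/-- The coproduct of the quantum function algebra. -/
noncomputable def comulHat : FHat n k →ₐ[k[T;T⁻¹]] FHat n k ⊗[k[T;T⁻¹]] FHat n k :=
  liftHat (fun i j => ∑ l, (rho k i l ⊗ₜ 1) * (1 ⊗ₜ rho k l j))
    (((isQMatrix_rho n k).map (Algebra.TensorProduct.includeLeft :
      FHat n k →ₐ[k[T;T⁻¹]] FHat n k ⊗[k[T;T⁻¹]] FHat n k)).mul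
      ((isQMatrix_rho n k).map (Algebra.TensorProduct.includeRight :
        FHat n k →ₐ[k[T;T⁻¹]] FHat n k ⊗[k[T;T⁻¹]] FHat n k)) fun i j a b => by
          simp [Commute, SemiconjBy])
    (by
      have h1 := map_qDet (k := k) (Algebra.TensorProduct.includeLeft :
        FHat n k →ₐ[k[T;T⁻¹]] FHat n k ⊗[k[T;T⁻¹]] FHat n k) (rho k)
      have h2 := map_qDet (k := k) (Algebra.TensorProduct.includeRight :
        FHat n k →ₐ[k[T;T⁻¹]] FHat n k ⊗[k[T;T⁻¹]] FHat n k) (rho k)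
      rw [qDet_rho, map_one] at h1 h2
      refine (IsQMatrix.qDet_mul ((isQMatrix_rho n k).map (Algebra.TensorProduct.includeRight :
        FHat n k →ₐ[k[T;T⁻¹]] FHat n k ⊗[k[T;T⁻¹]] FHat n k)) fun i j a b => by
          simp [Commute, SemiconjBy]).trans ?_
      refine (congrArg₂ (· * ·) h1.symm h2.symm).trans (mul_one 1))

theorem comulHat_rho (i j : Fin n) :
    comulHat n k (rho k i j) = ∑ l, rho k i l ⊗ₜ rho k l j := by
  refine (liftHat_rho _ _ _ i j).trans ?_
  simp

/-- The antipode of the quantum function algebra, with values in the opposite algebra. -/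
noncomputable def antipodeHat : FHat n k →ₐ[k[T;T⁻¹]] (FHat n k)ᵐᵒᵖ :=
  liftHat (fun i j => MulOpposite.op (qCofactor k (rho k) i j))
    ((isQMatrix_rho n k).inverse (rho_mul_cofactor n k) (cofactor_mul_rho n k))
    ((isQMatrix_rho n k).qDet_inverse (qDet_rho n k) (cofactor_mul_rho n k))

theorem antipodeHat_rho (i j : Fin n) :
    unopLinear (antipodeHat n k) (rho k i j) = qCofactor k (rho k) i j := by
  rw [unopLinear_apply, antipodeHat, liftHat_rho, MulOpposite.unop_op]

/-- The standard Hopf algebra structure of the quantum function algebra. -/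
noncomputable def hopfHat : HopfStr k[T;T⁻¹] (FHat n k) :=
  HopfStr.ofGenerators (comulHat n k) (counitHat n k) (antipodeHat n k) _ (adjoin_rho n k)
    (by
      rintro _ ⟨i, j, rfl⟩
      simp only [comulHat_rho, map_sum, LinearMap.rTensor_tmul, LinearMap.lTensor_tmul,
        AlgHom.toLinearMap_apply, TensorProduct.sum_tmul, TensorProduct.tmul_sum,
        TensorProduct.assoc_tmul]
      exact Finset.sum_comm)
    (by
      rintro _ ⟨i, j, rfl⟩
      simp [comulHat_rho, counitHat_rho, map_sum, TensorProduct.ite_tmul])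
    (by
      rintro _ ⟨i, j, rfl⟩
      simp [comulHat_rho, counitHat_rho, map_sum, TensorProduct.tmul_ite])
    (by
      rintro _ ⟨i, j, rfl⟩
      simp only [comulHat_rho, map_sum, LinearMap.rTensor_tmul, LinearMap.mul'_apply,
        antipodeHat_rho, cofactor_mul_rho, counitHat_rho]
      split_ifs <;> simp)
    (by
      rintro _ ⟨i, j, rfl⟩
      simp only [comulHat_rho, map_sum, LinearMap.lTensor_tmul, LinearMap.mul'_apply,
        antipodeHat_rho, rho_mul_cofactor, counitHat_rho]
      split_ifs <;> simp)

theorem isStandardHopf_hopfHat : IsStandardHopf n (hopfHat n k) :=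
  ⟨comulHat_rho n k, counitHat_rho n k, antipodeHat_rho n k⟩

end QuantumFunctionAlgebra

/-! ### Generators, flatness and universal property of `Ftilde` -/

section TorsionFree
open LaurentPolynomial
variable (k : Type*) [Field k]

theorem isDedekindDomain_laurent : IsDedekindDomain k[T;T⁻¹] :=
  IsLocalization.isDedekindDomain (Polynomial k)
    (M := Submonoid.powers (Polynomial.X : Polynomial k))
    (powers_le_nonZeroDivisors_of_noZeroDivisors Polynomial.X_ne_zero) _

theorem qSub_ne_zero : qSub k ≠ 0 := fun h => qSub_ne k (by rw [h, map_zero])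

variable {k}
theorem qSub_smul_injective {N : Type*} [AddCommGroup N] [Module k[T;T⁻¹] N]
    [Module.Flat k[T;T⁻¹] N] {x y : N} (h : qSub k • x = qSub k • y) : x = y :=
  Module.Flat.isSMulRegular_of_nonZeroDivisors
    (mem_nonZeroDivisors_of_ne_zero (qSub_ne_zero k)) h

variable (k) (n : ℕ)

/-- `Ftilde` is contained in a vector space over the fraction field, so it is torsion free, and thus
flat over the Dedekind domain `k[q, q⁻¹]`. -/
instance : Module.Flat k[T;T⁻¹] (Ftilde n k) := by
  have := isDedekindDomain_laurent k
  rw [IsDedekindDomain.flat_iff_torsion_eq_bot, eq_bot_iff]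
  rintro x ⟨⟨r, hr⟩, h⟩
  have h1 : algebraMap k[T;T⁻¹] (RatQ k) r • (x : Fq n k) = 0 := by
    rw [algebraMap_smul]
    exact congrArg Subtype.val h
  have h2 : algebraMap k[T;T⁻¹] (RatQ k) r ≠ 0 := fun h0 =>
    nonZeroDivisors.ne_zero hr ((map_eq_zero_iff _ (IsFractionRing.injective _ _)).mp h0)
  exact Subtype.ext ((smul_eq_zero.mp h1).resolve_left h2)

theorem toFq_eq_smul_of_mem (r : k[T;T⁻¹]) (x : Fq n k) :
    (algebraMap k[T;T⁻¹] (RatQ k) (qSub k))⁻¹ • (qSub k * r) • x = r • x := by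
  rw [mul_smul, ← algebraMap_smul (RatQ k) (qSub k), smul_smul, inv_mul_cancel₀ (qSub_ne k),
    one_smul]

variable {n} in
theorem hatToTilde_rho (i j : Fin n) :
    hatToTilde n k (rho k i j) = (if i = j then 1 else 0) + qSub k • rGen k i j := by
  apply Subtype.ext
  have h : ((qSub k • rGen k i j : Ftilde n k) : Fq n k) =
      toFq n k (rho k i j - if i = j then 1 else 0) := by
    change qSub k • ((algebraMap k[T;T⁻¹] (RatQ k) (qSub k))⁻¹ • _) = _
    rw [← algebraMap_smul (RatQ k) (qSub k), smul_smul, mul_inv_cancel₀ (qSub_ne k), one_smul]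
  rw [Subalgebra.coe_add, h, map_sub]
  change toFq n k (rho k i j) = _
  split_ifs <;> simp

/-- `FHat` reduces to scalars modulo `(q - 1)` times the algebra generated by the `r_ij`. -/
theorem toFq_eq_counit_add (x : FHat n k) :
    ∃ y ∈ Algebra.adjoin k[T;T⁻¹] {x : Fq n k | ∃ i j : Fin n, x = (rGen k i j : Ftilde n k)},
      toFq n k x = algebraMap _ _ (counitHat n k x) + qSub k • y := by
  have hx : x ∈ Algebra.adjoin k[T;T⁻¹] {x | ∃ i j : Fin n, x = rho k i j} :=
    adjoin_rho n k ▸ Algebra.mem_top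
  induction hx using Algebra.adjoin_induction with
  | mem x hx =>
    obtain ⟨i, j, rfl⟩ := hx
    refine ⟨_, Algebra.subset_adjoin ⟨i, j, rfl⟩, ?_⟩
    have := congrArg Subtype.val (hatToTilde_rho k i j)
    refine this.trans ?_
    rw [Subalgebra.coe_add, counitHat_rho]
    split_ifs <;> simp
  | algebraMap r => exact ⟨0, zero_mem _, by simp⟩
  | add a b _ _ ha hb =>
    obtain ⟨y, hy, h⟩ := ha
    obtain ⟨z, hz, h'⟩ := hb
    exact ⟨y + z, add_mem hy hz, by rw [map_add, h, h', map_add, map_add, smul_add]; abel⟩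
  | mul a b _ _ ha hb =>
    obtain ⟨y, hy, h⟩ := ha
    obtain ⟨z, hz, h'⟩ := hb
    refine ⟨counitHat n k a • z + counitHat n k b • y + qSub k • (y * z),
      add_mem (add_mem (Subalgebra.smul_mem _ hz _) (Subalgebra.smul_mem _ hy _))
        (Subalgebra.smul_mem _ (mul_mem hy hz) _), ?_⟩
    rw [map_mul, h, h', map_mul, map_mul]
    simp only [add_mul, mul_add, Algebra.algebraMap_eq_smul_one, smul_mul_assoc, one_mul,
      mul_smul_comm, mul_one, smul_add, smul_smul, mul_comm (qSub k)]
    abel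

theorem adjoin_rGen : Algebra.adjoin k[T;T⁻¹]
    {x : Fq n k | ∃ i j : Fin n, x = (rGen k i j : Ftilde n k)} = Ftilde n k := by
  apply le_antisymm
  · rw [Algebra.adjoin_le_iff]
    rintro _ ⟨i, j, rfl⟩
    exact (rGen k i j).2
  · set S := Algebra.adjoin k[T;T⁻¹] {x : Fq n k | ∃ i j : Fin n, x = (rGen k i j : Ftilde n k)}
      with hS
    have h1 : scaledAug n k ≤ Subalgebra.toSubmodule S := by
      rintro _ ⟨_, ⟨x, hx, rfl⟩, rfl⟩
      obtain ⟨y, hy, h⟩ := toFq_eq_counit_add k n x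
      obtain ⟨g, hg⟩ := C_evOne k (counitHat n k x)
      have hx0 : evOne k (counitHat n k x) = 0 := hx
      rw [hx0, map_zero, zero_add] at hg
      change (algebraMap k[T;T⁻¹] (RatQ k) (qSub k))⁻¹ • toFq n k x ∈ S
      rw [h, hg, smul_add, Algebra.algebraMap_eq_smul_one (A := Fq n k), toFq_eq_smul_of_mem]
      have := toFq_eq_smul_of_mem k n 1 y
      rw [mul_one, one_smul] at this
      rw [this]
      exact add_mem (Subalgebra.smul_mem _ (one_mem _) _) hy
    have h2 : tildeModule n k ≤ Subalgebra.toSubmodule S := by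
      refine iSup_le fun m => ?_
      induction m with
      | zero =>
        rw [pow_zero, Submodule.one_le]
        exact one_mem S
      | succ m ih =>
        rw [pow_succ, Submodule.mul_le]
        intro a ha b hb
        exact mul_mem (S := Subalgebra _ _) (ih ha) (h1 hb)
    exact h2

theorem adjoin_rGen_eq_top :
    Algebra.adjoin k[T;T⁻¹] {x : Ftilde n k | ∃ i j : Fin n, x = rGen k i j} = ⊤ := by
  apply Subalgebra.map_injective (f := (Ftilde n k).val) Subtype.val_injective
  rw [AlgHom.map_adjoin, Algebra.map_top, Subalgebra.range_val]
  convert adjoin_rGen k n using 2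
  ext x
  constructor
  · rintro ⟨_, ⟨i, j, rfl⟩, rfl⟩
    exact ⟨i, j, rfl⟩
  · rintro ⟨i, j, rfl⟩
    exact ⟨_, ⟨i, j, rfl⟩, rfl⟩

theorem span_Ftilde : Submodule.span (RatQ k) (Ftilde n k : Set (Fq n k)) = ⊤ := by
  rw [eq_top_iff]
  rintro x -
  induction x using TensorProduct.induction_on with
  | zero => exact zero_mem _
  | add a b ha hb => exact add_mem ha hb
  | tmul c x =>
    have h : (c ⊗ₜ[k[T;T⁻¹]] x : RatQ k ⊗[k[T;T⁻¹]] FHat n k) = c • (toFq n k x : Fq n k) := by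
      change _ = c • (1 ⊗ₜ[k[T;T⁻¹]] x : RatQ k ⊗[k[T;T⁻¹]] FHat n k)
      rw [TensorProduct.smul_tmul', smul_eq_mul, mul_one]
    rw [h]
    exact Submodule.smul_mem _ _ (Submodule.subset_span (toFq_mem n k x))

variable {n k} {N : Type*} [Ring N] [Algebra k[T;T⁻¹] N] [Module.Flat k[T;T⁻¹] N]

theorem includeRight_ratQ_injective : Function.Injective
    (Algebra.TensorProduct.includeRight : N →ₐ[k[T;T⁻¹]] RatQ k ⊗[k[T;T⁻¹]] N) :=
  Algebra.TensorProduct.includeRight_injective (IsFractionRing.injective k[T;T⁻¹] (RatQ k))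

/-- The universal property of `Ftilde`: a homomorphism from `FHat` to a flat algebra which is
congruent to the counit modulo `q - 1` on generators extends to `Ftilde`. -/
theorem exists_tilde_extension (f : FHat n k →ₐ[k[T;T⁻¹]] N)
    (h : ∀ i j, ∃ b, f (rho k i j) = (if i = j then 1 else 0) + qSub k • b) :
    ∃ g : Ftilde n k →ₐ[k[T;T⁻¹]] N, ∀ x, g (hatToTilde n k x) = f x := by
  -- extend scalars to `k(q)`, where `q - 1` is invertible; the image of `Ftilde` lies in `N`
  let ι : N →ₐ[k[T;T⁻¹]] RatQ k ⊗[k[T;T⁻¹]] N := Algebra.TensorProduct.includeRight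
  let F : Fq n k →ₐ[RatQ k] RatQ k ⊗[k[T;T⁻¹]] N :=
    Algebra.TensorProduct.map (AlgHom.id (RatQ k) (RatQ k)) f
  have hF : ∀ x, F (toFq n k x) = ι (f x) := fun x => by
    change (AlgHom.id (RatQ k) (RatQ k) 1) ⊗ₜ f x = 1 ⊗ₜ f x
    rw [map_one]
  have hmem : ∀ x : Ftilde n k, F.restrictScalars k[T;T⁻¹] x ∈ ι.range := by
    have hle : Ftilde n k ≤ ι.range.comap (F.restrictScalars k[T;T⁻¹]) := by
      rw [← adjoin_rGen k n, Algebra.adjoin_le_iff]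
      rintro _ ⟨i, j, rfl⟩
      obtain ⟨b, hb⟩ := h i j
      refine ⟨b, ?_⟩
      change ι b = F ((algebraMap k[T;T⁻¹] (RatQ k) (qSub k))⁻¹ •
        toFq n k (rho k i j - if i = j then 1 else 0))
      have h1 : f (rho k i j - if i = j then 1 else 0) = qSub k • b := by
        rw [map_sub, hb]
        split_ifs <;> simp
      rw [map_smul, hF, h1, map_smul, ← algebraMap_smul (RatQ k) (qSub k) (ι b), smul_smul,
        inv_mul_cancel₀ (qSub_ne k), one_smul]
    exact fun x => hle x.2
  let e := AlgEquiv.ofInjective ι includeRight_ratQ_injective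
  refine ⟨e.symm.toAlgHom.comp
    (((F.restrictScalars k[T;T⁻¹]).comp (Ftilde n k).val).codRestrict _ hmem), fun x => ?_⟩
  change e.symm _ = _
  rw [AlgEquiv.symm_apply_eq]
  exact Subtype.ext (hF x)

/-- The extension of `exists_tilde_extension` divides by `q - 1` on generators. -/
theorem tilde_extension_rGen {f : FHat n k →ₐ[k[T;T⁻¹]] N} {g : Ftilde n k →ₐ[k[T;T⁻¹]] N}
    (hg : ∀ x, g (hatToTilde n k x) = f x) {i j : Fin n} {b : N}
    (hb : f (rho k i j) = (if i = j then 1 else 0) + qSub k • b) : g (rGen k i j) = b := by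
  have := hg (rho k i j)
  rw [hatToTilde_rho, map_add, map_smul, hb] at this
  refine qSub_smul_injective (k := k) (add_left_cancel (Eq.trans ?_ this))
  congr 1
  split_ifs <;> simp

end TorsionFree

/-! ### The Hopf algebra structure and the relations of `Ftilde` -/

section TildeHopf
open LaurentPolynomial
variable {n : ℕ} {k : Type*} [Field k]

/-- Linear maps on `Ftilde` with flat target agree on `r_ij` if they agree on `1` and `ρ_ij`. This
reduces the Hopf algebra axioms of `Ftilde` to those of the quantum function algebra. -/
theorem linearMap_eq_on_rGen {N : Type*} [AddCommGroup N] [Module k[T;T⁻¹] N]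
    [Module.Flat k[T;T⁻¹] N] (f g : Ftilde n k →ₗ[k[T;T⁻¹]] N) (h1 : f 1 = g 1)
    (h : ∀ i j, f (hatToTilde n k (rho k i j)) = g (hatToTilde n k (rho k i j))) (i j : Fin n) :
    f (rGen k i j) = g (rGen k i j) := by
  have := h i j
  rw [hatToTilde_rho, map_add, map_add, map_smul, map_smul] at this
  refine qSub_smul_injective (k := k) (add_left_cancel (this.trans ?_))
  congr 1
  split_ifs
  · exact h1.symm
  · simp

instance : Module.Flat k[T;T⁻¹] (Ftilde n k)ᵐᵒᵖ :=
  Module.Flat.of_linearEquiv (MulOpposite.opLinearEquiv k[T;T⁻¹]).symm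

variable (n k)

theorem map_comulHat_rho (i j : Fin n) :
    ((Algebra.TensorProduct.map (hatToTilde n k) (hatToTilde n k)).comp (comulHat n k))
      (rho k i j) = (if i = j then 1 else 0) + qSub k • (rGen k i j ⊗ₜ 1 + 1 ⊗ₜ rGen k i j +
        qSub k • ∑ l, rGen k i l ⊗ₜ rGen k l j) := by
  rw [AlgHom.comp_apply, comulHat_rho, map_sum]
  simp only [Algebra.TensorProduct.map_tmul, hatToTilde_rho, TensorProduct.add_tmul,
    TensorProduct.tmul_add, Finset.sum_add_distrib, TensorProduct.ite_tmul, TensorProduct.tmul_ite,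
    ← TensorProduct.smul_tmul', TensorProduct.tmul_smul,
    smul_add, Finset.smul_sum, Algebra.TensorProduct.one_def, smul_ite, smul_zero,
    Finset.sum_ite_eq, Finset.sum_ite_eq', Finset.mem_univ, if_true]
  by_cases h : i = j
  · simp only [h, if_true]
    abel
  · simp only [h, if_false]
    abel

theorem exists_comulTilde : ∃ g : Ftilde n k →ₐ[k[T;T⁻¹]] Ftilde n k ⊗[k[T;T⁻¹]] Ftilde n k,
    ∀ x, g (hatToTilde n k x) =
      ((Algebra.TensorProduct.map (hatToTilde n k) (hatToTilde n k)).comp (comulHat n k)) x :=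
  exists_tilde_extension (N := Ftilde n k ⊗[k[T;T⁻¹]] Ftilde n k) _
    fun i j => ⟨_, map_comulHat_rho n k i j⟩

/-- The coproduct of `Ftilde`. -/
noncomputable def comulTilde : Ftilde n k →ₐ[k[T;T⁻¹]] Ftilde n k ⊗[k[T;T⁻¹]] Ftilde n k :=
  (exists_comulTilde n k).choose

theorem comulTilde_hat (x : FHat n k) : comulTilde n k (hatToTilde n k x) =
    Algebra.TensorProduct.map (hatToTilde n k) (hatToTilde n k) (comulHat n k x) :=
  (exists_comulTilde n k).choose_spec x

theorem comulTilde_rho (i j : Fin n) : comulTilde n k (hatToTilde n k (rho k i j)) =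
    ∑ l, hatToTilde n k (rho k i l) ⊗ₜ hatToTilde n k (rho k l j) := by
  rw [comulTilde_hat, comulHat_rho, map_sum]
  simp only [Algebra.TensorProduct.map_tmul]

theorem comulTilde_rGen (i j : Fin n) : comulTilde n k (rGen k i j) =
    rGen k i j ⊗ₜ 1 + 1 ⊗ₜ rGen k i j + qSub k • ∑ l, rGen k i l ⊗ₜ rGen k l j :=
  tilde_extension_rGen (N := Ftilde n k ⊗[k[T;T⁻¹]] Ftilde n k)
    (exists_comulTilde n k).choose_spec (map_comulHat_rho n k i j)

theorem counitHat_rho' (i j : Fin n) :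
    counitHat n k (rho k i j) = (if i = j then 1 else 0) + qSub k • 0 := by
  rw [counitHat_rho, smul_zero, add_zero]

theorem exists_counitTilde : ∃ g : Ftilde n k →ₐ[k[T;T⁻¹]] k[T;T⁻¹],
    ∀ x, g (hatToTilde n k x) = counitHat n k x :=
  exists_tilde_extension _ fun i j => ⟨_, counitHat_rho' n k i j⟩

/-- The counit of `Ftilde`. -/
noncomputable def counitTilde : Ftilde n k →ₐ[k[T;T⁻¹]] k[T;T⁻¹] :=
  (exists_counitTilde n k).choose

theorem counitTilde_hat (x : FHat n k) : counitTilde n k (hatToTilde n k x) = counitHat n k x :=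
  (exists_counitTilde n k).choose_spec x

theorem counitTilde_rGen (i j : Fin n) : counitTilde n k (rGen k i j) = 0 :=
  tilde_extension_rGen (exists_counitTilde n k).choose_spec (counitHat_rho' n k i j)

theorem hat_rho_mul_cofactor (i j : Fin n) :
    ∑ l, hatToTilde n k (rho k i l) * hatToTilde n k (qCofactor k (rho k) l j) =
      if i = j then 1 else 0 := by
  simp only [← map_mul, ← map_sum, rho_mul_cofactor]
  split_ifs <;> simp

theorem hat_cofactor_mul_rho (i j : Fin n) :
    ∑ l, hatToTilde n k (qCofactor k (rho k) i l) * hatToTilde n k (rho k l j) =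
      if i = j then 1 else 0 := by
  simp only [← map_mul, ← map_sum, cofactor_mul_rho]
  split_ifs <;> simp

/-- The antipode is congruent to the counit modulo `q - 1`: this follows from the cofactor identity
`∑ ρ_il S(ρ_lj) = δ_ij` and `ρ_il = δ_il + (q - 1) r_il`. -/
theorem op_antipodeHat_rho (i j : Fin n) :
    ((AlgHom.op (hatToTilde n k)).comp (antipodeHat n k)) (rho k i j) =
      (if i = j then 1 else 0) + qSub k • MulOpposite.op
        (-∑ l, rGen k i l * hatToTilde n k (qCofactor k (rho k) l j)) := by
  have h : ((AlgHom.op (hatToTilde n k)).comp (antipodeHat n k)) (rho k i j) =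
      MulOpposite.op (hatToTilde n k (unopLinear (antipodeHat n k) (rho k i j))) := rfl
  rw [h, antipodeHat_rho]
  apply MulOpposite.unop_injective
  have h2 := hat_rho_mul_cofactor n k i j
  simp only [hatToTilde_rho, add_mul, ite_mul, one_mul, zero_mul, Finset.sum_add_distrib,
    Finset.sum_ite_eq, Finset.mem_univ, if_true, smul_mul_assoc, ← Finset.smul_sum] at h2
  rw [eq_sub_of_add_eq h2]
  split_ifs <;> simp [sub_eq_add_neg]

theorem exists_antipodeTilde : ∃ g : Ftilde n k →ₐ[k[T;T⁻¹]] (Ftilde n k)ᵐᵒᵖ,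
    ∀ x, g (hatToTilde n k x) = ((AlgHom.op (hatToTilde n k)).comp (antipodeHat n k)) x :=
  exists_tilde_extension _ fun i j => ⟨_, op_antipodeHat_rho n k i j⟩

/-- The antipode of `Ftilde`, with values in the opposite algebra. -/
noncomputable def antipodeTilde : Ftilde n k →ₐ[k[T;T⁻¹]] (Ftilde n k)ᵐᵒᵖ :=
  (exists_antipodeTilde n k).choose

theorem antipodeTilde_hat (x : FHat n k) : unopLinear (antipodeTilde n k) (hatToTilde n k x) =
    hatToTilde n k (unopLinear (antipodeHat n k) x) :=
  congrArg MulOpposite.unop ((exists_antipodeTilde n k).choose_spec x)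

theorem antipodeTilde_rGen (i j : Fin n) : unopLinear (antipodeTilde n k) (rGen k i j) =
    -∑ l, rGen k i l * hatToTilde n k (qCofactor k (rho k) l j) :=
  congrArg MulOpposite.unop
    (tilde_extension_rGen (exists_antipodeTilde n k).choose_spec (op_antipodeHat_rho n k i j))

/-- The Hopf algebra structure of `Ftilde`. -/
noncomputable def hopfTilde : HopfStr k[T;T⁻¹] (Ftilde n k) :=
  HopfStr.ofGenerators (comulTilde n k) (counitTilde n k) (antipodeTilde n k) _
    (adjoin_rGen_eq_top k n)
    (by
      rintro _ ⟨i, j, rfl⟩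
      refine linearMap_eq_on_rGen
        (N := Ftilde n k ⊗[k[T;T⁻¹]] (Ftilde n k ⊗[k[T;T⁻¹]] Ftilde n k))
        ((TensorProduct.assoc _ _ _ _).toLinearMap ∘ₗ
          (comulTilde n k).toLinearMap.rTensor (Ftilde n k) ∘ₗ (comulTilde n k).toLinearMap)
        ((comulTilde n k).toLinearMap.lTensor (Ftilde n k) ∘ₗ (comulTilde n k).toLinearMap)
        ?_ ?_ i j
      · simp [Algebra.TensorProduct.one_def]
      · intro i j
        simp only [LinearMap.comp_apply, AlgHom.toLinearMap_apply, LinearEquiv.coe_coe,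
          comulTilde_rho, map_sum, LinearMap.rTensor_tmul,
          LinearMap.lTensor_tmul, TensorProduct.sum_tmul, TensorProduct.tmul_sum,
          TensorProduct.assoc_tmul]
        exact Finset.sum_comm)
    (by
      rintro _ ⟨i, j, rfl⟩
      simp [comulTilde_rGen, counitTilde_rGen])
    (by
      rintro _ ⟨i, j, rfl⟩
      simp [comulTilde_rGen, counitTilde_rGen])
    (by
      rintro _ ⟨i, j, rfl⟩
      refine linearMap_eq_on_rGen
        (LinearMap.mul' _ _ ∘ₗ (unopLinear (antipodeTilde n k)).rTensor (Ftilde n k) ∘ₗ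
          (comulTilde n k).toLinearMap)
        (Algebra.linearMap _ _ ∘ₗ (counitTilde n k).toLinearMap) ?_ ?_ i j
      · simp [Algebra.TensorProduct.one_def, unopLinear_apply]
      · intro i j
        simp only [LinearMap.comp_apply, AlgHom.toLinearMap_apply, comulTilde_rho, map_sum,
          LinearMap.rTensor_tmul, LinearMap.mul'_apply, antipodeTilde_hat, antipodeHat_rho,
          hat_cofactor_mul_rho, counitTilde_hat, counitHat_rho]
        split_ifs <;> simp)
    (by
      rintro _ ⟨i, j, rfl⟩
      refine linearMap_eq_on_rGen
        (LinearMap.mul' _ _ ∘ₗ (unopLinear (antipodeTilde n k)).lTensor (Ftilde n k) ∘ₗ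
          (comulTilde n k).toLinearMap)
        (Algebra.linearMap _ _ ∘ₗ (counitTilde n k).toLinearMap) ?_ ?_ i j
      · simp [Algebra.TensorProduct.one_def, unopLinear_apply]
      · intro i j
        simp only [LinearMap.comp_apply, AlgHom.toLinearMap_apply, comulTilde_rho, map_sum,
          LinearMap.lTensor_tmul, LinearMap.mul'_apply, antipodeTilde_hat, antipodeHat_rho,
          hat_rho_mul_cofactor, counitTilde_hat, counitHat_rho]
        split_ifs <;> simp)

theorem hopfHat_isHom : (hopfHat n k).IsHom (hopfTilde n k) (hatToTilde n k) :=
  ⟨comulTilde_hat n k, counitTilde_hat n k, antipodeTilde_hat n k⟩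

/-- The commutation relations of the `r_ij`, obtained from those of the `ρ_ij` by dividing by
`(q - 1) ^ 2`: the coefficients of the quantum matrix relations are divisible by `q - 1`. -/
theorem rGen_commutator (i j a b : Fin n) (c c' : k[T;T⁻¹]) (hc : qWeight k i j = qSub k * c)
    (hc' : qWeight k a b = qSub k * c') :
    rGen k i b * rGen k j a - rGen k j a * rGen k i b =
      (c - c') • ((if i = a then rGen k j b else 0) + (if j = b then rGen k i a else 0) +
        qSub k • (rGen k i a * rGen k j b)) := by
  have h := (isQMatrix_rho n k).map (hatToTilde n k) i j a b
  have hl : hatToTilde n k (rho k i b) * hatToTilde n k (rho k j a) -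
      hatToTilde n k (rho k j a) * hatToTilde n k (rho k i b) =
      qSub k • qSub k • (rGen k i b * rGen k j a - rGen k j a * rGen k i b) := by
    simp only [hatToTilde_rho]
    split_ifs <;> simp only [add_mul, mul_add, one_mul, mul_one, zero_add, smul_mul_assoc,
      mul_smul_comm, smul_add, smul_sub] <;> abel
  have hz : (c - c') • (if i = a then if j = b then (1 : Ftilde n k) else 0 else 0) = 0 := by
    split_ifs with h1 h2
    · have : qSub k * c = qSub k * c' := by rw [← hc, ← hc', h1, h2]
      rw [mul_left_cancel₀ (qSub_ne_zero k) this, sub_self, zero_smul]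
    · exact smul_zero _
    · exact smul_zero _
  have hr : hatToTilde n k (rho k i a) * hatToTilde n k (rho k j b) =
      (if i = a then if j = b then (1 : Ftilde n k) else 0 else 0) + qSub k •
        ((if i = a then rGen k j b else 0) + (if j = b then rGen k i a else 0) +
          qSub k • (rGen k i a * rGen k j b)) := by
    simp only [hatToTilde_rho]
    split_ifs <;> simp only [add_mul, mul_add, one_mul, mul_one, zero_add, add_zero,
      smul_mul_assoc, mul_smul_comm, smul_add] <;> abel
  rw [hl, hr, hc, hc', ← mul_sub, smul_add, mul_smul, hz, smul_zero, zero_add, mul_smul,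
    smul_comm (c - c')] at h
  exact qSub_smul_injective (k := k) (qSub_smul_injective (k := k) h)

theorem prod_ofFn_smul {R A : Type*} [CommRing R] [Ring A] [Algebra R A] {n : ℕ} (r : Fin n → R)
    (b : Fin n → A) :
    (List.ofFn fun i => r i • b i).prod = (∏ i, r i) • (List.ofFn b).prod := by
  induction n with
  | zero => simp
  | succ n ih =>
    rw [List.ofFn_succ, List.prod_cons, ih, Fin.prod_univ_succ, List.ofFn_succ, List.prod_cons,
      smul_mul_smul_comm]

theorem prod_ofFn_one_add_smul {R A : Type*} [CommRing R] [Ring A] [Algebra R A] {n : ℕ} (r : R)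
    (b : Fin n → A) :
    ∃ y, (List.ofFn fun i => 1 + r • b i).prod = 1 + r • ∑ i, b i + r • r • y := by
  induction n with
  | zero => exact ⟨0, by simp⟩
  | succ n ih =>
    obtain ⟨y, hy⟩ := ih fun i => b i.succ
    refine ⟨y + b 0 * ∑ i : Fin n, b i.succ + r • (b 0 * y), ?_⟩
    rw [List.ofFn_succ, List.prod_cons, hy, Fin.sum_univ_succ]
    simp only [add_mul, mul_add, one_mul, mul_one, smul_mul_assoc, mul_smul_comm, smul_add]
    abel

/-- The quantum determinant relation is, to first order in `q - 1`, the vanishing of the trace. -/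
theorem sum_rGen_diag : ∃ y, ∑ i, rGen (n := n) k i i = qSub k • y := by
  have hdet : qDet (k := k) (fun i j => hatToTilde n k (rho k i j)) = 1 := by
    rw [← map_qDet, qDet_rho, map_one]
  -- a permutation `σ ≠ 1` moves at least two indices, so its term is divisible by `(q - 1) ^ 2`
  have hσ : ∀ σ : Equiv.Perm (Fin n), σ ≠ 1 → ∃ y,
      (List.ofFn fun i => hatToTilde n k (rho k i (σ i))).prod = qSub k • qSub k • y := by
    intro σ h1
    have h2 := Equiv.Perm.two_le_card_support_of_ne_one h1
    have h3 : (fun i => hatToTilde n k (rho k i (σ i))) = fun i =>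
        (if σ i ≠ i then qSub k else 1) •
          (if σ i ≠ i then rGen k i (σ i) else hatToTilde n k (rho k i (σ i))) := by
      funext i
      by_cases h : σ i = i
      · simp [h]
      · simp [h, hatToTilde_rho, Ne.symm h]
    have h4 : ∏ i, (if σ i ≠ i then qSub k else 1) = qSub k ^ σ.support.card := by
      rw [Finset.prod_ite, Finset.prod_const_one, mul_one, Finset.prod_const]
      rfl
    refine ⟨qSub k ^ (σ.support.card - 2) • (List.ofFn fun i =>
      (if σ i ≠ i then rGen k i (σ i) else hatToTilde n k (rho k i (σ i)))).prod, ?_⟩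
    rw [h3, prod_ofFn_smul, h4, smul_smul, smul_smul]
    congr 1
    rw [mul_assoc, ← pow_succ', ← pow_succ']
    congr 1
    omega
  choose! y hy using hσ
  obtain ⟨z, hz⟩ := prod_ofFn_one_add_smul (qSub k) fun i => rGen (n := n) k i i
  have h1 : (List.ofFn fun i => hatToTilde n k (rho k i ((1 : Equiv.Perm (Fin n)) i))).prod =
      1 + qSub k • ∑ i, rGen k i i + qSub k • qSub k • z := by
    rw [← hz]
    simp [hatToTilde_rho]
  rw [qDet, ← Finset.add_sum_erase _ _ (Finset.mem_univ 1), h1, invNum_one, pow_zero, one_smul,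
    add_assoc, add_assoc, add_eq_left] at hdet
  have h2 : ∑ σ ∈ Finset.univ.erase 1, (-T 1 : k[T;T⁻¹]) ^ invNum σ •
      (List.ofFn fun i => hatToTilde n k (rho k i (σ i))).prod =
      qSub k • qSub k • ∑ σ ∈ Finset.univ.erase (1 : Equiv.Perm (Fin n)),
        (-T 1 : k[T;T⁻¹]) ^ invNum σ • y σ := by
    rw [Finset.smul_sum, Finset.smul_sum]
    refine Finset.sum_congr rfl fun σ hσ => ?_
    rw [hy σ (Finset.ne_of_mem_erase hσ), smul_comm _ (qSub k), smul_comm _ (qSub k)]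
  rw [h2, ← smul_add, ← smul_add] at hdet
  have h3 := qSub_smul_injective (k := k) (hdet.trans (smul_zero (qSub k)).symm)
  exact ⟨-(z + _), by rw [smul_neg]; exact eq_neg_of_add_eq_zero_left (by rw [smul_add]; exact h3)⟩

end TildeHopf

/-! ### Injectivity criterion for homomorphisms from an enveloping algebra -/

section EnvInjective
variable (k : Type*) [Field k] (L : Type*) [LieRing L] [LieAlgebra k L]
attribute [local instance 100] LieRing.ofAssociativeRing
local notation "U" => UniversalEnvelopingAlgebra k L

/-- The subspace `k + L` of `U(L)`; its powers are the standard filtration. -/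
def envFil : Submodule k U :=
  1 ⊔ LinearMap.range (UniversalEnvelopingAlgebra.ι k (L := L)).toLinearMap

variable {k L}

theorem one_le_envFil : 1 ≤ envFil k L := le_sup_left

theorem ι_mem_envFil (a : L) : UniversalEnvelopingAlgebra.ι k a ∈ envFil k L :=
  Submodule.mem_sup_right ⟨a, rfl⟩

theorem mem_envFil {x : U} (hx : x ∈ envFil k L) :
    ∃ (c : k) (a : L), x = algebraMap k U c + UniversalEnvelopingAlgebra.ι k a := by
  obtain ⟨y, hy, z, ⟨a, rfl⟩, rfl⟩ := Submodule.mem_sup.mp hx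
  obtain ⟨c, rfl⟩ := Submodule.mem_one.mp hy
  exact ⟨c, a, rfl⟩

theorem envFil_pow_mono : Monotone fun d : ℕ => envFil k L ^ d :=
  fun _ _ h => pow_le_pow_right₀ one_le_envFil h

theorem one_mem_envFil_pow (d : ℕ) : (1 : U) ∈ envFil k L ^ d := by
  refine envFil_pow_mono d.zero_le ?_
  change (1 : U) ∈ envFil k L ^ 0
  rw [pow_zero]
  exact Submodule.mem_one.mpr ⟨1, map_one _⟩

theorem exists_mem_envFil_pow (x : U) : ∃ d, x ∈ envFil k L ^ d := by
  induction x using env_induction with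
  | hι a => exact ⟨1, by rw [pow_one]; exact ι_mem_envFil a⟩
  | hc c => exact ⟨0, by rw [pow_zero]; exact Submodule.mem_one.mpr ⟨c, rfl⟩⟩
  | ha a b ha hb =>
    obtain ⟨d, hd⟩ := ha
    obtain ⟨e, he⟩ := hb
    exact ⟨max d e, add_mem (envFil_pow_mono (le_max_left _ _) hd)
      (envFil_pow_mono (le_max_right _ _) he)⟩
  | hm a b ha hb =>
    obtain ⟨d, hd⟩ := ha
    obtain ⟨e, he⟩ := hb
    exact ⟨d + e, by rw [pow_add]; exact Submodule.mul_mem_mul hd he⟩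

/-- To check a linear condition on the step `d + 1` of the filtration it is enough to consider the
step `d` and products with elements of `L`. -/
theorem envFil_succ_le {d : ℕ} {P : Submodule k U} (h0 : envFil k L ^ d ≤ P)
    (h : ∀ y ∈ envFil k L ^ d, ∀ a : L, y * UniversalEnvelopingAlgebra.ι k a ∈ P) :
    envFil k L ^ (d + 1) ≤ P := by
  rw [pow_succ, Submodule.mul_le]
  intro y hy m hm
  obtain ⟨c, a, rfl⟩ := mem_envFil hm
  rw [mul_add]
  refine add_mem (h0 ?_) (h y hy a)
  rw [← Algebra.commutes, ← Algebra.smul_def]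
  exact Submodule.smul_mem _ _ hy

theorem mul_ι_mem_envFil {d : ℕ} {y : U} (hy : y ∈ envFil k L ^ d) (a : L) :
    y * UniversalEnvelopingAlgebra.ι k a ∈ envFil k L ^ (d + 1) := by
  rw [pow_succ]; exact Submodule.mul_mem_mul hy (ι_mem_envFil a)

/-- The adjoint action of `L` preserves the filtration. -/
theorem commutator_mem_envFil (a : L) (d : ℕ) {y : U} (hy : y ∈ envFil k L ^ d) :
    UniversalEnvelopingAlgebra.ι k a * y - y * UniversalEnvelopingAlgebra.ι k a ∈
      envFil k L ^ d := by
  let ad : U →ₗ[k] U := LinearMap.mulLeft k (UniversalEnvelopingAlgebra.ι k a) -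
    LinearMap.mulRight k (UniversalEnvelopingAlgebra.ι k a)
  suffices h : envFil k L ^ d ≤ (envFil k L ^ d).comap ad from h hy
  clear hy
  induction d with
  | zero =>
    intro y hy
    rw [pow_zero] at hy
    obtain ⟨c, rfl⟩ := Submodule.mem_one.mp hy
    have : ad (algebraMap k U c) = 0 := by
      simp only [ad, LinearMap.sub_apply, LinearMap.mulLeft_apply, LinearMap.mulRight_apply]
      rw [Algebra.commutes, sub_self]
    rw [Submodule.mem_comap, this]
    exact zero_mem _
  | succ d ih =>
    refine envFil_succ_le (fun y hy => envFil_pow_mono d.le_succ (ih hy)) fun y hy b => ?_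
    have : ad (y * UniversalEnvelopingAlgebra.ι k b) =
        ad y * UniversalEnvelopingAlgebra.ι k b + y * UniversalEnvelopingAlgebra.ι k ⁅a, b⁆ := by
      rw [LieHom.map_lie, LieRing.of_associative_ring_bracket]
      simp only [ad, LinearMap.sub_apply, LinearMap.mulLeft_apply, LinearMap.mulRight_apply]
      noncomm_ring
    rw [Submodule.mem_comap, this]
    exact add_mem (mul_ι_mem_envFil (ih hy) b) (mul_ι_mem_envFil hy _)

variable (k L) in
/-- The sum of the `M ^ i ⊗ M ^ j` with `i + j = d`, where `M = k + L`. -/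
def envFilTensor (d : ℕ) : Submodule k (U ⊗[k] U) :=
  Submodule.span k {t | ∃ i j, i + j = d ∧ ∃ x ∈ envFil k L ^ i, ∃ y ∈ envFil k L ^ j, t = x ⊗ₜ y}

theorem tmul_mem_envFilTensor {i j d : ℕ} (h : i + j = d) {x y : U} (hx : x ∈ envFil k L ^ i)
    (hy : y ∈ envFil k L ^ j) : x ⊗ₜ[k] y ∈ envFilTensor k L d :=
  Submodule.subset_span ⟨i, j, h, x, hx, y, hy, rfl⟩

theorem envFilTensor_le_succ (d : ℕ) : envFilTensor k L d ≤ envFilTensor k L (d + 1) := by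
  refine Submodule.span_le.mpr ?_
  rintro _ ⟨i, j, h, x, hx, y, hy, rfl⟩
  exact tmul_mem_envFilTensor (by omega) (envFil_pow_mono i.le_succ hx) hy

theorem envComul_mem_envFilTensor (d : ℕ) {x : U} (hx : x ∈ envFil k L ^ d) :
    envComul k L x ∈ envFilTensor k L d := by
  suffices h : envFil k L ^ d ≤ (envFilTensor k L d).comap (envComul k L).toLinearMap from h hx
  clear hx
  induction d with
  | zero =>
    intro y hy
    rw [pow_zero] at hy
    obtain ⟨c, rfl⟩ := Submodule.mem_one.mp hy
    rw [Submodule.mem_comap, AlgHom.toLinearMap_apply, AlgHom.commutes,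
      Algebra.algebraMap_eq_smul_one]
    exact Submodule.smul_mem _ _ (tmul_mem_envFilTensor (add_zero 0) (one_mem_envFil_pow 0)
      (one_mem_envFil_pow 0))
  | succ d ih =>
    refine envFil_succ_le (fun y hy => envFilTensor_le_succ d (ih hy)) fun y hy a => ?_
    rw [Submodule.mem_comap, AlgHom.toLinearMap_apply, map_mul, envComul_ι]
    have h := ih hy
    rw [Submodule.mem_comap, AlgHom.toLinearMap_apply] at h
    generalize envComul k L y = t at h
    clear hy
    induction h using Submodule.span_induction with
    | zero => rw [zero_mul]; exact zero_mem _
    | add s t _ _ hs ht => rw [add_mul]; exact add_mem hs ht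
    | smul c s _ hs => rw [smul_mul_assoc]; exact Submodule.smul_mem _ _ hs
    | mem t ht =>
      obtain ⟨i, j, h, x, hx, y, hy, rfl⟩ := ht
      simp only [mul_add, Algebra.TensorProduct.tmul_mul_tmul, mul_one]
      exact add_mem (tmul_mem_envFilTensor (by omega) (mul_ι_mem_envFil hx a) hy)
        (tmul_mem_envFilTensor (by omega) hx (mul_ι_mem_envFil hy a))

/-- Up to terms of lower degree, `x ↦ ∑ x₁ x₂` is multiplication by `2 ^ d` in degree `d`. -/
theorem mul_envComul_sub_mem (d : ℕ) {x : U} (hx : x ∈ envFil k L ^ (d + 1)) :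
    LinearMap.mul' k U (envComul k L x) - (2 : k) ^ (d + 1) • x ∈ envFil k L ^ d := by
  let D : ℕ → U →ₗ[k] U := fun d =>
    LinearMap.mul' k U ∘ₗ (envComul k L).toLinearMap - (2 : k) ^ d • LinearMap.id
  have hD : ∀ d x, D d x = LinearMap.mul' k U (envComul k L x) - (2 : k) ^ d • x := fun _ _ => rfl
  have hm : ∀ d, ∀ y ∈ envFil k L ^ d, ∀ a : L,
      LinearMap.mul' k U (envComul k L (y * UniversalEnvelopingAlgebra.ι k a)) -
        (2 : k) • (LinearMap.mul' k U (envComul k L y) * UniversalEnvelopingAlgebra.ι k a) ∈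
      envFil k L ^ d := by
    intro d y hy a
    have h := envComul_mem_envFilTensor d hy
    rw [map_mul, envComul_ι]
    generalize envComul k L y = t at h
    clear hy
    induction h using Submodule.span_induction with
    | zero => simp
    | add s t _ _ hs ht =>
      rw [add_mul, map_add, map_add, add_mul, smul_add, add_sub_add_comm]
      exact add_mem hs ht
    | smul c s _ hs =>
      rw [smul_mul_assoc, map_smul, map_smul, smul_mul_assoc, smul_comm, ← smul_sub]
      exact Submodule.smul_mem _ _ hs
    | mem t ht =>
      obtain ⟨i, j, h, x, hx, y, hy, rfl⟩ := ht
      have : LinearMap.mul' k U (x ⊗ₜ[k] y * (UniversalEnvelopingAlgebra.ι k a ⊗ₜ[k] 1 +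
          1 ⊗ₜ[k] UniversalEnvelopingAlgebra.ι k a)) -
          (2 : k) • (LinearMap.mul' k U (x ⊗ₜ[k] y) * UniversalEnvelopingAlgebra.ι k a) =
          x * (UniversalEnvelopingAlgebra.ι k a * y - y * UniversalEnvelopingAlgebra.ι k a) := by
        simp only [mul_add, Algebra.TensorProduct.tmul_mul_tmul, mul_one, map_add,
          LinearMap.mul'_apply, two_smul]
        noncomm_ring
      rw [this, ← h, pow_add]
      exact Submodule.mul_mem_mul hx (commutator_mem_envFil a j hy)
  have step : ∀ d, ∀ y ∈ envFil k L ^ d, ∀ a : L, (D d y * UniversalEnvelopingAlgebra.ι k a) ∈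
      envFil k L ^ d → D (d + 1) (y * UniversalEnvelopingAlgebra.ι k a) ∈ envFil k L ^ d := by
    intro d y hy a h
    have := add_mem (hm d y hy a) (Submodule.smul_mem _ (2 : k) h)
    rw [hD, sub_mul, smul_sub, sub_add_sub_cancel, smul_mul_assoc, smul_smul, ← pow_succ'] at this
    exact this
  suffices h : envFil k L ^ (d + 1) ≤ (envFil k L ^ d).comap (D (d + 1)) from h hx
  clear hx
  have hc : ∀ d, envFil k L ^ d ≤ (envFil k L ^ d).comap (LinearMap.mul' k U ∘ₗ
      (envComul k L).toLinearMap) := by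
    intro d y hy
    have h := envComul_mem_envFilTensor d hy
    rw [Submodule.mem_comap, LinearMap.comp_apply, AlgHom.toLinearMap_apply]
    generalize envComul k L y = t at h
    clear hy
    induction h using Submodule.span_induction with
    | zero => rw [map_zero]; exact zero_mem _
    | add s t _ _ hs ht => rw [map_add]; exact add_mem hs ht
    | smul c s _ hs => rw [map_smul]; exact Submodule.smul_mem _ _ hs
    | mem t ht =>
      obtain ⟨i, j, h, x, hx, y, hy, rfl⟩ := ht
      rw [LinearMap.mul'_apply, ← h, pow_add]
      exact Submodule.mul_mem_mul hx hy
  have hlow : ∀ d e, envFil k L ^ d ≤ (envFil k L ^ d).comap (D e) := by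
    intro d e y hy
    rw [Submodule.mem_comap, hD]
    exact sub_mem (hc d hy) (Submodule.smul_mem _ _ hy)
  induction d with
  | zero =>
    refine envFil_succ_le (hlow 0 1) fun y hy a => step 0 y hy a ?_
    rw [pow_zero] at hy
    obtain ⟨c, rfl⟩ := Submodule.mem_one.mp hy
    have : D 0 (algebraMap k U c) = 0 := by
      rw [hD, AlgHom.commutes, Algebra.algebraMap_eq_smul_one, map_smul,
        Algebra.TensorProduct.one_def, LinearMap.mul'_apply, mul_one, pow_zero, one_smul,
        Algebra.algebraMap_eq_smul_one, sub_self]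
    rw [this, zero_mul]
    exact zero_mem _
  | succ d ih =>
    exact envFil_succ_le (hlow (d + 1) (d + 2)) fun y hy a =>
      step (d + 1) y hy a (mul_ι_mem_envFil (ih hy) a)

/-- The reduced coproduct lowers the degree in both factors. -/
theorem reduced_envComul_mem (d : ℕ) {x : U} (hx : x ∈ envFil k L ^ (d + 1)) :
    envComul k L x - x ⊗ₜ 1 - 1 ⊗ₜ x ∈
      LinearMap.range (TensorProduct.mapIncl (envFil k L ^ d) (envFil k L ^ d)) := by
  have hmem : ∀ d, ∀ y ∈ envFil k L ^ d, ∀ z ∈ envFil k L ^ d, y ⊗ₜ[k] z ∈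
      LinearMap.range (TensorProduct.mapIncl (envFil k L ^ d) (envFil k L ^ d)) :=
    fun d y hy z hz => ⟨⟨y, hy⟩ ⊗ₜ ⟨z, hz⟩, rfl⟩
  have h1 : ∀ d, (1 : U) ∈ envFil k L ^ d := one_mem_envFil_pow
  let D : U →ₗ[k] U ⊗[k] U := (envComul k L).toLinearMap - (TensorProduct.mk k U U).flip 1 -
    TensorProduct.mk k U U 1
  have hD : ∀ x, D x = envComul k L x - x ⊗ₜ 1 - 1 ⊗ₜ x := fun _ => rfl
  suffices h : envFil k L ^ (d + 1) ≤ (LinearMap.range (TensorProduct.mapIncl (envFil k L ^ d)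
    (envFil k L ^ d))).comap D from h hx
  clear hx
  have hDc : ∀ c : k, D (algebraMap k U c) ∈ LinearMap.range (TensorProduct.mapIncl
      (envFil k L ^ 0) (envFil k L ^ 0)) := by
    intro c
    have : D (algebraMap k U c) = -((c • 1 : U) ⊗ₜ[k] 1) := by
      rw [hD, AlgHom.commutes, Algebra.algebraMap_eq_smul_one, Algebra.algebraMap_eq_smul_one,
        Algebra.TensorProduct.one_def, TensorProduct.tmul_smul, TensorProduct.smul_tmul']
      abel
    rw [this]
    exact neg_mem (hmem 0 _ (Submodule.smul_mem _ _ (h1 0)) _ (h1 0))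
  have hmono : ∀ d, LinearMap.range (TensorProduct.mapIncl (envFil k L ^ d) (envFil k L ^ d)) ≤
      LinearMap.range (TensorProduct.mapIncl (envFil k L ^ (d + 1)) (envFil k L ^ (d + 1))) :=
    fun d => TensorProduct.range_mapIncl_mono (envFil_pow_mono d.le_succ)
      (envFil_pow_mono d.le_succ)
  induction d with
  | zero =>
    rw [zero_add, pow_one]
    intro x hx
    obtain ⟨c, a, rfl⟩ := mem_envFil hx
    rw [Submodule.mem_comap, map_add]
    refine add_mem (hDc c) ?_
    have : D (UniversalEnvelopingAlgebra.ι k a) = 0 := by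
      rw [hD, envComul_ι]; abel
    rw [this]
    exact zero_mem _
  | succ d ih =>
    refine envFil_succ_le (fun y hy => hmono d (ih hy)) fun y hy a => ?_
    have ha : UniversalEnvelopingAlgebra.ι k a ∈ envFil k L ^ (d + 1) :=
      envFil_pow_mono (show 1 ≤ d + 1 by omega) (by
        change _ ∈ envFil k L ^ 1
        rw [pow_one]; exact ι_mem_envFil a)
    have h2 : D (y * UniversalEnvelopingAlgebra.ι k a) = y ⊗ₜ UniversalEnvelopingAlgebra.ι k a +
        UniversalEnvelopingAlgebra.ι k a ⊗ₜ y +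
        D y * envComul k L (UniversalEnvelopingAlgebra.ι k a) := by
      simp only [hD, map_mul, envComul_ι, sub_mul, mul_add, Algebra.TensorProduct.tmul_mul_tmul,
        one_mul, mul_one]
      abel
    rw [Submodule.mem_comap, h2]
    refine add_mem (add_mem (hmem _ _ hy _ ha) (hmem _ _ ha _ hy)) ?_
    obtain ⟨w, hw⟩ := ih hy
    rw [← hw]
    clear hw h2
    induction w with
    | zero => rw [map_zero, zero_mul]; exact zero_mem _
    | add s t hs ht => rw [map_add, add_mul]; exact add_mem hs ht
    | tmul s t =>
      rw [TensorProduct.mapIncl, TensorProduct.map_tmul, envComul_ι, mul_add,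
        Algebra.TensorProduct.tmul_mul_tmul, Algebra.TensorProduct.tmul_mul_tmul, mul_one, mul_one]
      exact add_mem
        (hmem _ _ (mul_ι_mem_envFil s.2 a) _ (envFil_pow_mono d.le_succ t.2))
        (hmem _ _ (envFil_pow_mono d.le_succ s.2) _ (mul_ι_mem_envFil t.2 a))

/-- In characteristic `0`, a homomorphism from `U(L)` which is compatible with coproducts and
counits, and is injective on `L`, is injective. No basis of `U(L)` enters: an element of the kernel
of minimal filtration degree `d` is primitive, so `x ↦ ∑ x₁ x₂` multiplies it by `2`. Up to lower
degree the same map is multiplication by `2 ^ d`, so that `d ≥ 2` would not be minimal. -/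
theorem env_injective [CharZero k] {B : Type*} [Ring B] [Algebra k B] (f : U →ₐ[k] B)
    (Δ : B →ₗ[k] B ⊗[k] B) (ε : B →ₗ[k] k)
    (hΔ : ∀ x, Δ (f x) = Algebra.TensorProduct.map f f (envComul k L x))
    (hε : ∀ x, ε (f x) = envCounit k L x)
    (hL : ∀ a : L, f (UniversalEnvelopingAlgebra.ι k a) = 0 → a = 0) : Function.Injective f := by
  suffices h : ∀ d, ∀ x ∈ envFil k L ^ (d + 1), f x = 0 → x = 0 by
    rw [injective_iff_map_eq_zero]
    intro x hx
    obtain ⟨d, hd⟩ := exists_mem_envFil_pow x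
    exact h d x (envFil_pow_mono d.le_succ hd) hx
  intro d
  induction d with
  | zero =>
    intro x hx hfx
    rw [zero_add, pow_one] at hx
    obtain ⟨c, a, rfl⟩ := mem_envFil hx
    have h := hε (algebraMap k U c + UniversalEnvelopingAlgebra.ι k a)
    rw [hfx, map_zero, map_add, AlgHom.commutes, envCounit_ι, add_zero] at h
    have hc : c = 0 := h.symm
    rw [hc, map_zero, zero_add] at hfx ⊢
    rw [hL a hfx, map_zero]
  | succ d ih =>
    intro x hx hfx
    obtain ⟨w, hw⟩ := reduced_envComul_mem (d + 1) hx
    have hinj : Function.Injective (f.toLinearMap ∘ₗ (envFil k L ^ (d + 1)).subtype) := by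
      rw [injective_iff_map_eq_zero]
      exact fun y hy => Subtype.ext (ih y y.2 hy)
    have h0 : TensorProduct.map (f.toLinearMap ∘ₗ (envFil k L ^ (d + 1)).subtype)
        (f.toLinearMap ∘ₗ (envFil k L ^ (d + 1)).subtype) w = 0 := by
      rw [TensorProduct.map_comp, LinearMap.comp_apply]
      refine (congrArg _ hw).trans ?_
      have h := hΔ x
      rw [hfx, map_zero] at h
      change Algebra.TensorProduct.map f f _ = 0
      rw [map_sub, map_sub, ← h, Algebra.TensorProduct.map_tmul, Algebra.TensorProduct.map_tmul,
        hfx, TensorProduct.zero_tmul, TensorProduct.tmul_zero, sub_zero, sub_zero]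
    -- the tensor square of the restriction of `f` to degree at most `d + 1` is injective, so the
    -- reduced coproduct of `x` vanishes
    have hw0 : w = 0 := TensorProduct.map_injective_of_flat_flat _ _ hinj hinj
      (h0.trans (map_zero _).symm)
    rw [hw0, map_zero, sub_sub] at hw
    have h3 := mul_envComul_sub_mem (d + 1) hx
    rw [eq_of_sub_eq_zero hw.symm, map_add, LinearMap.mul'_apply, LinearMap.mul'_apply, mul_one,
      one_mul, ← two_smul k x, ← sub_smul] at h3
    have h4 : (2 : k) - 2 ^ (d + 1 + 1) ≠ 0 := by
      have : (2 : k) ^ (d + 1 + 1) = ((2 ^ (d + 1 + 1) : ℕ) : k) := by push_cast; rfl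
      rw [this, sub_ne_zero, ← Nat.cast_ofNat (R := k), Ne, Nat.cast_inj]
      have : 2 ^ (d + 1) > 1 := Nat.one_lt_two_pow (by omega)
      omega
    exact ih x ((Submodule.smul_mem_iff _ h4).mp h3) hfx

end EnvInjective

/-! ### Co-Poisson structures checked on generators -/

section CoPoissonGenerators
variable {R A : Type*} [CommRing R] [Ring A] [Algebra R A]

/-- If `δ(ab) = δ(a) Δ(b) + Δ(a) δ(b)`, then `δ ⊗ 1` has the same property relative to `Δ ⊗ 1`. -/
theorem rTensor_coderivation (Δ : A →ₐ[R] A ⊗[R] A) (δ : A →ₗ[R] A ⊗[R] A)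
    (hδ : ∀ a b, δ (a * b) = δ a * Δ b + Δ a * δ b) (s t : A ⊗[R] A) :
    δ.rTensor A (s * t) = δ.rTensor A s * Δ.toLinearMap.rTensor A t +
      Δ.toLinearMap.rTensor A s * δ.rTensor A t := by
  induction s with
  | zero => simp
  | add s s' h h' => simp only [add_mul, map_add, h, h']; abel
  | tmul a b =>
    induction t with
    | zero => simp
    | add t t' h h' => simp only [mul_add, map_add, h, h']; abel
    | tmul c d =>
      simp only [Algebra.TensorProduct.tmul_mul_tmul, LinearMap.rTensor_tmul, hδ,
        TensorProduct.add_tmul, AlgHom.toLinearMap_apply]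

theorem lTensor_coderivation (Δ : A →ₐ[R] A ⊗[R] A) (δ : A →ₗ[R] A ⊗[R] A)
    (hδ : ∀ a b, δ (a * b) = δ a * Δ b + Δ a * δ b) (s t : A ⊗[R] A) :
    δ.lTensor A (s * t) = δ.lTensor A s * Δ.toLinearMap.lTensor A t +
      Δ.toLinearMap.lTensor A s * δ.lTensor A t := by
  induction s with
  | zero => simp
  | add s s' h h' => simp only [add_mul, map_add, h, h']; abel
  | tmul a b =>
    induction t with
    | zero => simp
    | add t t' h h' => simp only [mul_add, map_add, h, h']; abel
    | tmul c d =>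
      simp only [Algebra.TensorProduct.tmul_mul_tmul, LinearMap.lTensor_tmul, hδ,
        TensorProduct.tmul_add, AlgHom.toLinearMap_apply]

theorem comm_mul (s t : A ⊗[R] A) : TensorProduct.comm R A A (s * t) =
    TensorProduct.comm R A A s * TensorProduct.comm R A A t :=
  map_mul (Algebra.TensorProduct.comm R A A) s t

theorem assoc_mul (s t : (A ⊗[R] A) ⊗[R] A) : TensorProduct.assoc R A A A (s * t) =
    TensorProduct.assoc R A A A s * TensorProduct.assoc R A A A t :=
  map_mul (Algebra.TensorProduct.assoc R R R A A A) s t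

theorem cyc₃_tmul (a b c : A) : cyc₃ R A (a ⊗ₜ (b ⊗ₜ c)) = b ⊗ₜ (c ⊗ₜ a) := rfl

theorem cyc₃_mul (s t : A ⊗[R] (A ⊗[R] A)) : cyc₃ R A (s * t) = cyc₃ R A s * cyc₃ R A t := by
  have h : ∀ s, cyc₃ R A s = Algebra.TensorProduct.assoc R R R A A A
      (Algebra.TensorProduct.comm R A (A ⊗[R] A) s) := fun _ => rfl
  rw [h, h, h, map_mul, map_mul]

theorem lTensor_comm_mul (s t : A ⊗[R] (A ⊗[R] A)) :
    (TensorProduct.comm R A A).toLinearMap.lTensor A (s * t) =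
      (TensorProduct.comm R A A).toLinearMap.lTensor A s *
        (TensorProduct.comm R A A).toLinearMap.lTensor A t :=
  map_mul (Algebra.TensorProduct.map (AlgHom.id R A)
    (Algebra.TensorProduct.comm R A A).toAlgHom) s t

theorem rTensor_mul (Δ : A →ₐ[R] A ⊗[R] A) (s t : A ⊗[R] A) :
    Δ.toLinearMap.rTensor A (s * t) = Δ.toLinearMap.rTensor A s * Δ.toLinearMap.rTensor A t :=
  map_mul (Algebra.TensorProduct.map Δ (AlgHom.id R A)) s t

theorem coderivation_algebraMap (Δ : A →ₐ[R] A ⊗[R] A) (δ : A →ₗ[R] A ⊗[R] A)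
    (hδ : ∀ a b, δ (a * b) = δ a * Δ b + Δ a * δ b) (r : R) : δ (algebraMap R A r) = 0 := by
  have h := hδ 1 1
  rw [mul_one, map_one Δ, mul_one, one_mul, left_eq_add] at h
  rw [Algebra.algebraMap_eq_smul_one, map_smul, h, smul_zero]

/-- A condition which is stable under sums and products holds everywhere once it holds on algebra
generators and scalars. -/
theorem forall_of_adjoin {s : Set A} (hs : Algebra.adjoin R s = ⊤) {P : A → Prop}
    (h : ∀ x ∈ s, P x) (hc : ∀ r, P (algebraMap R A r)) (ha : ∀ a b, P a → P b → P (a + b))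
    (hm : ∀ a b, P a → P b → P (a * b)) (a : A) : P a := by
  have : a ∈ Algebra.adjoin R s := hs ▸ Algebra.mem_top
  induction this using Algebra.adjoin_induction with
  | mem x hx => exact h x hx
  | algebraMap r => exact hc r
  | add a b _ _ h h' => exact ha a b h h'
  | mul a b _ _ h h' => exact hm a b h h'

/-- For a cobracket compatible with products, the remaining axioms of a co-Poisson Hopf algebra need
only be checked on algebra generators. For the co-Jacobi identity, write `δ₁₂`, `δ₂₃`, `δ₁₃` for the
maps `A → A ⊗ A ⊗ A` obtained from `Δ` by applying `δ` to one factor: by the co-Leibniz identity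
`(Δ ⊗ 1) δ = δ₂₃ + δ₁₃`, and in the cyclic sum for a product `ab` the terms that are bilinear in
these maps cancel. -/
theorem HopfStr.isCoPoisson_of_generators (H : HopfStr R A) (δ : A →ₗ[R] A ⊗[R] A) {s : Set A}
    (hs : Algebra.adjoin R s = ⊤)
    (cocomm : ∀ x ∈ s, TensorProduct.comm R A A (H.comul x) = H.comul x)
    (map_mul : ∀ a b, δ (a * b) = δ a * H.comul b + H.comul a * δ b)
    (skew : ∀ x ∈ s, TensorProduct.comm R A A (δ x) = -δ x)
    (coJacobi : ∀ x ∈ s, TensorProduct.assoc R A A A (δ.rTensor A (δ x)) +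
      cyc₃ R A (TensorProduct.assoc R A A A (δ.rTensor A (δ x))) +
      cyc₃ R A (cyc₃ R A (TensorProduct.assoc R A A A (δ.rTensor A (δ x)))) = 0)
    (coLeibniz : ∀ x ∈ s, TensorProduct.assoc R A A A (H.comul.toLinearMap.rTensor A (δ x)) =
      δ.lTensor A (H.comul x) + (TensorProduct.comm R A A).toLinearMap.lTensor A
        (TensorProduct.assoc R A A A (δ.rTensor A (H.comul x)))) :
    H.IsCoPoisson δ := by
  have h0 : ∀ r, δ (algebraMap R A r) = 0 := coderivation_algebraMap H.comul δ map_mul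
  have h01 : δ 1 = 0 := by simpa using h0 1
  have hcc : ∀ a, TensorProduct.comm R A A (H.comul a) = H.comul a := by
    refine forall_of_adjoin hs cocomm (fun r => ?_) (fun a b ha hb => ?_) fun a b ha hb => ?_
    · rw [AlgHom.commutes]
      exact AlgEquiv.commutes (Algebra.TensorProduct.comm R A A) r
    · rw [map_add, map_add, ha, hb]
    · rw [_root_.map_mul, comm_mul, ha, hb]
  have hsk : ∀ a, TensorProduct.comm R A A (δ a) = -δ a := by
    refine forall_of_adjoin hs skew (fun r => ?_) (fun a b ha hb => ?_) fun a b ha hb => ?_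
    · rw [h0, map_zero, neg_zero]
    · rw [map_add, map_add, ha, hb, neg_add]
    · rw [map_mul, map_add, comm_mul, comm_mul, ha, hb, hcc, hcc, neg_mul, mul_neg, neg_add]
  -- the three-fold coproduct and its symmetry
  let D : A → A ⊗[R] (A ⊗[R] A) := fun a =>
    TensorProduct.assoc R A A A (H.comul.toLinearMap.rTensor A (H.comul a))
  have hD : ∀ a, D a = H.comul.toLinearMap.lTensor A (H.comul a) := fun a =>
    LinearMap.congr_fun H.coassoc a
  have hlc : ∀ t : A ⊗[R] A, (TensorProduct.comm R A A).toLinearMap.lTensor A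
      (H.comul.toLinearMap.lTensor A t) = H.comul.toLinearMap.lTensor A t := by
    intro t
    induction t with
    | zero => simp
    | add u v hu hv => simp only [map_add, hu, hv]
    | tmul u v => simp [hcc]
  have hDc : ∀ a, (TensorProduct.comm R A A).toLinearMap.lTensor A (D a) = D a := by
    intro a
    rw [hD, hlc]
  have hcycl : ∀ (g : A →ₗ[R] A ⊗[R] A) (t : A ⊗[R] A), cyc₃ R A (g.lTensor A t) =
      TensorProduct.assoc R A A A (g.rTensor A (TensorProduct.comm R A A t)) := by
    intro g t
    induction t with
    | zero => simp
    | add u v hu hv => simp only [map_add, hu, hv]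
    | tmul u v => rfl
  have hDcyc : ∀ a, cyc₃ R A (D a) = D a := by
    intro a
    rw [hD, hcycl, hcc, ← hD]
  -- `X`, `Y`, `Z` are the maps `δ₁₂`, `δ₂₃`, `δ₁₃`
  let X : A → A ⊗[R] (A ⊗[R] A) := fun a => TensorProduct.assoc R A A A (δ.rTensor A (H.comul a))
  let Y : A → A ⊗[R] (A ⊗[R] A) := fun a => δ.lTensor A (H.comul a)
  let Z : A → A ⊗[R] (A ⊗[R] A) := fun a =>
    (TensorProduct.comm R A A).toLinearMap.lTensor A (X a)
  let P : A → A ⊗[R] (A ⊗[R] A) := fun a =>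
    TensorProduct.assoc R A A A (H.comul.toLinearMap.rTensor A (δ a))
  have hX : ∀ a b, X (a * b) = X a * D b + D a * X b := by
    intro a b
    simp only [X, D]
    rw [_root_.map_mul, rTensor_coderivation H.comul δ map_mul, map_add, assoc_mul, assoc_mul]
  have hY : ∀ a b, Y (a * b) = Y a * D b + D a * Y b := by
    intro a b
    rw [hD, hD]
    simp only [Y]
    rw [_root_.map_mul, lTensor_coderivation H.comul δ map_mul]
  have hZ : ∀ a b, Z (a * b) = Z a * D b + D a * Z b := by
    intro a b
    simp only [Z]
    rw [hX, map_add, lTensor_comm_mul, lTensor_comm_mul, hDc, hDc]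
  have hP : ∀ a b, P (a * b) = P a * D b + D a * P b := by
    intro a b
    simp only [P, D]
    rw [map_mul, map_add, rTensor_mul, rTensor_mul, map_add, assoc_mul, assoc_mul]
  have hPYZ : ∀ a, P a = Y a + Z a := by
    refine forall_of_adjoin hs coLeibniz (fun r => ?_) (fun a b ha hb => ?_) fun a b ha hb => ?_
    · simp [P, Y, Z, X, h01, Algebra.algebraMap_eq_smul_one, Algebra.TensorProduct.one_def]
    · simp only [P, Y, Z, X, map_add] at ha hb ⊢
      rw [ha, hb]
      abel
    · rw [hP, hY, hZ, ha, hb]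
      simp only [add_mul, mul_add]
      abel
  have cX : ∀ a, cyc₃ R A (X a) = -Z a := by
    intro a
    have h : ∀ t : A ⊗[R] A, cyc₃ R A (TensorProduct.assoc R A A A (δ.rTensor A t)) =
        -(TensorProduct.comm R A A).toLinearMap.lTensor A
          (TensorProduct.assoc R A A A (δ.rTensor A t)) := by
      intro t
      induction t with
      | zero => simp
      | add u v hu hv => simp only [map_add, hu, hv, neg_add]
      | tmul u v =>
        have h1 : ∀ w : A ⊗[R] A, cyc₃ R A (TensorProduct.assoc R A A A (w ⊗ₜ v)) =
            (TensorProduct.comm R A A).toLinearMap.lTensor A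
              (TensorProduct.assoc R A A A (TensorProduct.comm R A A w ⊗ₜ v)) := by
          intro w
          induction w with
          | zero => simp
          | add a b ha hb => simp only [map_add, TensorProduct.add_tmul, ha, hb]
          | tmul a b => rfl
        rw [LinearMap.rTensor_tmul, h1, hsk, TensorProduct.neg_tmul, map_neg, map_neg]
    exact h _
  have cY : ∀ a, cyc₃ R A (Y a) = X a := by
    intro a
    simp only [Y, X]
    rw [hcycl, hcc]
  have cZ : ∀ a, cyc₃ R A (Z a) = -Y a := by
    intro a
    have h : ∀ t : A ⊗[R] A, cyc₃ R A ((TensorProduct.comm R A A).toLinearMap.lTensor A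
        (TensorProduct.assoc R A A A (δ.rTensor A t))) =
        -δ.lTensor A (TensorProduct.comm R A A t) := by
      intro t
      induction t with
      | zero => simp
      | add u v hu hv => simp only [map_add, hu, hv, neg_add]
      | tmul u v =>
        have h1 : ∀ w : A ⊗[R] A, cyc₃ R A ((TensorProduct.comm R A A).toLinearMap.lTensor A
            (TensorProduct.assoc R A A A (w ⊗ₜ v))) = v ⊗ₜ TensorProduct.comm R A A w := by
          intro w
          induction w with
          | zero => simp
          | add a b ha hb =>
            simp only [map_add, TensorProduct.add_tmul, TensorProduct.tmul_add, ha, hb]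
          | tmul a b => rfl
        rw [LinearMap.rTensor_tmul, h1, hsk, TensorProduct.comm_tmul, LinearMap.lTensor_tmul,
          TensorProduct.tmul_neg]
    refine (h _).trans ?_
    rw [hcc]
  let J : A → A ⊗[R] (A ⊗[R] A) := fun a => TensorProduct.assoc R A A A (δ.rTensor A (δ a))
  have hJ : ∀ a b, J (a * b) = J a * D b + P a * X b + X a * P b + D a * J b := by
    intro a b
    simp only [J, P, D, X]
    rw [map_mul, map_add, rTensor_coderivation H.comul δ map_mul,
      rTensor_coderivation H.comul δ map_mul, map_add, map_add, map_add, assoc_mul, assoc_mul,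
      assoc_mul, assoc_mul]
    abel
  have hJJ : ∀ a, J a + cyc₃ R A (J a) + cyc₃ R A (cyc₃ R A (J a)) = 0 := by
    refine forall_of_adjoin hs coJacobi (fun r => ?_) (fun a b ha hb => ?_) fun a b ha hb => ?_
    · simp only [J, h0, map_zero, add_zero]
    · have : J (a + b) = J a + J b := by simp only [J, map_add]
      rw [this, map_add, map_add]
      rw [← add_zero (0 : A ⊗[R] (A ⊗[R] A))]
      nth_rewrite 1 [← ha]
      rw [← hb]
      abel
    · have e : J (a * b) + cyc₃ R A (J (a * b)) + cyc₃ R A (cyc₃ R A (J (a * b))) =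
          (J a + cyc₃ R A (J a) + cyc₃ R A (cyc₃ R A (J a))) * D b +
          D a * (J b + cyc₃ R A (J b) + cyc₃ R A (cyc₃ R A (J b))) := by
        have nm : ∀ s t : A ⊗[R] (A ⊗[R] A), -s * t = -(s * t) := fun s t => neg_mul s t
        have mn : ∀ s t : A ⊗[R] (A ⊗[R] A), s * -t = -(s * t) := fun s t => mul_neg s t
        rw [hJ, hPYZ, hPYZ]
        simp only [map_add, map_neg, cyc₃_mul, hDcyc, cX, cY, cZ, add_mul, mul_add, nm, mn,
          neg_neg]
        abel
      rw [e, ha, hb, zero_mul, mul_zero, add_zero]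
  exact ⟨hcc, hsk, hJJ, hPYZ, map_mul⟩

end CoPoissonGenerators

/-! ### Specialization of algebras and tensor squares at `q = 1` -/

section AtOneLift
open LaurentPolynomial
variable {k : Type*} [Field k] {A : Type*} [Ring A] [Algebra k[T;T⁻¹] A]

theorem atOne_surjective : Function.Surjective (atOne k (A := A)) := Ideal.Quotient.mk_surjective

theorem evOne_C (c : k) : evOne k (C c) = c := by simp [evOne]

theorem evOne_T (m : ℤ) : evOne k (T m) = 1 := by simp [evOne]

theorem atOne_qSub_smul (a : A) : atOne k (qSub k • a) = 0 := by
  rw [atOne_smul, evOne_qSub, zero_smul]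

/-- The algebra homomorphism from the specialization at `q = 1` induced by a ring homomorphism which
is semilinear along `q ↦ 1`. -/
noncomputable def atOneLift {B : Type*} [Ring B] [Algebra k B] (f : A →+* B)
    (hf : ∀ r a, f (r • a) = evOne k r • f a) : AtOne k A →ₐ[k] B where
  __ := Ideal.Quotient.lift (qIdeal k A) f (fun a ha => by
    obtain ⟨b, rfl⟩ := (mem_qIdeal k A a).mp ha
    rw [hf, evOne_qSub, zero_smul])
  commutes' c := by
    change f (algebraMap k[T;T⁻¹] A (C c)) = _
    rw [Algebra.algebraMap_eq_smul_one, hf, map_one, evOne_C, Algebra.algebraMap_eq_smul_one]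

theorem atOneTensor_tmul (a b : A) :
    atOneTensor k (a ⊗ₜ[k[T;T⁻¹]] b) = atOne k a ⊗ₜ[k] atOne k b := rfl

theorem atOneTensor_smul (r : k[T;T⁻¹]) (t : A ⊗[k[T;T⁻¹]] A) :
    atOneTensor k (r • t) = evOne k r • atOneTensor k t := by
  induction t with
  | zero => simp
  | add s t hs ht => rw [smul_add, map_add, map_add, hs, ht, smul_add]
  | tmul a b =>
    rw [TensorProduct.smul_tmul', atOneTensor_tmul, atOne_smul, atOneTensor_tmul,
      TensorProduct.smul_tmul']

theorem atOneTensor_mul (s t : A ⊗[k[T;T⁻¹]] A) :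
    atOneTensor k (s * t) = atOneTensor k s * atOneTensor k t := by
  induction s with
  | zero => simp
  | add s s' h h' => rw [add_mul, map_add, map_add, h, h', add_mul]
  | tmul a b =>
    induction t with
    | zero => simp
    | add t t' h h' => rw [mul_add, map_add, map_add, h, h', mul_add]
    | tmul c d =>
      rw [Algebra.TensorProduct.tmul_mul_tmul, atOneTensor_tmul, atOneTensor_tmul,
        atOneTensor_tmul, Algebra.TensorProduct.tmul_mul_tmul, map_mul, map_mul]

theorem atOneTensor_one : atOneTensor k (1 : A ⊗[k[T;T⁻¹]] A) = 1 := by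
  rw [Algebra.TensorProduct.one_def, atOneTensor_tmul, map_one, Algebra.TensorProduct.one_def]

variable (k A) in
/-- `atOneTensor` as a ring homomorphism. -/
noncomputable def atOneTensorHom : A ⊗[k[T;T⁻¹]] A →+* AtOne k A ⊗[k] AtOne k A where
  __ := atOneTensor k
  map_one' := atOneTensor_one
  map_mul' := atOneTensor_mul

theorem adjoin_atOne_image {s : Set A} (hs : Algebra.adjoin k[T;T⁻¹] s = ⊤) :
    Algebra.adjoin k (atOne k '' s) = ⊤ := by
  rw [eq_top_iff]
  rintro x -
  obtain ⟨a, rfl⟩ := atOne_surjective x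
  refine forall_of_adjoin (P := fun a => atOne k a ∈ Algebra.adjoin k (atOne k '' s)) hs
    (fun x hx => Algebra.subset_adjoin ⟨x, hx, rfl⟩) (fun r => ?_) (fun a b ha hb => ?_)
    (fun a b ha hb => ?_) a
  · rw [Algebra.algebraMap_eq_smul_one, atOne_smul, map_one]
    exact Subalgebra.smul_mem _ (one_mem _) _
  · rw [map_add]; exact add_mem ha hb
  · rw [map_mul]; exact mul_mem ha hb

end AtOneLift

/-! ### The Hopf algebra `Ftilde` at `q = 1` -/

section TildeAtOne
open LaurentPolynomial
variable (n : ℕ) (k : Type*) [Field k]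

/-- The class of `r_ij` at `q = 1`. -/
noncomputable def xGen (i j : Fin n) : AtOne k (Ftilde n k) := atOne k (rGen k i j)

theorem adjoin_xGen :
    Algebra.adjoin k {x : AtOne k (Ftilde n k) | ∃ i j, x = xGen n k i j} = ⊤ := by
  rw [← adjoin_atOne_image (adjoin_rGen_eq_top k n)]
  congr 1
  ext x
  constructor
  · rintro ⟨i, j, rfl⟩
    exact ⟨_, ⟨i, j, rfl⟩, rfl⟩
  · rintro ⟨_, ⟨i, j, rfl⟩, rfl⟩
    exact ⟨i, j, rfl⟩

/-- The coproduct of `Ftilde` at `q = 1`. -/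
noncomputable def comulOne :
    AtOne k (Ftilde n k) →ₐ[k] AtOne k (Ftilde n k) ⊗[k] AtOne k (Ftilde n k) :=
  atOneLift ((atOneTensorHom k (Ftilde n k)).comp (comulTilde n k : _ →+* _)) fun r a => by
    have h : comulTilde n k (r • a) = r • comulTilde n k a := map_smul _ _ _
    exact (congrArg (atOneTensor k) h).trans (atOneTensor_smul r _)

theorem comulOne_atOne (a : Ftilde n k) :
    comulOne n k (atOne k a) = atOneTensor k (comulTilde n k a) := rfl

theorem comulOne_xGen (i j : Fin n) :
    comulOne n k (xGen n k i j) = xGen n k i j ⊗ₜ 1 + 1 ⊗ₜ xGen n k i j := by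
  rw [xGen, comulOne_atOne, comulTilde_rGen, map_add, map_add, atOneTensor_smul, evOne_qSub,
    zero_smul, add_zero, atOneTensor_tmul, atOneTensor_tmul, map_one]

/-- The counit of `Ftilde` at `q = 1`. -/
noncomputable def counitOne : AtOne k (Ftilde n k) →ₐ[k] k :=
  atOneLift ((evOne k).comp (counitTilde n k : _ →+* _)) fun r a => by
    have h : counitTilde n k (r • a) = r • counitTilde n k a := map_smul _ _ _
    exact (congrArg (evOne k) h).trans (map_mul _ _ _)

theorem counitOne_atOne (a : Ftilde n k) :
    counitOne n k (atOne k a) = evOne k (counitTilde n k a) := rfl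

theorem counitOne_xGen (i j : Fin n) : counitOne n k (xGen n k i j) = 0 := by
  rw [xGen, counitOne_atOne, counitTilde_rGen, map_zero]

/-- The antipode of `Ftilde` at `q = 1`, with values in the opposite algebra. -/
noncomputable def antipodeOne : AtOne k (Ftilde n k) →ₐ[k] (AtOne k (Ftilde n k))ᵐᵒᵖ :=
  atOneLift (((atOne k).op : (Ftilde n k)ᵐᵒᵖ →+* _).comp (antipodeTilde n k : _ →+* _))
    fun r a => by
      have h : antipodeTilde n k (r • a) = r • antipodeTilde n k a := map_smul _ _ _
      change MulOpposite.op (atOne k (antipodeTilde n k (r • a)).unop) = _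
      rw [h]
      exact congrArg MulOpposite.op (atOne_smul k r (antipodeTilde n k a).unop)

theorem antipodeOne_atOne (a : Ftilde n k) :
    unopLinear (antipodeOne n k) (atOne k a) = atOne k (unopLinear (antipodeTilde n k) a) := rfl

/-- In `S(r_ij) = -∑ r_il S(ρ_lj)` the factor `S(ρ_lj)` becomes `δ_lj` at `q = 1`. -/
theorem antipodeOne_xGen (i j : Fin n) :
    unopLinear (antipodeOne n k) (xGen n k i j) = -xGen n k i j := by
  have hρ : ∀ i j : Fin n, atOne k (hatToTilde n k (rho k i j)) = if i = j then 1 else 0 := by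
    intro i j
    rw [hatToTilde_rho, map_add, atOne_qSub_smul, add_zero]
    split_ifs <;> simp
  have hc : ∀ i j : Fin n, atOne k (hatToTilde n k (qCofactor k (rho k) i j)) =
      if i = j then 1 else 0 := by
    intro i j
    have h := congrArg (atOne k) (hat_rho_mul_cofactor n k i j)
    simp only [map_sum, map_mul, hρ, ite_mul, one_mul, zero_mul, Finset.sum_ite_eq,
      Finset.mem_univ, if_true] at h
    rw [h]
    split_ifs <;> simp
  rw [xGen, antipodeOne_atOne, antipodeTilde_rGen, map_neg, map_sum]
  simp only [map_mul, hc, mul_ite, mul_one, mul_zero, Finset.sum_ite_eq', Finset.mem_univ, if_true]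

/-- The Hopf algebra structure of `Ftilde` at `q = 1`. -/
noncomputable def hopfOne : HopfStr k (AtOne k (Ftilde n k)) :=
  HopfStr.ofGenerators (comulOne n k) (counitOne n k) (antipodeOne n k) _ (adjoin_xGen n k)
    (by
      rintro _ ⟨i, j, rfl⟩
      simp only [comulOne_xGen, map_add, LinearMap.rTensor_tmul, LinearMap.lTensor_tmul,
        AlgHom.toLinearMap_apply, map_one, Algebra.TensorProduct.one_def, TensorProduct.add_tmul,
        TensorProduct.tmul_add, TensorProduct.assoc_tmul]
      abel)
    (by
      rintro _ ⟨i, j, rfl⟩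
      simp [comulOne_xGen, counitOne_xGen])
    (by
      rintro _ ⟨i, j, rfl⟩
      simp [comulOne_xGen, counitOne_xGen])
    (by
      rintro _ ⟨i, j, rfl⟩
      have h : unopLinear (antipodeOne n k) 1 = 1 := by simp [unopLinear_apply]
      simp [comulOne_xGen, counitOne_xGen, antipodeOne_xGen, h])
    (by
      rintro _ ⟨i, j, rfl⟩
      have h : unopLinear (antipodeOne n k) 1 = 1 := by simp [unopLinear_apply]
      simp [comulOne_xGen, counitOne_xGen, antipodeOne_xGen, h])

theorem hopfTilde_isSpecialization : (hopfTilde n k).IsSpecialization (hopfOne n k) :=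
  ⟨comulOne_atOne n k, counitOne_atOne n k, antipodeOne_atOne n k⟩

variable {n} in
/-- The sign of `j - i`. -/
def ordSign (i j : Fin n) : k := if i < j then 1 else if j < i then -1 else 0

/-- At `q = 1`, the quantum matrix relations become Lie algebra relations. They are those of the
matrix coefficients in `sl_n*`, see `lie_slCoord`. -/
theorem xGen_commutator (i j a b : Fin n) :
    xGen n k i b * xGen n k j a - xGen n k j a * xGen n k i b =
      (ordSign k i j - ordSign k a b) •
        ((if i = a then xGen n k j b else 0) + if j = b then xGen n k i a else 0) := by
  have hw : ∀ i j : Fin n, ∃ c, qWeight k i j = qSub k * c ∧ evOne k c = ordSign k i j + 1 := by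
    intro i j
    rcases lt_trichotomy i j with h | h | h
    · refine ⟨1 + T (-1), ?_, by simp [evOne_T, ordSign, h]⟩
      simp only [qWeight, h.ne, h, if_true, if_false, qSub, sub_mul, mul_add, mul_one, one_mul,
        T_one_mul_T_neg_one]
      ring
    · exact ⟨1, by simp [qWeight, h, qSub], by simp [ordSign, h]⟩
    · exact ⟨0, by simp [qWeight, h.ne', h.not_gt], by simp [ordSign, h, h.not_gt]⟩
  obtain ⟨c, hc, hc1⟩ := hw i j
  obtain ⟨c', hc', hc1'⟩ := hw a b
  have h := congrArg (atOne k) (rGen_commutator n k i j a b c c' hc hc')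
  rw [map_sub, map_mul, map_mul, atOne_smul, map_add, atOne_qSub_smul, add_zero, map_sub, hc1,
    hc1', add_sub_add_right_eq_sub, map_add] at h
  refine h.trans ?_
  congr 2 <;> split_ifs <;> simp [xGen]

/-- At `q = 1` the quantum determinant relation becomes the trace relation, which also holds between
the matrix coefficients on `sl_n`. -/
theorem sum_xGen_diag : ∑ i, xGen n k i i = 0 := by
  obtain ⟨y, hy⟩ := sum_rGen_diag n k
  simpa only [map_sum, atOne_qSub_smul, xGen] using congrArg (atOne k) hy

end TildeAtOne

/-! ### A triangular quantum matrix over a matrix algebra -/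

section TestRepresentation
open LaurentPolynomial
variable (n : ℕ) (k : Type*) [Field k]

/-- The quantum matrix which defines the test representation, before normalizing the quantum
determinant: `1 + (q⁻¹ - 1) E_ii` on the diagonal, and `-(q - q⁻¹) E_ji` above it. In
`Mat_n ⊗ Mat_n` this is the inverse of the `R`-matrix
`∑ q ^ δ_ij E_ii ⊗ E_jj + (q - q⁻¹) ∑_{i < j} E_ij ⊗ E_ji`. -/
noncomputable def testRaw (i j : Fin n) : Matrix (Fin n) (Fin n) k[T;T⁻¹] :=
  if i = j then 1 + (T (-1) - 1 : k[T;T⁻¹]) • Matrix.single i i 1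
  else if i < j then -((T 1 - T (-1) : k[T;T⁻¹]) • Matrix.single j i 1) else 0

variable {n}

theorem testRaw_self (i : Fin n) :
    testRaw n k i i = 1 + (T (-1) - 1 : k[T;T⁻¹]) • Matrix.single i i 1 := if_pos rfl

theorem testRaw_of_lt {i j : Fin n} (h : i < j) :
    testRaw n k i j = -((T 1 - T (-1) : k[T;T⁻¹]) • Matrix.single j i 1) := by
  rw [testRaw, if_neg h.ne, if_pos h]

theorem testRaw_of_gt {i j : Fin n} (h : j < i) : testRaw n k i j = 0 := by
  rw [testRaw, if_neg h.ne', if_neg h.not_gt]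

theorem single_mul_single_ne {R : Type*} [Ring R] (a b c d : Fin n) (h : b ≠ c) :
    (Matrix.single a b (1 : R) : Matrix (Fin n) (Fin n) R) * Matrix.single c d 1 = 0 :=
  Matrix.single_mul_single_of_ne _ _ _ _ h _

theorem isQMatrix_testRaw : IsQMatrix k (testRaw n k) := by
  have hT := T_one_mul_T_neg_one (k := k)
  have same : ∀ a b c : Fin n,
      (Matrix.single a b (1 : k[T;T⁻¹]) : Matrix (Fin n) (Fin n) k[T;T⁻¹]) *
      Matrix.single b c 1 = Matrix.single a c 1 := fun a b c => by
    rw [Matrix.single_mul_single_same, one_mul]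
  refine IsQMatrix.of_rel (fun i j l h => ?_) (fun i h l hh => ?_) (fun i j m l h h' => ?_)
    (fun i j m l h h' => ?_)
  · rcases lt_trichotomy i j with h1 | rfl | h1
    · simp [testRaw_of_lt, h1, h1.trans h, h1.ne, (h1.trans h).ne]
    · rw [testRaw_self, testRaw_of_lt k h]
      simp only [mul_neg, neg_mul, add_mul, mul_add, one_mul, mul_one, smul_mul_assoc,
        mul_smul_comm, same, single_mul_single_ne _ _ _ _ h.ne, smul_zero, add_zero, smul_neg]
      linear_combination (norm := module) hT • ((T 1 - T (-1) : k[T;T⁻¹]) •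
        (Matrix.single l i 1 : Matrix (Fin n) (Fin n) k[T;T⁻¹]))
    · simp [testRaw_of_gt, h1]
  · rcases lt_trichotomy h l with h1 | rfl | h1
    · simp [testRaw_of_lt, h1, hh.trans h1, h1.ne, (hh.trans h1).ne]
    · rw [testRaw_self, testRaw_of_lt k hh]
      simp only [mul_neg, neg_mul, add_mul, mul_add, one_mul, mul_one, smul_mul_assoc,
        mul_smul_comm, same, single_mul_single_ne _ _ _ _ hh.ne, smul_zero, smul_neg]
      linear_combination (norm := module) hT • ((T 1 - T (-1) : k[T;T⁻¹]) •
        (Matrix.single h i 1 : Matrix (Fin n) (Fin n) k[T;T⁻¹]))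
    · simp [testRaw_of_gt, h1]
  · rcases lt_trichotomy j m with h1 | rfl | h1
    · have h2 := h.trans (h1.trans h')
      rw [testRaw_of_lt k h1, testRaw_of_lt k h2]
      simp [(h.trans h1).ne, (h1.trans h').ne]
    · rw [testRaw_self, testRaw_of_lt k (h.trans h')]
      simp [h.ne, h'.ne, add_mul, mul_add]
    · simp [testRaw_of_gt, h1]
  · by_cases hjm : m < j
    · rw [testRaw_of_gt k hjm, mul_zero, smul_zero]
      rcases lt_trichotomy i m with h1 | rfl | h1
      · rcases lt_trichotomy j l with h2 | rfl | h2
        · rw [testRaw_of_lt k h1, testRaw_of_lt k h2]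
          simp [hjm.ne', (h1.trans h').ne]
        · rw [testRaw_of_lt k h1, testRaw_self]
          simp [h.ne, hjm.ne', add_mul, mul_add]
        · simp [testRaw_of_gt, h2]
      · rcases lt_trichotomy j l with h2 | rfl | h2
        · rw [testRaw_of_lt k h2, testRaw_self]
          simp [h'.ne, h.ne', add_mul, mul_add]
        · rw [testRaw_self, testRaw_self]
          simp [h.ne, h.ne', add_mul, mul_add]
          abel
        · simp [testRaw_of_gt, h2]
      · simp [testRaw_of_gt, h1]
    · have hjm := le_of_not_gt hjm
      have h1 := h.trans_le hjm
      have h2 := hjm.trans_lt h'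
      rw [testRaw_of_lt k h1, testRaw_of_lt k h2, testRaw_of_lt k (h.trans h2)]
      rcases hjm.lt_or_eq with h3 | rfl
      · rw [testRaw_of_lt k h3]
        simp [h3.ne, h1.ne, (h1.trans h').ne]
      · rw [testRaw_self]
        simp [h.ne, (h.trans h').ne, mul_add]

end TestRepresentation

/-! ### Linear relations between the generators at `q = 1` -/

section TestRepresentation
open LaurentPolynomial
variable {n : ℕ} (k : Type*) [Field k]

/-- Rescaling the rows of a quantum matrix by scalars gives a quantum matrix. -/
theorem IsQMatrix.smul_row {k C : Type*} [Field k] [Ring C] [Algebra k[T;T⁻¹] C] {n : ℕ}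
    {t : Fin n → Fin n → C} (ht : IsQMatrix k t) (r : Fin n → k[T;T⁻¹]) :
    IsQMatrix k fun i j => r i • t i j := by
  intro i j a b
  rw [smul_mul_smul_comm, smul_mul_smul_comm, smul_mul_smul_comm, mul_comm (r j), ← smul_sub, ht,
    smul_comm]

/-- The row factors which turn the quantum determinant of `testRaw` into `1`. -/
noncomputable def testScale (i : Fin n) : k[T;T⁻¹] := if i.val = 0 then T 1 else 1

/-- The quantum matrix, of quantum determinant `1`, which defines the test representation. -/
noncomputable def testMatrix (i j : Fin n) : Matrix (Fin n) (Fin n) k[T;T⁻¹] :=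
  testScale k i • testRaw n k i j

theorem isQMatrix_testMatrix : IsQMatrix k (testMatrix (n := n) k) :=
  (isQMatrix_testRaw k).smul_row (testScale k)

theorem qDet_testMatrix : qDet (k := k) (testMatrix (n := n) k) = 1 := by
  rw [qDet_of_upper (testMatrix k) fun i j h => by rw [testMatrix, testRaw_of_gt k h, smul_zero]]
  have h1 : (fun i : Fin n => testMatrix k i i) = fun i => Matrix.diagonalRingHom (Fin n) k[T;T⁻¹]
      (fun a => testScale k i * if a = i then T (-1) else 1) := by
    funext i
    ext a b
    rw [testMatrix, testRaw_self, Matrix.diagonalRingHom_apply, Matrix.smul_apply,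
      Matrix.add_apply, Matrix.smul_apply, Matrix.one_apply, Matrix.single_apply,
      Matrix.diagonal_apply]
    by_cases hab : a = b
    · subst hab
      by_cases ha : a = i
      · simp [ha]
      · simp [ha, Ne.symm ha]
    · have : ¬ (i = a ∧ i = b) := fun h => hab (h.1.symm.trans h.2)
      simp [hab, this]
  have h2 : (List.ofFn fun i : Fin n => Matrix.diagonalRingHom (Fin n) k[T;T⁻¹]
      (fun a => testScale k i * if a = i then T (-1) else 1)) =
      (List.ofFn fun i : Fin n => fun a => testScale k i * if a = i then T (-1) else 1).map
        (Matrix.diagonalRingHom (Fin n) k[T;T⁻¹]) := by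
    rw [List.map_ofFn]
    rfl
  rw [h1, h2, ← map_list_prod, List.prod_ofFn]
  have h3 : (∏ i : Fin n, fun a : Fin n => testScale k i * if a = i then T (-1) else 1) = 1 := by
    funext a
    have h4 : ∏ i : Fin n, testScale k i = T 1 := by
      have ha : 0 < n := a.pos
      rw [Finset.prod_eq_single (⟨0, ha⟩ : Fin n)]
      · simp [testScale]
      · intro b _ hb
        exact if_neg fun h => hb (Fin.ext h)
      · simp
    rw [Finset.prod_apply, Finset.prod_mul_distrib, h4, Finset.prod_ite_eq,
      if_pos (Finset.mem_univ a), T_one_mul_T_neg_one]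
    rfl
  rw [h3, map_one]

/-- The images of the `r_ij` in the test representation at `q = 1`. -/
noncomputable def testOne (i j : Fin n) : Matrix (Fin n) (Fin n) k :=
  if i = j then (if i.val = 0 then 1 else 0) - Matrix.single i i 1
  else if i < j then -((2 : k) • Matrix.single j i 1) else 0

/-- The test matrix is congruent to the identity modulo `q - 1`, and `testOne` is its first order
term. -/
theorem exists_testMatrix_eq (i j : Fin n) : ∃ y : Matrix (Fin n) (Fin n) k[T;T⁻¹],
    testMatrix k i j = (if i = j then 1 else 0) + qSub k • y ∧
      (evOne k).mapMatrix y = testOne k i j := by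
  have hT := T_one_mul_T_neg_one (k := k)
  have hm : ∀ a b : Fin n, (evOne k).mapMatrix (Matrix.single a b (1 : k[T;T⁻¹])) =
      Matrix.single a b 1 := fun a b => by
    rw [RingHom.mapMatrix_apply, Matrix.map_single, map_one]
  have hs : ∀ (r : k[T;T⁻¹]) (y : Matrix (Fin n) (Fin n) k[T;T⁻¹]),
      (evOne k).mapMatrix (r • y) = evOne k r • (evOne k).mapMatrix y := fun r y => by
    ext a b
    simp
  have hr : evOne k (testScale k i) = 1 := by
    rw [testScale]; split_ifs <;> simp [evOne_T]
  rcases lt_trichotomy i j with h | rfl | h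
  · refine ⟨-((testScale k i * (1 + T (-1))) • Matrix.single j i 1), ?_, ?_⟩
    · rw [testMatrix, testRaw_of_lt k h, if_neg h.ne, qSub]
      linear_combination (norm := module) hT • (testScale k i •
        (Matrix.single j i 1 : Matrix (Fin n) (Fin n) k[T;T⁻¹]))
    · rw [map_neg, hs, hm, testOne, if_neg h.ne, if_pos h, map_mul, hr, one_mul, map_add, evOne_T,
        map_one, one_add_one_eq_two]
  · by_cases hi : i.val = 0
    · refine ⟨1 - Matrix.single i i 1, ?_, ?_⟩
      · rw [testMatrix, testRaw_self, testScale, if_pos hi, if_pos rfl, qSub]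
        linear_combination (norm := module) hT •
          (Matrix.single i i 1 : Matrix (Fin n) (Fin n) k[T;T⁻¹])
      · rw [map_sub, map_one, hm, testOne, if_pos rfl, if_pos hi]
    · refine ⟨-((T (-1) : k[T;T⁻¹]) • Matrix.single i i 1), ?_, ?_⟩
      · rw [testMatrix, testRaw_self, testScale, if_neg hi, if_pos rfl, qSub]
        linear_combination (norm := module) hT •
          (Matrix.single i i 1 : Matrix (Fin n) (Fin n) k[T;T⁻¹])
      · rw [map_neg, hs, hm, testOne, if_pos rfl, if_neg hi, evOne_T, one_smul, zero_sub]
  · exact ⟨0, by rw [testMatrix, testRaw_of_gt k h, if_neg h.ne']; simp,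
      by rw [testOne, if_neg h.ne', if_neg h.not_gt, map_zero]⟩

variable {k}

/-- A quantum matrix over `Mat_n(k[q, q⁻¹])` which is congruent to the identity modulo `q - 1`
gives a representation of `Ftilde` at `q = 1`. -/
theorem exists_atOne_rep {t y : Fin n → Fin n → Matrix (Fin n) (Fin n) k[T;T⁻¹]}
    (ht : IsQMatrix k t) (hd : qDet (k := k) t = 1)
    (hy : ∀ i j, t i j = (if i = j then 1 else 0) + qSub k • y i j) :
    ∃ f : AtOne k (Ftilde n k) →ₐ[k] Matrix (Fin n) (Fin n) k,
      ∀ i j, f (xGen n k i j) = (evOne k).mapMatrix (y i j) := by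
  have hb : ∀ i j, liftHat t ht hd (rho k i j) = (if i = j then 1 else 0) + qSub k • y i j :=
    fun i j => (liftHat_rho t ht hd i j).trans (hy i j)
  obtain ⟨g, hg⟩ := exists_tilde_extension (liftHat t ht hd) fun i j => ⟨_, hb i j⟩
  refine ⟨atOneLift ((evOne k).mapMatrix.comp (g : _ →+* _)) fun r a => ?_, fun i j => ?_⟩
  · have h : g (r • a) = r • g a := map_smul _ _ _
    refine (congrArg (evOne k).mapMatrix h).trans ?_
    ext a b
    simp
  · exact congrArg (evOne k).mapMatrix (tilde_extension_rGen hg (hb i j))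

variable (n k)

/-- The test representation kills the `x_ij` with `i > j`. -/
theorem exists_testRep : ∃ f : AtOne k (Ftilde n k) →ₐ[k] Matrix (Fin n) (Fin n) k,
    ∀ i j, f (xGen n k i j) = testOne k i j := by
  choose y hy hy1 using exists_testMatrix_eq (n := n) k
  obtain ⟨f, hf⟩ := exists_atOne_rep (isQMatrix_testMatrix k) (qDet_testMatrix k) hy
  exact ⟨f, fun i j => (hf i j).trans (hy1 i j)⟩

/-- The representation defined by the transposed test matrix kills the `x_ij` with `i < j`. -/
theorem exists_testRep_transpose : ∃ f : AtOne k (Ftilde n k) →ₐ[k] Matrix (Fin n) (Fin n) k,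
    ∀ i j, f (xGen n k i j) = testOne k j i := by
  choose y hy hy1 using exists_testMatrix_eq (n := n) k
  obtain ⟨f, hf⟩ := exists_atOne_rep (y := fun i j => y j i) (isQMatrix_testMatrix k).transpose
    ((isQMatrix_testMatrix k).qDet_transpose.trans (qDet_testMatrix k))
    fun i j => by simp only [hy j i, eq_comm]
  exact ⟨f, fun i j => (hf i j).trans (hy1 j i)⟩

/-- The only linear relation between the classes `x_ij` of the `r_ij` at `q = 1` is `∑ x_ii = 0`. -/
theorem scalar_of_sum_xGen_eq_zero [CharZero k] (M : Matrix (Fin n) (Fin n) k)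
    (h : ∑ i, ∑ j, M j i • xGen n k i j = 0) : ∃ c : k, M = Matrix.diagonal fun _ => c := by
  obtain ⟨f, hf⟩ := exists_testRep n k
  obtain ⟨g, hg⟩ := exists_testRep_transpose n k
  have h1 : ∑ i, ∑ j, M j i • testOne k i j = 0 := by
    have := congrArg f h
    simpa only [map_sum, map_smul, hf, map_zero] using this
  have h2 : ∑ i, ∑ j, M j i • testOne k j i = 0 := by
    have := congrArg g h
    simpa only [map_sum, map_smul, hg, map_zero] using this
  have e : ∀ i j a b : Fin n, testOne k i j a b =
      if i = j then (if i.val = 0 ∧ a = b then 1 else 0) - (if i = a ∧ i = b then 1 else 0)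
      else if i < j then -(2 * if j = a ∧ i = b then 1 else 0) else 0 := by
    intro i j a b
    rw [testOne]
    by_cases h1 : i = j
    · by_cases h2 : i.val = 0 <;> simp [h1, h1 ▸ h2, Matrix.single_apply, Matrix.one_apply]
    · by_cases h2 : i < j <;> simp [h1, h2, Matrix.single_apply]
  have e1 : ∀ i j a b : Fin n, b < a → testOne k i j a b = if i = b ∧ j = a then -2 else 0 := by
    intro i j a b hab
    rw [e]
    by_cases h1 : i = b ∧ j = a
    · simp [h1, hab, hab.ne]
    · rw [if_neg h1]
      have h2 : ¬ (j = a ∧ i = b) := fun h => h1 ⟨h.2, h.1⟩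
      have h3 : ¬ (i = a ∧ i = b) := fun h => hab.ne' (h.1.symm.trans h.2)
      simp [h2, h3, hab.ne']
  have e2 : ∀ i j a : Fin n, testOne k i j a a =
      if i = j then (if i.val = 0 then 1 else 0) - (if i = a then 1 else 0) else 0 := by
    intro i j a
    rw [e]
    by_cases h1 : i = j
    · simp [h1]
    · have h2 : ¬ (j = a ∧ i = a) := fun h => h1 (h.2.trans h.1.symm)
      simp [h1, h2]
  -- the two representations show that `M` is upper and lower triangular
  have lo : ∀ a b : Fin n, b < a → M a b = 0 := by
    intro a b hab
    have h3 := congrFun (congrFun h1 a) b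
    simp only [Matrix.sum_apply, Matrix.smul_apply, e1 _ _ a b hab, ite_and, smul_ite, smul_zero,
      Matrix.zero_apply] at h3
    rw [Finset.sum_eq_single b (fun i _ hi => by simp [hi]) (by simp)] at h3
    simpa using h3
  have up : ∀ a b : Fin n, b < a → M b a = 0 := by
    intro a b hab
    have h3 := congrFun (congrFun h2 a) b
    simp only [Matrix.sum_apply, Matrix.smul_apply, e1 _ _ a b hab, ite_and, smul_ite, smul_zero,
      Matrix.zero_apply] at h3
    rw [Finset.sum_eq_single a (fun i _ hi => by simp [hi]) (by simp)] at h3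
    simpa using h3
  -- the diagonal entry at `a` of the first representation compares `M a a` with the first diagonal
  -- entry of `M`
  refine ⟨∑ i, if i.val = 0 then M i i else 0, ?_⟩
  ext a b
  rcases lt_trichotomy a b with hab | rfl | hab
  · rw [up b a hab, Matrix.diagonal_apply_ne _ hab.ne]
  · rw [Matrix.diagonal_apply_eq]
    have h3 := congrFun (congrFun h1 a) a
    simp only [Matrix.sum_apply, Matrix.smul_apply, e2, Matrix.zero_apply,
      Finset.sum_ite_eq, Finset.mem_univ, if_true, smul_eq_mul, mul_one, mul_zero,
      mul_sub, mul_ite, Finset.sum_sub_distrib, Finset.sum_ite_eq'] at h3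
    exact (sub_eq_zero.mp h3).symm
  · rw [lo a b hab, Matrix.diagonal_apply_ne _ hab.ne']

end TestRepresentation

/-! ### The Lie bialgebra dual to `sl_n` on matrix coefficients -/

section SlDualCoordinates
attribute [local instance 100] LieRing.ofAssociativeRing
variable (n : ℕ) (k : Type*) [Field k]

theorem slCoord_apply (i j : Fin n) (X : Sl n k) :
    (slBialgebra n k).toDual (slCoord n k i j) X = X.val i j := rfl

/-- The functional `X ↦ tr(M X)`, as an element of `sl_n*`. -/
noncomputable def slForm : Matrix (Fin n) (Fin n) k →ₗ[k] SlDual n k where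
  toFun M := (slBialgebra n k).toDual.symm (trForm M)
  map_add' M N := by
    rw [← map_add]
    congr 1
    ext X
    simp only [LinearMap.add_apply, trForm_apply, add_mul, Matrix.trace_add]
  map_smul' c M := by
    rw [RingHom.id_apply, ← map_smul]
    congr 1
    ext X
    simp only [LinearMap.smul_apply, trForm_apply, smul_mul_assoc, Matrix.trace_smul]

theorem slForm_apply (M : Matrix (Fin n) (Fin n) k) (X : Sl n k) :
    (slBialgebra n k).toDual (slForm n k M) X = (M * X.val).trace := rfl

theorem slForm_single (i j : Fin n) : slForm n k (Matrix.single j i 1) = slCoord n k i j := by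
  apply (slBialgebra n k).toDual.injective
  ext X
  rw [slForm_apply, slCoord_apply, Matrix.trace_mul_comm, Matrix.trace_mul_single,
    MulOpposite.op_one, one_smul]

theorem slForm_surjective : Function.Surjective (slForm n k) := by
  intro φ
  obtain ⟨M, hM⟩ := trForm_surj ((slBialgebra n k).toDual φ)
  exact ⟨M, (slBialgebra n k).toDual.injective hM.symm⟩

theorem slForm_eq_sum (M : Matrix (Fin n) (Fin n) k) :
    slForm n k M = ∑ i, ∑ j, M j i • slCoord n k i j := by
  conv_lhs => rw [Matrix.matrix_eq_sum_single M]
  rw [Finset.sum_comm, map_sum]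
  refine Finset.sum_congr rfl fun i _ => ?_
  rw [map_sum]
  refine Finset.sum_congr rfl fun j _ => ?_
  rw [← slForm_single, ← map_smul, Matrix.smul_single, smul_eq_mul, mul_one]

theorem span_slCoord :
    Submodule.span k {φ | ∃ i j, φ = slCoord n k i j} = ⊤ := by
  rw [eq_top_iff]
  rintro φ -
  obtain ⟨M, rfl⟩ := slForm_surjective n k φ
  rw [slForm_eq_sum]
  exact sum_mem fun i _ => sum_mem fun j _ =>
    Submodule.smul_mem _ _ (Submodule.subset_span ⟨i, j, rfl⟩)

theorem slForm_scalar (c : k) : slForm n k (Matrix.diagonal fun _ => c) = 0 := by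
  apply (slBialgebra n k).toDual.injective
  ext X
  have hX : X.val.trace = 0 := X.2
  rw [slForm_apply, ← Matrix.smul_one_eq_diagonal, smul_mul_assoc, one_mul, Matrix.trace_smul, hX,
    smul_zero]
  rfl

/-- A functional `X ↦ tr(M X)` vanishes on `sl_n` only if `M` is a scalar matrix. -/
theorem scalar_of_slForm_eq_zero (M : Matrix (Fin n) (Fin n) k) (h : slForm n k M = 0) :
    ∃ c : k, M = Matrix.diagonal fun _ => c := by
  have h1 : ∀ X : Sl n k, (M * X.val).trace = 0 := fun X => by
    rw [← slForm_apply, h]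
    rfl
  have hne : ∀ i j, i ≠ j → M i j = 0 := by
    intro i j hij
    have := h1 (LieAlgebra.SpecialLinear.single j i hij.symm 1)
    rwa [LieAlgebra.SpecialLinear.val_single, Matrix.trace_mul_single, MulOpposite.op_one,
      one_smul] at this
  have heq : ∀ i j, M i i = M j j := by
    intro i j
    have hm : Matrix.single i i (1 : k) - Matrix.single j j 1 ∈
        LieAlgebra.SpecialLinear.sl (Fin n) k :=
      LinearMap.mem_ker.mpr (by simp)
    have := h1 ⟨_, hm⟩
    rw [mul_sub, Matrix.trace_sub, Matrix.trace_mul_single, Matrix.trace_mul_single,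
      MulOpposite.op_one, one_smul, one_smul] at this
    exact sub_eq_zero.mp this
  by_cases hn : Nonempty (Fin n)
  · obtain ⟨a⟩ := hn
    refine ⟨M a a, ?_⟩
    ext i j
    by_cases hij : i = j
    · rw [hij, Matrix.diagonal_apply_eq, heq]
    · rw [hne i j hij, Matrix.diagonal_apply_ne _ hij]
  · exact ⟨0, by ext i; exact (hn ⟨i⟩).elim⟩

theorem triR_single (p q : Fin n) :
    triR (Matrix.single p q (1 : k)) = ordSign k p q • Matrix.single p q 1 := by
  ext a b
  by_cases h : p = a ∧ q = b
  · obtain ⟨rfl, rfl⟩ := h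
    simp [triR, ordSign, Matrix.single_apply]
  · simp [triR, Matrix.single_apply, h]

variable [CharZero k]

/-- The Lie bracket of `sl_n*` on matrix coefficients. On functionals `X ↦ tr(M X)` it is
given by `triBr`, and the elementary matrices are eigenvectors of `triR`. -/
theorem lie_slCoord (i j a b : Fin n) : ⁅slCoord n k i b, slCoord n k j a⁆ =
    (ordSign k i j - ordSign k a b) •
      ((if i = a then slCoord n k j b else 0) + if j = b then slCoord n k i a else 0) := by
  have h1 : ⁅slCoord n k i b, slCoord n k j a⁆ =
      slForm n k (triBr (Matrix.single b i 1) (Matrix.single a j 1)) := by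
    rw [← slForm_single, ← slForm_single]
    exact dualBracket_trForm _ _
  have h2 : triBr (Matrix.single b i (1 : k)) (Matrix.single a j 1) =
      (ordSign k b i + ordSign k a j) • ((if i = a then Matrix.single b j 1 else 0) -
        if j = b then Matrix.single a i 1 else 0) := by
    have hs : ∀ p q r s : Fin n, (Matrix.single p q (1 : k)) * Matrix.single r s 1 =
        if q = r then Matrix.single p s 1 else 0 := by
      intro p q r s
      split_ifs with h
      · rw [h, Matrix.single_mul_single_same, one_mul]
      · exact Matrix.single_mul_single_of_ne _ _ _ _ h _
    rw [triBr, triR_single, triR_single]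
    simp only [smul_mul_assoc, mul_smul_comm, hs, add_smul, smul_sub]
    abel
  have hf : ∀ (P : Prop) [Decidable P] (N : Matrix (Fin n) (Fin n) k),
      slForm n k (if P then N else 0) = if P then slForm n k N else 0 := by
    intro P _ N
    split_ifs <;> simp
  have hanti : ∀ p q : Fin n, ordSign k p q = -ordSign k q p := by
    intro p q
    rcases lt_trichotomy p q with h | rfl | h
    · simp [ordSign, h, h.not_gt]
    · simp [ordSign]
    · simp [ordSign, h, h.not_gt]
  rw [h1, h2, map_smul, map_sub, hf, hf, slForm_single, slForm_single, smul_sub, smul_add,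
    sub_eq_add_neg]
  congr 1
  · split_ifs with h
    · rw [h, hanti b a]
      congr 1
      ring
    · rw [smul_zero, smul_zero]
  · split_ifs with h
    · rw [h, hanti b i, ← neg_smul]
      congr 1
      ring
    · rw [smul_zero, smul_zero, neg_zero]

/-- The Lie cobracket of `sl_n*` on matrix coefficients, transposed from the commutator of matrices.
-/
theorem dual_cobracket_slCoord (i j : Fin n) : (slBialgebra n k).dual.cobracket (slCoord n k i j) =
    ∑ l, (slCoord n k i l ⊗ₜ slCoord n k l j - slCoord n k l j ⊗ₜ slCoord n k i l) := by
  apply (slBialgebra n k).pair₂_ext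
  intro X Y
  refine ((slBialgebra n k).pair₂_dualCobracket _ X Y).trans ?_
  rw [map_sum, LinearMap.sum_apply, slCoord_apply]
  simp only [map_sub, LinearMap.sub_apply, LieBialgebraStr.pair₂_tmul, slCoord_apply]
  rw [LieAlgebra.SpecialLinear.sl_bracket, Matrix.sub_apply, Matrix.mul_apply, Matrix.mul_apply,
    ← Finset.sum_sub_distrib]
  exact Finset.sum_congr rfl fun l _ => by rw [mul_comm (Y.val i l)]

end SlDualCoordinates

/-! ### The isomorphism from the enveloping algebra -/

section DualToTilde
attribute [local instance 100] LieRing.ofAssociativeRing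
variable (n : ℕ) (k : Type*) [Field k]

/-- The linear map `sl_n* → Ftilde / (q - 1)` which sends `X ↦ X_ij` to the class of `r_ij`. It is
well defined as the only relation between the matrix coefficients is `∑ X_ii = 0`. -/
theorem exists_slCoord_to_xGen : ∃ θ : SlDual n k →ₗ[k] AtOne k (Ftilde n k),
    ∀ i j, θ (slCoord n k i j) = xGen n k i j := by
  let ψ : Matrix (Fin n) (Fin n) k →ₗ[k] AtOne k (Ftilde n k) :=
    ∑ i, ∑ j, (Matrix.entryLinearMap k k j i).smulRight (xGen n k i j)
  have hψ : ∀ M, ψ M = ∑ i, ∑ j, M j i • xGen n k i j := fun M => by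
    simp [ψ, LinearMap.sum_apply]
  obtain ⟨g, hg⟩ := (slForm n k).exists_rightInverse_of_surjective
    (LinearMap.range_eq_top.mpr (slForm_surjective n k))
  refine ⟨ψ ∘ₗ g, fun i j => ?_⟩
  have h1 : slForm n k (g (slCoord n k i j) - Matrix.single j i 1) = 0 := by
    rw [map_sub, slForm_single, sub_eq_zero]
    exact LinearMap.congr_fun hg _
  obtain ⟨c, hc⟩ := scalar_of_slForm_eq_zero n k _ h1
  have h2 : ψ (Matrix.diagonal fun _ => c) = 0 := by
    rw [hψ]
    simp only [Matrix.diagonal_apply, ite_smul, zero_smul, Finset.sum_ite_eq', Finset.mem_univ,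
      if_true]
    rw [← Finset.smul_sum, sum_xGen_diag, smul_zero]
  have h3 : ψ (Matrix.single j i 1) = xGen n k i j := by
    rw [hψ]
    simp only [Matrix.single_apply, ite_and, ite_smul, one_smul, zero_smul, Finset.sum_ite_eq,
      Finset.mem_univ, if_true]
  rw [← hc, map_sub, h3] at h2
  exact sub_eq_zero.mp h2

variable [CharZero k]

/-- The homomorphism of Lie algebras `sl_n* → Ftilde / (q - 1)`. -/
noncomputable def slToOne : SlDual n k →ₗ⁅k⁆ AtOne k (Ftilde n k) where
  __ := (exists_slCoord_to_xGen n k).choose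
  map_lie' {φ ψ} := by
    obtain ⟨θ, hθ⟩ : ∃ θ, θ = (exists_slCoord_to_xGen n k).choose := ⟨_, rfl⟩
    have hx : ∀ i j, θ (slCoord n k i j) = xGen n k i j :=
      hθ ▸ (exists_slCoord_to_xGen n k).choose_spec
    change (exists_slCoord_to_xGen n k).choose ⁅φ, ψ⁆ =
      ⁅(exists_slCoord_to_xGen n k).choose φ, (exists_slCoord_to_xGen n k).choose ψ⁆
    rw [← hθ]
    have hφ : φ ∈ Submodule.span k {φ | ∃ i j, φ = slCoord n k i j} :=
      span_slCoord n k ▸ Submodule.mem_top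
    have hψ : ψ ∈ Submodule.span k {φ | ∃ i j, φ = slCoord n k i j} :=
      span_slCoord n k ▸ Submodule.mem_top
    induction hφ using Submodule.span_induction with
    | zero => simp
    | add a b _ _ ha hb => rw [add_lie, map_add, map_add, add_lie, ha, hb]
    | smul c a _ ha => rw [smul_lie, map_smul, map_smul, smul_lie, ha]
    | mem a ha =>
      obtain ⟨i, b, rfl⟩ := ha
      induction hψ using Submodule.span_induction with
      | zero => simp
      | add a b _ _ ha hb => rw [lie_add, map_add, map_add, lie_add, ha, hb]
      | smul c a _ ha =>
        rw [lie_smul, map_smul, map_smul, ha, LieRing.of_associative_ring_bracket,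
          LieRing.of_associative_ring_bracket, mul_smul_comm, smul_mul_assoc, smul_sub]
      | mem c hc =>
        obtain ⟨j, a, rfl⟩ := hc
        rw [lie_slCoord, hx, hx, LieRing.of_associative_ring_bracket, xGen_commutator, map_smul,
          map_add]
        congr 2 <;> split_ifs <;> simp [hx]

theorem slToOne_slCoord (i j : Fin n) : slToOne n k (slCoord n k i j) = xGen n k i j :=
  (exists_slCoord_to_xGen n k).choose_spec i j

/-- The homomorphism `sl_n* → Ftilde / (q - 1)` is injective, as its source and its target have the
same linear relations between matrix coefficients. -/
theorem slToOne_eq_zero {φ : SlDual n k} (h : slToOne n k φ = 0) : φ = 0 := by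
  obtain ⟨M, rfl⟩ := slForm_surjective n k φ
  rw [slForm_eq_sum] at h
  have h1 : ∑ i, ∑ j, M j i • xGen n k i j = 0 := by
    rw [← h, map_sum]
    refine Finset.sum_congr rfl fun i _ => ?_
    rw [map_sum]
    refine Finset.sum_congr rfl fun j _ => ?_
    rw [map_smul, slToOne_slCoord]
  obtain ⟨c, rfl⟩ := scalar_of_sum_xGen_eq_zero n k M h1
  exact slForm_scalar n k c

/-- The homomorphism `U(sl_n*) → Ftilde / (q - 1)`. -/
noncomputable def envToOne :
    UniversalEnvelopingAlgebra k (SlDual n k) →ₐ[k] AtOne k (Ftilde n k) :=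
  UniversalEnvelopingAlgebra.lift k (slToOne n k)

theorem envToOne_ι (φ : SlDual n k) :
    envToOne n k (UniversalEnvelopingAlgebra.ι k φ) = slToOne n k φ :=
  UniversalEnvelopingAlgebra.lift_ι_apply k _ φ

theorem envToOne_slCoord (i j : Fin n) :
    envToOne n k (UniversalEnvelopingAlgebra.ι k (slCoord n k i j)) = xGen n k i j := by
  rw [envToOne_ι, slToOne_slCoord]

theorem slToOne_primitive (φ : SlDual n k) :
    comulOne n k (slToOne n k φ) = slToOne n k φ ⊗ₜ 1 + 1 ⊗ₜ slToOne n k φ := by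
  have h : (comulOne n k).toLinearMap ∘ₗ (slToOne n k : SlDual n k →ₗ[k] AtOne k (Ftilde n k)) =
      ((TensorProduct.mk k (AtOne k (Ftilde n k)) (AtOne k (Ftilde n k))).flip 1 +
        TensorProduct.mk k (AtOne k (Ftilde n k)) (AtOne k (Ftilde n k)) 1) ∘ₗ
          (slToOne n k : SlDual n k →ₗ[k] AtOne k (Ftilde n k)) := by
    refine LinearMap.ext_on (span_slCoord n k) ?_
    rintro _ ⟨i, j, rfl⟩
    change comulOne n k (slToOne n k (slCoord n k i j)) =
      slToOne n k (slCoord n k i j) ⊗ₜ 1 + 1 ⊗ₜ slToOne n k (slCoord n k i j)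
    rw [slToOne_slCoord, comulOne_xGen]
  exact LinearMap.congr_fun h φ

theorem comulOne_envToOne (x : UniversalEnvelopingAlgebra k (SlDual n k)) :
    comulOne n k (envToOne n k x) =
      Algebra.TensorProduct.map (envToOne n k) (envToOne n k) (envComul k (SlDual n k) x) := by
  have h : (comulOne n k).comp (envToOne n k) =
      (Algebra.TensorProduct.map (envToOne n k) (envToOne n k)).comp (envComul k (SlDual n k)) := by
    refine env_algHom_ext fun φ => ?_
    rw [AlgHom.comp_apply, AlgHom.comp_apply, envToOne_ι, slToOne_primitive, envComul_ι, map_add,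
      Algebra.TensorProduct.map_tmul, Algebra.TensorProduct.map_tmul, envToOne_ι, map_one]
  exact congrArg (fun f => f x) h

theorem counitOne_envToOne (x : UniversalEnvelopingAlgebra k (SlDual n k)) :
    counitOne n k (envToOne n k x) = envCounit k (SlDual n k) x := by
  have h : (counitOne n k).comp (envToOne n k) = envCounit k (SlDual n k) := by
    refine env_algHom_ext fun φ => ?_
    have h : (counitOne n k).toLinearMap ∘ₗ
        (slToOne n k : SlDual n k →ₗ[k] AtOne k (Ftilde n k)) = 0 := by
      refine LinearMap.ext_on (span_slCoord n k) ?_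
      rintro _ ⟨i, j, rfl⟩
      change counitOne n k (slToOne n k (slCoord n k i j)) = 0
      rw [slToOne_slCoord, counitOne_xGen]
    rw [AlgHom.comp_apply, envToOne_ι, envCounit_ι]
    exact LinearMap.congr_fun h φ
  exact congrArg (fun f => f x) h

theorem envToOne_bijective : Function.Bijective (envToOne n k) := by
  constructor
  · exact env_injective (envToOne n k) (comulOne n k).toLinearMap (counitOne n k).toLinearMap
      (comulOne_envToOne n k) (counitOne_envToOne n k)
      fun φ h => slToOne_eq_zero n k ((envToOne_ι n k φ).symm.trans h)
  · rw [← AlgHom.range_eq_top, eq_top_iff, ← adjoin_xGen, Algebra.adjoin_le_iff]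
    rintro _ ⟨i, j, rfl⟩
    exact ⟨_, envToOne_slCoord n k i j⟩

end DualToTilde

/-! ### The matrix cobracket -/

section MatrixCobracket
variable {R A : Type*} [CommRing R] [Ring A] [Algebra R A]

/-- The co-Jacobi identity for the cobracket `δ(x_ij) = ∑ (x_il ⊗ x_lj - x_lj ⊗ x_il)`. -/
theorem coJacobi_of_matrix {n : ℕ} (δ : A →ₗ[R] A ⊗[R] A) (x : Fin n → Fin n → A)
    (hδ : ∀ i j, δ (x i j) = ∑ l, (x i l ⊗ₜ x l j - x l j ⊗ₜ x i l)) (i j : Fin n) :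
    TensorProduct.assoc R A A A (δ.rTensor A (δ (x i j))) +
      cyc₃ R A (TensorProduct.assoc R A A A (δ.rTensor A (δ (x i j)))) +
      cyc₃ R A (cyc₃ R A (TensorProduct.assoc R A A A (δ.rTensor A (δ (x i j))))) = 0 := by
  have h : TensorProduct.assoc R A A A (δ.rTensor A (δ (x i j))) =
      ∑ l, ∑ m, (x i l ⊗ₜ[R] (x l m ⊗ₜ[R] x m j) - x l m ⊗ₜ[R] (x i l ⊗ₜ[R] x m j) -
        x l m ⊗ₜ[R] (x m j ⊗ₜ[R] x i l) + x m j ⊗ₜ[R] (x l m ⊗ₜ[R] x i l)) := by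
    have h1 : ∀ l, TensorProduct.assoc R A A A (δ.rTensor A
        (x i l ⊗ₜ[R] x l j - x l j ⊗ₜ[R] x i l)) =
        (∑ m, (x i m ⊗ₜ[R] (x m l ⊗ₜ[R] x l j) - x m l ⊗ₜ[R] (x i m ⊗ₜ[R] x l j))) -
        ∑ m, (x l m ⊗ₜ[R] (x m j ⊗ₜ[R] x i l) - x m j ⊗ₜ[R] (x l m ⊗ₜ[R] x i l)) := by
      intro l
      rw [map_sub, map_sub, LinearMap.rTensor_tmul, LinearMap.rTensor_tmul, hδ, hδ,
        TensorProduct.sum_tmul, TensorProduct.sum_tmul, map_sum, map_sum]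
      simp only [TensorProduct.sub_tmul, map_sub, TensorProduct.assoc_tmul]
    rw [hδ, map_sum, map_sum, Finset.sum_congr rfl fun l _ => h1 l, Finset.sum_sub_distrib,
      Finset.sum_comm, ← Finset.sum_sub_distrib]
    refine Finset.sum_congr rfl fun l _ => ?_
    rw [← Finset.sum_sub_distrib]
    refine Finset.sum_congr rfl fun m _ => ?_
    abel
  rw [h]
  simp only [map_sum, ← Finset.sum_add_distrib]
  refine Finset.sum_eq_zero fun l _ => Finset.sum_eq_zero fun m _ => ?_
  simp only [map_sub, map_add, cyc₃_tmul]
  abel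

/-- The co-Leibniz identity for the cobracket `δ(x_ij) = ∑ (x_il ⊗ x_lj - x_lj ⊗ x_il)`, when the
`x_ij` are primitive. -/
theorem coLeibniz_of_matrix {n : ℕ} (Δ : A →ₐ[R] A ⊗[R] A) (δ : A →ₗ[R] A ⊗[R] A)
    (x : Fin n → Fin n → A) (h0 : δ 1 = 0)
    (hΔ : ∀ i j, Δ (x i j) = x i j ⊗ₜ 1 + 1 ⊗ₜ x i j)
    (hδ : ∀ i j, δ (x i j) = ∑ l, (x i l ⊗ₜ x l j - x l j ⊗ₜ x i l)) (i j : Fin n) :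
    TensorProduct.assoc R A A A (Δ.toLinearMap.rTensor A (δ (x i j))) =
      δ.lTensor A (Δ (x i j)) + (TensorProduct.comm R A A).toLinearMap.lTensor A
        (TensorProduct.assoc R A A A (δ.rTensor A (Δ (x i j)))) := by
  rw [hΔ]
  simp only [map_add, LinearMap.lTensor_tmul, LinearMap.rTensor_tmul, h0, TensorProduct.tmul_zero,
    TensorProduct.zero_tmul, add_zero, zero_add, hδ, map_sum, TensorProduct.tmul_sum,
    TensorProduct.sum_tmul]
  rw [← Finset.sum_add_distrib]
  refine Finset.sum_congr rfl fun l _ => ?_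
  simp only [map_sub, LinearMap.rTensor_tmul, AlgHom.toLinearMap_apply, hΔ,
    TensorProduct.add_tmul, TensorProduct.sub_tmul, TensorProduct.tmul_sub, map_add,
    TensorProduct.assoc_tmul, LinearMap.lTensor_tmul, LinearEquiv.coe_coe,
    TensorProduct.comm_tmul]
  abel

theorem mul_sub_mul_eq_smul {r : R} {s s' t t' y z : A} (hs : s - s' = r • y)
    (ht : t - t' = r • z) : s * t - s' * t' = r • (y * t + s' * z) := by
  rw [smul_add, ← smul_mul_assoc, ← mul_smul_comm, ← hs, ← ht, sub_mul, mul_sub]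
  abel

theorem add_smul_sum_sub {M ι : Type*} [AddCommGroup M] [Module R M] (s : Finset ι) (r : R)
    (u v : M) (f g : ι → M) : u + v + r • ∑ l ∈ s, f l - (v + u + r • ∑ l ∈ s, g l) =
      r • ∑ l ∈ s, (f l - g l) := by
  rw [Finset.sum_sub_distrib, smul_sub]
  abel

end MatrixCobracket

/-! ### The co-Poisson structure at `q = 1` -/

section Semiclassical
attribute [local instance 100] LieRing.ofAssociativeRing
open LaurentPolynomial
variable (n : ℕ) (k : Type*) [Field k] [CharZero k]

/-- The isomorphism `U(sl_n*) ≃ Ftilde / (q - 1)`. -/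
noncomputable def envEquivOne :
    UniversalEnvelopingAlgebra k (SlDual n k) ≃ₐ[k] AtOne k (Ftilde n k) :=
  AlgEquiv.ofBijective (envToOne n k) (envToOne_bijective n k)

theorem envEquivOne_symm_envToOne (u : UniversalEnvelopingAlgebra k (SlDual n k)) :
    (envEquivOne n k).symm (envToOne n k u) = u :=
  (envEquivOne n k).symm_apply_apply u

theorem map_symm_map_envToOne (t : UniversalEnvelopingAlgebra k (SlDual n k) ⊗[k]
      UniversalEnvelopingAlgebra k (SlDual n k)) :
    Algebra.TensorProduct.map ((envEquivOne n k).symm : _ →ₐ[k] _)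
      ((envEquivOne n k).symm : _ →ₐ[k] _)
      (Algebra.TensorProduct.map (envToOne n k) (envToOne n k) t) = t := by
  induction t with
  | zero => rw [map_zero, map_zero]
  | add s t hs ht => rw [map_add, map_add, hs, ht]
  | tmul a b =>
    rw [Algebra.TensorProduct.map_tmul, Algebra.TensorProduct.map_tmul]
    exact congrArg₂ _ (envEquivOne_symm_envToOne n k a) (envEquivOne_symm_envToOne n k b)

theorem antipodeOne_envToOne (u : UniversalEnvelopingAlgebra k (SlDual n k)) :
    unopLinear (antipodeOne n k) (envToOne n k u) =
      envToOne n k (envAntipode k (SlDual n k) u) := by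
  have h1 : unopLinear (antipodeOne n k) ∘ₗ
      (slToOne n k : SlDual n k →ₗ[k] AtOne k (Ftilde n k)) =
      -(slToOne n k : SlDual n k →ₗ[k] AtOne k (Ftilde n k)) := by
    refine LinearMap.ext_on (span_slCoord n k) ?_
    rintro _ ⟨i, j, rfl⟩
    change unopLinear (antipodeOne n k) (slToOne n k (slCoord n k i j)) =
      -slToOne n k (slCoord n k i j)
    rw [slToOne_slCoord, antipodeOne_xGen]
  have h : (antipodeOne n k).comp (envToOne n k) = (AlgHom.op (envToOne n k)).comp
      (UniversalEnvelopingAlgebra.lift k (envAntipodeLie k (SlDual n k))) := by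
    refine env_algHom_ext fun φ => MulOpposite.unop_injective ?_
    have h2 : (UniversalEnvelopingAlgebra.lift k (envAntipodeLie k (SlDual n k)))
        (UniversalEnvelopingAlgebra.ι k φ) = envAntipodeLie k (SlDual n k) φ :=
      UniversalEnvelopingAlgebra.lift_ι_apply k _ φ
    rw [AlgHom.comp_apply, AlgHom.comp_apply, h2, envToOne_ι]
    refine (LinearMap.congr_fun h1 φ).trans ?_
    change -slToOne n k φ = envToOne n k (-UniversalEnvelopingAlgebra.ι k φ)
    rw [map_neg, envToOne_ι]
  exact congrArg (fun f => (f u).unop) h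

theorem hopfOne_isHom : (hopfOne n k).IsHom (envHopf k (SlDual n k)) (envEquivOne n k).symm := by
  have hs : ∀ a, ∃ u, a = envToOne n k u := fun a =>
    ((envToOne_bijective n k).surjective a).imp fun _ h => h.symm
  refine ⟨fun a => ?_, fun a => ?_, fun a => ?_⟩ <;> obtain ⟨u, rfl⟩ := hs a
  · change envComul k (SlDual n k) ((envEquivOne n k).symm (envToOne n k u)) =
      Algebra.TensorProduct.map _ _ (comulOne n k (envToOne n k u))
    rw [comulOne_envToOne, map_symm_map_envToOne, envEquivOne_symm_envToOne]
  · change envCounit k (SlDual n k) ((envEquivOne n k).symm (envToOne n k u)) =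
      counitOne n k (envToOne n k u)
    rw [counitOne_envToOne, envEquivOne_symm_envToOne]
  · change envAntipode k (SlDual n k) ((envEquivOne n k).symm (envToOne n k u)) =
      (envEquivOne n k).symm (unopLinear (antipodeOne n k) (envToOne n k u))
    rw [antipodeOne_envToOne, envEquivOne_symm_envToOne, envEquivOne_symm_envToOne]

/-- The Poisson cobracket of `Ftilde` at `q = 1`, transported from `U(sl_n*)`. -/
noncomputable def cobracketOne :
    AtOne k (Ftilde n k) →ₗ[k] AtOne k (Ftilde n k) ⊗[k] AtOne k (Ftilde n k) :=
  (Algebra.TensorProduct.map (envToOne n k) (envToOne n k)).toLinearMap ∘ₗ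
    (slBialgebra n k).dual.envCobracket ∘ₗ (envEquivOne n k).symm.toLinearMap

theorem cobracketOne_envToOne (u : UniversalEnvelopingAlgebra k (SlDual n k)) :
    cobracketOne n k (envToOne n k u) = Algebra.TensorProduct.map (envToOne n k) (envToOne n k)
      ((slBialgebra n k).dual.envCobracket u) := by
  change Algebra.TensorProduct.map (envToOne n k) (envToOne n k)
    ((slBialgebra n k).dual.envCobracket ((envEquivOne n k).symm (envToOne n k u))) = _
  rw [envEquivOne_symm_envToOne]

theorem cobracketOne_mul (a b : AtOne k (Ftilde n k)) : cobracketOne n k (a * b) =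
    cobracketOne n k a * comulOne n k b + comulOne n k a * cobracketOne n k b := by
  obtain ⟨u, rfl⟩ := (envToOne_bijective n k).surjective a
  obtain ⟨v, rfl⟩ := (envToOne_bijective n k).surjective b
  rw [← map_mul, cobracketOne_envToOne, cobracketOne_envToOne, cobracketOne_envToOne,
    LieBialgebraStr.envCobracket_mul, map_add, map_mul, map_mul, comulOne_envToOne,
    comulOne_envToOne]

theorem cobracketOne_xGen (i j : Fin n) : cobracketOne n k (xGen n k i j) =
    ∑ l, (xGen n k i l ⊗ₜ xGen n k l j - xGen n k l j ⊗ₜ xGen n k i l) := by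
  rw [← envToOne_slCoord, cobracketOne_envToOne, LieBialgebraStr.envCobracket_ι,
    dual_cobracket_slCoord]
  rw [map_sum, map_sum]
  refine Finset.sum_congr rfl fun l _ => ?_
  have h : ∀ φ ψ : SlDual n k, Algebra.TensorProduct.map (envToOne n k) (envToOne n k)
      (envTensor (φ ⊗ₜ[k] ψ)) = envToOne n k (UniversalEnvelopingAlgebra.ι k φ) ⊗ₜ
        envToOne n k (UniversalEnvelopingAlgebra.ι k ψ) := fun φ ψ => rfl
  rw [map_sub, map_sub, h, h, envToOne_slCoord, envToOne_slCoord]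

theorem cobracketOne_skew_xGen (i j : Fin n) :
    TensorProduct.comm k _ _ (cobracketOne n k (xGen n k i j)) =
      -cobracketOne n k (xGen n k i j) := by
  rw [cobracketOne_xGen, map_sum, ← Finset.sum_neg_distrib]
  refine Finset.sum_congr rfl fun l _ => ?_
  rw [map_sub, TensorProduct.comm_tmul, TensorProduct.comm_tmul, neg_sub]

theorem cobracketOne_isCoPoisson : (hopfOne n k).IsCoPoisson (cobracketOne n k) := by
  have h0 : cobracketOne n k 1 = 0 := by
    have := coderivation_algebraMap (comulOne n k) (cobracketOne n k) (cobracketOne_mul n k) 1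
    rwa [map_one] at this
  refine HopfStr.isCoPoisson_of_generators (hopfOne n k) (cobracketOne n k) (adjoin_xGen n k)
    ?_ (cobracketOne_mul n k) ?_ ?_ ?_
  · rintro _ ⟨i, j, rfl⟩
    change TensorProduct.comm k _ _ (comulOne n k (xGen n k i j)) = comulOne n k (xGen n k i j)
    rw [comulOne_xGen, map_add, TensorProduct.comm_tmul, TensorProduct.comm_tmul, add_comm]
  · rintro _ ⟨i, j, rfl⟩
    exact cobracketOne_skew_xGen n k i j
  · rintro _ ⟨i, j, rfl⟩
    exact coJacobi_of_matrix (cobracketOne n k) (xGen n k) (cobracketOne_xGen n k) i j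
  · rintro _ ⟨i, j, rfl⟩
    exact coLeibniz_of_matrix (comulOne n k) (cobracketOne n k) (xGen n k) h0 (comulOne_xGen n k)
      (cobracketOne_xGen n k) i j

/-- `Δ(a) - Δᵒᵖ(a)` is divisible by `q - 1`, with a quotient reducing to the cobracket. -/
theorem exists_comulTilde_sub_comm (a : Ftilde n k) : ∃ y : Ftilde n k ⊗[k[T;T⁻¹]] Ftilde n k,
    comulTilde n k a - TensorProduct.comm k[T;T⁻¹] _ _ (comulTilde n k a) = qSub k • y ∧
      cobracketOne n k (atOne k a) = atOneTensor k y := by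
  refine forall_of_adjoin (P := fun a => ∃ y : Ftilde n k ⊗[k[T;T⁻¹]] Ftilde n k,
    comulTilde n k a - TensorProduct.comm k[T;T⁻¹] _ _ (comulTilde n k a) = qSub k • y ∧
      cobracketOne n k (atOne k a) = atOneTensor k y) (adjoin_rGen_eq_top k n) ?_ ?_ ?_ ?_ a
  · rintro _ ⟨i, j, rfl⟩
    refine ⟨∑ l, (rGen k i l ⊗ₜ rGen k l j - rGen k l j ⊗ₜ rGen k i l), ?_, ?_⟩
    · have h : TensorProduct.comm k[T;T⁻¹] _ _ (comulTilde n k (rGen k i j)) =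
          1 ⊗ₜ rGen k i j + rGen k i j ⊗ₜ 1 + qSub k • ∑ l, rGen k l j ⊗ₜ rGen k i l := by
        rw [comulTilde_rGen]
        simp only [map_add, map_smul, map_sum, TensorProduct.comm_tmul]
      rw [h, comulTilde_rGen]
      exact add_smul_sum_sub (R := k[T;T⁻¹]) (M := Ftilde n k ⊗[k[T;T⁻¹]] Ftilde n k) _ _ _ _ _ _
    · refine (cobracketOne_xGen n k i j).trans ?_
      simp only [map_sum, map_sub, atOneTensor_tmul, xGen]
  · intro r
    refine ⟨0, ?_, ?_⟩
    · rw [AlgHom.commutes, smul_zero, sub_eq_zero]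
      exact (AlgEquiv.commutes (Algebra.TensorProduct.comm k[T;T⁻¹] _ _) r).symm
    · rw [Algebra.algebraMap_eq_smul_one, atOne_smul, map_one, map_zero,
        ← Algebra.algebraMap_eq_smul_one]
      exact coderivation_algebraMap (comulOne n k) (cobracketOne n k) (cobracketOne_mul n k) _
  · rintro a b ⟨y, hy, hy1⟩ ⟨z, hz, hz1⟩
    refine ⟨y + z, ?_, ?_⟩
    · rw [map_add, map_add, smul_add, ← hy, ← hz]
      abel
    · rw [map_add, map_add, map_add, hy1, hz1]
  · rintro a b ⟨y, hy, hy1⟩ ⟨z, hz, hz1⟩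
    refine ⟨y * comulTilde n k b + TensorProduct.comm k[T;T⁻¹] _ _ (comulTilde n k a) * z,
      ?_, ?_⟩
    · rw [map_mul, comm_mul]
      exact mul_sub_mul_eq_smul (A := Ftilde n k ⊗[k[T;T⁻¹]] Ftilde n k) hy hz
    · have h : atOneTensor k (TensorProduct.comm k[T;T⁻¹] _ _ (comulTilde n k a)) =
          comulOne n k (atOne k a) := by
        have := congrArg (atOneTensor k) hy
        rw [map_sub, atOneTensor_smul, evOne_qSub, zero_smul, sub_eq_zero] at this
        rw [← this, comulOne_atOne]
      refine (congrArg (cobracketOne n k) (map_mul (atOne k) a b)).trans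
        ((cobracketOne_mul n k _ _).trans ?_)
      rw [hy1, hz1, ← h, comulOne_atOne n k b, ← atOneTensor_mul, ← atOneTensor_mul]
      exact ((atOneTensor k).map_add _ _).symm

theorem hopfTilde_isSemiclassicalLimit :
    (hopfTilde n k).IsSemiclassicalLimit (cobracketOne n k) := by
  intro a
  obtain ⟨y, hy, hy1⟩ := exists_comulTilde_sub_comm n k a
  refine ⟨⟨y, hy⟩, fun z hz => ?_⟩
  have h : y = z := qSub_smul_injective (k := k) (hy.symm.trans hz)
  rw [← h, hy1]

theorem specializesToDual : SpecializesToDual n (hopfHat n k) (hopfTilde n k) (hopfOne n k)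
    (cobracketOne n k) (envEquivOne n k).symm where
  standard := isStandardHopf_hopfHat n k
  subalgebra := hopfHat_isHom n k
  specialization := hopfTilde_isSpecialization n k
  semiclassical := hopfTilde_isSemiclassicalLimit n k
  coPoisson := cobracketOne_isCoPoisson n k
  isHom := hopfOne_isHom n k
  map_cobracket a := by
    obtain ⟨u, rfl⟩ := (envToOne_bijective n k).surjective a
    rw [cobracketOne_envToOne, map_symm_map_envToOne, envEquivOne_symm_envToOne]
  map_rGen i j := by
    refine (congrArg _ (envToOne_slCoord n k i j).symm).trans ?_
    exact envEquivOne_symm_envToOne n k _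

end Semiclassical

/-! ### The quantum relations for `n = 2` -/

section RankOneQuantum
open LaurentPolynomial
variable (k : Type*) [Field k]

theorem qWeight_eq_qSub_mul {n : ℕ} (i j : Fin n) : qWeight k i j =
    qSub k * if i = j then 1 else if i < j then 1 + T (-1) else 0 := by
  rw [qWeight]
  split_ifs
  · rw [mul_one, qSub]
  · rw [qSub, sub_mul, mul_add, T_one_mul_T_neg_one]
    ring
  · rw [mul_zero]

theorem hPlus_mul_eGen : hPlus k * eGen k = (T 1 : k[T;T⁻¹]) • (eGen k * hPlus k) + eGen k := by
  have h := rGen_commutator 2 k 0 0 1 0 _ _ (qWeight_eq_qSub_mul k 0 0) (qWeight_eq_qSub_mul k 1 0)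
  simp only [Fin.reduceEq, Fin.reduceLT, if_true, if_false, sub_zero, one_smul, zero_add, qSub,
    sub_smul, zero_ne_one] at h
  linear_combination (norm := module) h

theorem hPlus_mul_fGen : hPlus k * fGen k = (T 1 : k[T;T⁻¹]) • (fGen k * hPlus k) + fGen k := by
  have h := rGen_commutator 2 k 1 0 0 0 _ _ (qWeight_eq_qSub_mul k 1 0) (qWeight_eq_qSub_mul k 0 0)
  simp only [Fin.reduceEq, Fin.reduceLT, if_true, if_false, zero_sub, neg_smul, one_smul, zero_add,
    qSub, sub_smul] at h
  linear_combination (norm := module) -h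

theorem eGen_mul_hMinus :
    eGen k * hMinus k = (T 1 : k[T;T⁻¹]) • (hMinus k * eGen k) + eGen k := by
  have h := rGen_commutator 2 k 1 0 1 1 _ _ (qWeight_eq_qSub_mul k 1 0) (qWeight_eq_qSub_mul k 1 1)
  simp only [Fin.reduceEq, Fin.reduceLT, if_true, if_false, zero_sub, neg_smul, one_smul, add_zero,
    qSub, sub_smul, zero_ne_one] at h
  linear_combination (norm := module) -h

theorem fGen_mul_hMinus :
    fGen k * hMinus k = (T 1 : k[T;T⁻¹]) • (hMinus k * fGen k) + fGen k := by
  have h := rGen_commutator 2 k 1 1 1 0 _ _ (qWeight_eq_qSub_mul k 1 1) (qWeight_eq_qSub_mul k 1 0)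
  simp only [Fin.reduceEq, Fin.reduceLT, if_true, if_false, sub_zero, one_smul, add_zero,
    qSub, sub_smul] at h
  linear_combination (norm := module) h

theorem eGen_mul_fGen : eGen k * fGen k = fGen k * eGen k := by
  have h := rGen_commutator 2 k 0 1 0 1 _ _ (qWeight_eq_qSub_mul k 0 1) (qWeight_eq_qSub_mul k 0 1)
  rwa [sub_self, zero_smul, sub_eq_zero] at h

theorem hPlus_commutator_hMinus : hPlus k * hMinus k - hMinus k * hPlus k =
    (T 1 - T (-1) : k[T;T⁻¹]) • (eGen k * fGen k) := by
  have h := rGen_commutator 2 k 0 1 1 0 _ _ (qWeight_eq_qSub_mul k 0 1) (qWeight_eq_qSub_mul k 1 0)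
  simp only [Fin.reduceLT, if_true, if_false, sub_zero, add_zero, zero_add,
    smul_smul, zero_ne_one, one_ne_zero, zero_lt_one] at h
  rw [h]
  congr 1
  rw [qSub, mul_sub, add_mul, mul_comm (T (-1)), T_one_mul_T_neg_one]
  ring

theorem qDet_two {A : Type*} [Ring A] [Algebra k[T;T⁻¹] A] (t : Fin 2 → Fin 2 → A) :
    qDet (k := k) t = t 0 0 * t 1 1 - (T 1 : k[T;T⁻¹]) • (t 0 1 * t 1 0) := by
  have h : (Finset.univ : Finset (Equiv.Perm (Fin 2))) = {1, Equiv.swap 0 1} := by decide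
  have h1 : invNum (Equiv.swap (0 : Fin 2) 1) = 1 := by decide
  rw [qDet, h, Finset.sum_pair (by decide), invNum_one, h1]
  simp [sub_eq_add_neg]

theorem hMinus_add_hPlus : hMinus k + hPlus k = (T 1 - 1 : k[T;T⁻¹]) •
    ((T 1 : k[T;T⁻¹]) • (eGen k * fGen k) - hPlus k * hMinus k) := by
  have h : qDet (k := k) (fun i j : Fin 2 => hatToTilde 2 k (rho k i j)) = 1 := by
    rw [← map_qDet, qDet_rho, map_one]
  rw [qDet_two] at h
  simp only [hatToTilde_rho, if_true, if_false, zero_add, smul_mul_assoc,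
    mul_smul_comm, add_mul, mul_add, one_mul, mul_one, zero_ne_one, one_ne_zero] at h
  refine qSub_smul_injective (k := k) ?_
  rw [← qSub]
  linear_combination (norm := module) h

theorem skip_two_zero : skip 2 0 0 = 1 := by
  rw [skip_eq_succAbove]; rfl

theorem skip_two_one : skip 2 1 0 = 0 := by
  rw [skip_eq_succAbove]; rfl

/-- The antipode on `r_ij` is obtained from a first order expansion of the cofactor. -/
theorem antipodeTilde_rGen_of_cofactor {n : ℕ} {i j : Fin n} {y : Ftilde n k}
    (h : hatToTilde n k (qCofactor k (rho k) i j) = (if i = j then 1 else 0) + qSub k • y) :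
    unopLinear (antipodeTilde n k) (rGen k i j) = y := by
  rw [← antipodeHat_rho, ← antipodeTilde_hat, hatToTilde_rho, map_add, map_smul] at h
  refine qSub_smul_injective (k := k) (add_left_cancel (Eq.trans ?_ h))
  congr 1
  split_ifs
  · simp [unopLinear_apply]
  · simp

theorem hat_cofactor_two (i j : Fin 2) : hatToTilde 2 k (qCofactor k (rho k) i j) =
    ((-1) ^ ((i : ℕ) + (j : ℕ)) * T ((i : ℤ) - (j : ℤ)) : k[T;T⁻¹]) •
      hatToTilde 2 k (rho k (skip 2 j 0) (skip 2 i 0)) := by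
  rw [← map_smul]
  refine congrArg _ ?_
  change _ • qDet (k := k) (n := 1) _ = _
  rw [qDet, Fintype.sum_unique]
  simp [invNum_one, cofactor_sign]

theorem antipode_hPlus : unopLinear (antipodeTilde 2 k) (hPlus k) = hMinus k :=
  antipodeTilde_rGen_of_cofactor k (by
    rw [hat_cofactor_two, skip_two_zero, hatToTilde_rho]; simp)

theorem antipode_hMinus : unopLinear (antipodeTilde 2 k) (hMinus k) = hPlus k :=
  antipodeTilde_rGen_of_cofactor k (by
    rw [hat_cofactor_two, skip_two_one, hatToTilde_rho]; simp)

theorem antipode_eGen :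
    unopLinear (antipodeTilde 2 k) (eGen k) = (-T (-1) : k[T;T⁻¹]) • eGen k :=
  antipodeTilde_rGen_of_cofactor k (by
    rw [hat_cofactor_two, skip_two_one, skip_two_zero, hatToTilde_rho, smul_comm (qSub k)]; simp)

theorem antipode_fGen :
    unopLinear (antipodeTilde 2 k) (fGen k) = (-T 1 : k[T;T⁻¹]) • fGen k :=
  antipodeTilde_rGen_of_cofactor k (by
    rw [hat_cofactor_two, skip_two_one, skip_two_zero, hatToTilde_rho, smul_comm (qSub k)]; simp)

theorem adjoin_rank_one :
    Algebra.adjoin k[T;T⁻¹] {hPlus k, eGen k, fGen k, hMinus k} = ⊤ := by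
  rw [← adjoin_rGen_eq_top k 2]
  congr 1
  ext x
  constructor
  · rintro (rfl | rfl | rfl | rfl)
    exacts [⟨0, 0, rfl⟩, ⟨0, 1, rfl⟩, ⟨1, 0, rfl⟩, ⟨1, 1, rfl⟩]
  · rintro ⟨i, j, rfl⟩
    fin_cases i <;> fin_cases j
    exacts [Or.inl rfl, Or.inr (Or.inl rfl), Or.inr (Or.inr (Or.inl rfl)),
      Or.inr (Or.inr (Or.inr rfl))]

end RankOneQuantum

/-! ### The dual Lie bialgebra for `n = 2` -/

section RankOneDual
attribute [local instance 100] LieRing.ofAssociativeRing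
variable (k : Type*) [Field k]

theorem slCoord_one_one : slCoord 2 k 1 1 = -hDual k := by
  have h := slForm_scalar 2 k 1
  rw [slForm_eq_sum, Fin.sum_univ_two, Fin.sum_univ_two, Fin.sum_univ_two] at h
  simp only [Matrix.diagonal_apply_eq, Matrix.diagonal_apply, if_false, zero_smul,
    one_smul, add_zero, zero_add, zero_ne_one, one_ne_zero] at h
  exact eq_neg_of_add_eq_zero_right h

theorem exists_basis_slDual_two :
    ∃ b : Module.Basis (Fin 3) k (SlDual 2 k), ⇑b = ![fDual k, hDual k, eDual k] := by
  have hli : LinearIndependent k ![fDual k, hDual k, eDual k] := by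
    rw [Fintype.linearIndependent_iff]
    intro c hc
    have h1 : slForm 2 k !![c 1, c 0; c 2, 0] = 0 := by
      rw [← hc, slForm_eq_sum, Fin.sum_univ_two, Fin.sum_univ_two, Fin.sum_univ_two,
        Fin.sum_univ_three]
      simp
      abel
    obtain ⟨d, hd⟩ := scalar_of_slForm_eq_zero 2 k _ h1
    have h00 := congrFun (congrFun hd 0) 0
    have h01 := congrFun (congrFun hd 0) 1
    have h10 := congrFun (congrFun hd 1) 0
    have h11 := congrFun (congrFun hd 1) 1
    simp at h00 h01 h10 h11
    intro i
    fin_cases i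
    exacts [h01, h00.trans h11.symm, h10]
  have hsp : ⊤ ≤ Submodule.span k (Set.range ![fDual k, hDual k, eDual k]) := by
    rw [← span_slCoord, Submodule.span_le]
    have hm : ∀ i, ![fDual k, hDual k, eDual k] i ∈
        Submodule.span k (Set.range ![fDual k, hDual k, eDual k]) :=
      fun i => Submodule.subset_span ⟨i, rfl⟩
    rintro _ ⟨i, j, rfl⟩
    fin_cases i <;> fin_cases j
    · exact hm 1
    · exact hm 2
    · exact hm 0
    · refine (congrArg (· ∈ Submodule.span k (Set.range ![fDual k, hDual k, eDual k]))
        (slCoord_one_one k)).mpr ?_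
      exact neg_mem (hm 1)
  exact ⟨Module.Basis.mk hli hsp, Module.Basis.coe_mk hli hsp⟩

variable [CharZero k]

theorem lie_hDual_eDual : ⁅hDual k, eDual k⁆ = eDual k := by
  have h := lie_slCoord 2 k 0 0 1 0
  simpa [ordSign] using h

theorem lie_hDual_fDual : ⁅hDual k, fDual k⁆ = fDual k := by
  have h := lie_slCoord 2 k 0 1 0 0
  simpa [ordSign] using h

theorem lie_eDual_fDual : ⁅eDual k, fDual k⁆ = 0 := by
  have h := lie_slCoord 2 k 0 1 0 1
  simpa [ordSign] using h

theorem cobracket_fDual : (slBialgebra 2 k).dual.cobracket (fDual k) =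
    (2 : k) • (fDual k ⊗ₜ[k] hDual k - hDual k ⊗ₜ[k] fDual k) := by
  rw [dual_cobracket_slCoord, Fin.sum_univ_two, slCoord_one_one, TensorProduct.neg_tmul,
    TensorProduct.tmul_neg, two_smul]
  abel

theorem cobracket_hDual : (slBialgebra 2 k).dual.cobracket (hDual k) =
    eDual k ⊗ₜ[k] fDual k - fDual k ⊗ₜ[k] eDual k := by
  rw [dual_cobracket_slCoord, Fin.sum_univ_two, sub_self, zero_add]

theorem cobracket_eDual : (slBialgebra 2 k).dual.cobracket (eDual k) =
    (2 : k) • (hDual k ⊗ₜ[k] eDual k - eDual k ⊗ₜ[k] hDual k) := by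
  rw [dual_cobracket_slCoord, Fin.sum_univ_two, slCoord_one_one, TensorProduct.neg_tmul,
    TensorProduct.tmul_neg, two_smul]
  abel

end RankOneDual

end GQDP

open GQDP LaurentPolynomial in
theorem mainTheorem9 (k : Type*) [Field k] [CharZero k] :
    (∀ n : ℕ,
      Algebra.adjoin k[T;T⁻¹] {x : Fq n k | ∃ i j : Fin n, x = (rGen k i j : Ftilde n k)} = Ftilde n k ∧
      Submodule.span (RatQ k) (Ftilde n k : Set (Fq n k)) = ⊤ ∧
      ∃ (Hhat : HopfStr k[T;T⁻¹] (FHat n k)) (H : HopfStr k[T;T⁻¹] (Ftilde n k))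
        (H₁ : HopfStr k (AtOne k (Ftilde n k)))
        (δ₁ : AtOne k (Ftilde n k) →ₗ[k] AtOne k (Ftilde n k) ⊗[k] AtOne k (Ftilde n k))
        (Φ : AtOne k (Ftilde n k) ≃ₐ[k] UniversalEnvelopingAlgebra k (SlDual n k)),
        SpecializesToDual n Hhat H H₁ δ₁ Φ) ∧
    (∃ (Hhat : HopfStr k[T;T⁻¹] (FHat 2 k)) (H : HopfStr k[T;T⁻¹] (Ftilde 2 k))
        (H₁ : HopfStr k (AtOne k (Ftilde 2 k)))
        (δ₁ : AtOne k (Ftilde 2 k) →ₗ[k] AtOne k (Ftilde 2 k) ⊗[k] AtOne k (Ftilde 2 k))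
        (Φ : AtOne k (Ftilde 2 k) ≃ₐ[k] UniversalEnvelopingAlgebra k (SlDual 2 k)),
      SpecializesToDual 2 Hhat H H₁ δ₁ Φ ∧
      -- generators and relations
      Algebra.adjoin k[T;T⁻¹] {hPlus k, eGen k, fGen k, hMinus k} = ⊤ ∧
      hPlus k * eGen k = (T 1 : k[T;T⁻¹]) • (eGen k * hPlus k) + eGen k ∧
      hPlus k * fGen k = (T 1 : k[T;T⁻¹]) • (fGen k * hPlus k) + fGen k ∧
      eGen k * hMinus k = (T 1 : k[T;T⁻¹]) • (hMinus k * eGen k) + eGen k ∧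
      fGen k * hMinus k = (T 1 : k[T;T⁻¹]) • (hMinus k * fGen k) + fGen k ∧
      eGen k * fGen k = fGen k * eGen k ∧
      hPlus k * hMinus k - hMinus k * hPlus k =
        (T 1 - T (-1) : k[T;T⁻¹]) • (eGen k * fGen k) ∧
      hMinus k + hPlus k =
        (T 1 - 1 : k[T;T⁻¹]) •
          ((T 1 : k[T;T⁻¹]) • (eGen k * fGen k) - hPlus k * hMinus k) ∧
      -- coproduct
      H.comul (hPlus k) = hPlus k ⊗ₜ 1 + 1 ⊗ₜ hPlus k +
        (T 1 - 1 : k[T;T⁻¹]) • (hPlus k ⊗ₜ hPlus k + eGen k ⊗ₜ fGen k) ∧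
      H.comul (eGen k) = eGen k ⊗ₜ 1 + 1 ⊗ₜ eGen k +
        (T 1 - 1 : k[T;T⁻¹]) • (hPlus k ⊗ₜ eGen k + eGen k ⊗ₜ hMinus k) ∧
      H.comul (fGen k) = fGen k ⊗ₜ 1 + 1 ⊗ₜ fGen k +
        (T 1 - 1 : k[T;T⁻¹]) • (fGen k ⊗ₜ hPlus k + hMinus k ⊗ₜ fGen k) ∧
      H.comul (hMinus k) = hMinus k ⊗ₜ 1 + 1 ⊗ₜ hMinus k +
        (T 1 - 1 : k[T;T⁻¹]) • (hMinus k ⊗ₜ hMinus k + fGen k ⊗ₜ eGen k) ∧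
      -- counit
      H.counit (hPlus k) = 0 ∧ H.counit (eGen k) = 0 ∧
      H.counit (fGen k) = 0 ∧ H.counit (hMinus k) = 0 ∧
      -- antipode
      H.antipode (hPlus k) = hMinus k ∧
      H.antipode (eGen k) = (-T (-1) : k[T;T⁻¹]) • eGen k ∧
      H.antipode (fGen k) = (-T 1 : k[T;T⁻¹]) • fGen k ∧
      H.antipode (hMinus k) = hPlus k ∧
      -- the Lie bialgebra `sl_2*`
      (∃ b : Module.Basis (Fin 3) k (SlDual 2 k), ⇑b = ![fDual k, hDual k, eDual k]) ∧
      ⁅hDual k, eDual k⁆ = eDual k ∧ ⁅hDual k, fDual k⁆ = fDual k ∧ ⁅eDual k, fDual k⁆ = 0 ∧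
      (slBialgebra 2 k).dual.cobracket (fDual k) =
        (2 : k) • (fDual k ⊗ₜ[k] hDual k - hDual k ⊗ₜ[k] fDual k) ∧
      (slBialgebra 2 k).dual.cobracket (hDual k) =
        eDual k ⊗ₜ[k] fDual k - fDual k ⊗ₜ[k] eDual k ∧
      (slBialgebra 2 k).dual.cobracket (eDual k) =
        (2 : k) • (hDual k ⊗ₜ[k] eDual k - eDual k ⊗ₜ[k] hDual k) ∧
      -- the isomorphism
      Φ (atOne k (hPlus k)) = UniversalEnvelopingAlgebra.ι k (hDual k) ∧
      Φ (atOne k (hMinus k)) = -UniversalEnvelopingAlgebra.ι k (hDual k) ∧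
      Φ (atOne k (eGen k)) = UniversalEnvelopingAlgebra.ι k (eDual k) ∧
      Φ (atOne k (fGen k)) = UniversalEnvelopingAlgebra.ι k (fDual k)) := by
  refine ⟨fun n => ⟨adjoin_rGen k n, span_Ftilde k n, _, _, _, _, _, specializesToDual n k⟩,
    hopfHat 2 k, hopfTilde 2 k, hopfOne 2 k, cobracketOne 2 k, (envEquivOne 2 k).symm,
    specializesToDual 2 k, adjoin_rank_one k, hPlus_mul_eGen k, hPlus_mul_fGen k,
    eGen_mul_hMinus k, fGen_mul_hMinus k, eGen_mul_fGen k, hPlus_commutator_hMinus k,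
    hMinus_add_hPlus k, ?_, ?_, ?_, ?_, counitTilde_rGen 2 k 0 0, counitTilde_rGen 2 k 0 1,
    counitTilde_rGen 2 k 1 0, counitTilde_rGen 2 k 1 1, antipode_hPlus k, antipode_eGen k,
    antipode_fGen k, antipode_hMinus k, exists_basis_slDual_two k, lie_hDual_eDual k,
    lie_hDual_fDual k, lie_eDual_fDual k, cobracket_fDual k, cobracket_hDual k, cobracket_eDual k,
    (specializesToDual 2 k).map_rGen 0 0, ?_, (specializesToDual 2 k).map_rGen 0 1,
    (specializesToDual 2 k).map_rGen 1 0⟩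
  · exact (comulTilde_rGen 2 k 0 0).trans (by rw [Fin.sum_univ_two, qSub])
  · exact (comulTilde_rGen 2 k 0 1).trans (by rw [Fin.sum_univ_two, qSub])
  · exact (comulTilde_rGen 2 k 1 0).trans
      (by rw [Fin.sum_univ_two, qSub])
  · exact (comulTilde_rGen 2 k 1 1).trans
      (by rw [Fin.sum_univ_two, qSub, add_comm (rGen k 1 0 ⊗ₜ rGen k 0 1)])
  · rw [(specializesToDual 2 k).map_rGen 1 1, slCoord_one_one, map_neg]
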